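/- Let $\omega$ be a free ultrafilter on the positive integers. For $k\ge 1$ let $\tau_k=\frac1k\mathrm{Tr}$ on $M_k(\mathbb C)$ and $\|(A_1,\dots,A_p)\|_2=\big(\sum_i\tau_k(A_i^*A_i)\big)^{1/2}$ on $M_k(\mathbb C)^p$. Let $M_k(\mathbb C)^\omega$ be the tracial ultraproduct: the norm bounded sequences $(X_k)_k$ with $X_k\in M_k(\mathbb C)$, modulo those with $\lim_{k\to\omega}\tau_k(X_k^*X_k)=0$, with trace $\tau_\omega([(X_k)_k])=\lim_{k\to\omega}\tau_k(X_k)$. Let $A$ be a von Neumann algebra with a faithful normal tracial state $\tau$, and $x_1,\dots,x_p\in A$. Let $\Theta(A)$ be the set of injective unital $*$-homomorphisms $\theta:A\to M_k(\mathbb C)^\omega$ with $\tau_\omega\circ\theta=\tau$. Let $\Xi$ be the set of sequences $\xi=(k_m)_{m\ge1}$ of positive integers with $k_m\to\infty$. For $R>0$ and $\xi=(k_m)_m\in\Xi$, let $\mathfrak N_{R,\xi}(x_1,\dots,x_p)$ be the set of all tuples of sequences $\big((Y_{1,k})_k,\dots,(Y_{p,k})_k\big)$, $Y_{i,k}\in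 M_k(\mathbb C)$, with $\|Y_{i,k}\|<R$ for all $i,k$, such that for some $\theta\in\Theta(A)$ $$\big|\tau_k(Y_{j_1,k}^{\epsilon_1}\cdots Y_{j_q,k}^{\epsilon_q})-\tau_\omega(\theta(x_{j_1})^{\epsilon_1}\cdots\theta(x_{j_q})^{\epsilon_q})\big|<\tfrac1m$$ for all $m\ge1$, $k\ge k_m$, $1\le q\le m$, $1\le j_1,\dots,j_q\le p$ and $\epsilon_1,\dots,\epsilon_q\in\{1,*\}$. Let $\Gamma_k=\Gamma_k(x;R,\xi)\subset M_k(\mathbb C)^p$ be the set of the $k$-th components of the elements of $\mathfrak N_{R,\xi}(x_1,\dots,x_p)$. For $\delta>0$ let $\nu_2(\Gamma_k,\delta)$ be the minimal number of open $\|\cdot\|_2$-balls of radius $\delta$ with centres in $\Gamma_k$ that cover $\Gamma_k$, and let $\nu(\Gamma_k,\delta)$ be the minimal number of orbit-balls $\{(A_i)_i:\ \|(A_i-WB_iW^*)_i\|_2<\delta\text{ for some unitary }W\in M_k(\mathbb C)\}$ with centres $(B_i)_i\in\Gamma_k$ that cover $\Gamma_k$. With $\log 0=-\infty$, put $$\delta_0^\omega(x_1,\dots,x_p)=\limsup_{\delta\to0^+}\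 \sup_{R>0,\,\xi\in\Xi}\ \lim_{k\to\omega}\frac{\log\nu_2(\Gamma_k,\delta)}{-k^2\log\delta},\qquad \mathcal H_1^\omega(x_1,\dots,x_p)=\limsup_{\delta\to0^+}\ \sup_{R>0,\,\xi\in\Xi}\ \lim_{k\to\omega}\frac{\log\nu(\Gamma_k,\delta)}{k^2}.$$ If $A$ is finitely generated, $\mathcal H_1^\omega(A)$ is the value of $\mathcal H_1^\omega$ on a finite family that generates $A$ as a von Neumann algebra (it does not depend on the family). **Theorem.** Let $\mathcal N$ be a finitely generated II$_1$ factor with tracial state $\tau$, and suppose that $\mathcal N$ has a faithful trace-preserving embedding into $M_k(\mathbb C)^\omega$. Suppose that there are finitely generated von Neumann subalgebras $\mathcal N_0,\mathcal N_1\subset\mathcal N$ with $\mathcal H_1^\omega(\mathcal N_0)<\infty$ and $\mathcal H_1^\omega(\mathcal N_1)<\infty$ (computed with the restrictions of $\tau$) and vectors $\xi_1,\dots,\xi_n\in L^2(\mathcal N,\tau)$ such that the $\|\cdot\|_2$-closed linear span of $\mathcal N_0\{\xi_1,\dots,\xi_n\}\mathcal N_1=\{a\,\xi_i\,b:\ a\in\mathcal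 N_0,\ b\in\mathcal N_1,\ 1\le i\le n\}$ is $L^2(\mathcal N,\tau)$. Then Voiculescu's embedding dimension of $\mathcal N$ is at most $1+2n$: for every finite family $x_1,\dots,x_p$ that generates $\mathcal N$ as a von Neumann algebra, $$\delta_0^\omega(x_1,\dots,x_p)\le 1+2n.$$ -/

import Mathlib

open Filter Topology
open scoped ENNReal InnerProductSpace

namespace EmbDim

noncomputable section

/-! ## Matrices: trace, trace norm, covering numbers -/

section Matrices

open scoped Matrix.Norms.L2Operator

/-- The `k × k` complex matrices, `k ≥ 1`; norms of matrices are operator norms. -/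
abbrev Mat (k : ℕ+) : Type := Matrix (Fin (k : ℕ)) (Fin (k : ℕ)) ℂ

instance instNonemptyFin (k : ℕ+) : Nonempty (Fin (k : ℕ)) := ⟨⟨0, k.pos⟩⟩

instance instNormOneClassMat (k : ℕ+) : NormOneClass (Mat k) := inferInstance

/-- The normalized trace `τ_k`. -/
def ntr {k : ℕ+} (A : Mat k) : ℂ := A.trace / ((k : ℕ) : ℂ)

/-- The trace norm `‖(A₁,…,Aₙ)‖₂ = (∑ᵢ τ_k(Aᵢ* Aᵢ))^{1/2}` on `n`-tuples of matrices. -/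
def tnorm {k : ℕ+} {n : ℕ} (A : Fin n → Mat k) : ℝ :=
  Real.sqrt (∑ i, (ntr (star (A i) * A i)).re)

/-- The open `δ`-ball around a tuple. -/
def traceBall {k : ℕ+} {n : ℕ} (δ : ℝ) (B : Fin n → Mat k) : Set (Fin n → Mat k) :=
  {A | tnorm (fun i => A i - B i) < δ}

/-- The `δ`-orbit-ball around a tuple. -/
def orbitBall {k : ℕ+} {n : ℕ} (δ : ℝ) (B : Fin n → Mat k) : Set (Fin n → Mat k) :=
  {A | ∃ W ∈ unitary (Mat k), tnorm (fun i => A i - W * B i * star W) < δ}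

/-- Minimal number of balls, with centres in `Γ`, that cover `Γ`. -/
def minCover {X : Type*} (ball : X → Set X) (Γ : Set X) : ℕ∞ :=
  ⨅ (F : Finset X) (_ : (F : Set X) ⊆ Γ ∧ Γ ⊆ ⋃ c ∈ F, ball c), (F.card : ℕ∞)

/-- The `δ`-covering number `ν₂(Γ, δ)`. -/
def coveringNumber {k : ℕ+} {n : ℕ} (Γ : Set (Fin n → Mat k)) (δ : ℝ) : ℕ∞ :=
  minCover (traceBall δ) Γ

/-- The `δ`-orbit covering number `ν(Γ, δ)`. -/
def orbitCoveringNumber {k : ℕ+} {n : ℕ} (Γ : Set (Fin n → Mat k)) (δ : ℝ) : ℕ∞ :=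
  minCover (orbitBall δ) Γ

/-! ### Elementary facts on the normalized Hilbert–Schmidt norm -/

/-- The square of the normalized Hilbert–Schmidt norm. -/
def hs {k : ℕ+} (A : Mat k) : ℝ := (∑ i, ∑ j, ‖A i j‖ ^ 2) / ((k : ℕ) : ℝ)

theorem hs_nonneg {k : ℕ+} (A : Mat k) : 0 ≤ hs A := by unfold hs; positivity

theorem ntr_star_mul_self {k : ℕ+} (A : Mat k) : ntr (star A * A) = (hs A : ℂ) := by
  simp only [ntr, hs, Matrix.trace, Matrix.diag, Matrix.mul_apply, Matrix.star_apply]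
  push_cast
  rw [Finset.sum_comm]
  congr 1
  refine Finset.sum_congr rfl fun i _ => Finset.sum_congr rfl fun j _ => ?_
  rw [← Complex.conj_mul']
  rfl

theorem hs_star {k : ℕ+} (A : Mat k) : hs (star A) = hs A := by
  simp only [hs, Matrix.star_apply, norm_star]
  rw [Finset.sum_comm]

theorem hs_neg {k : ℕ+} (A : Mat k) : hs (-A) = hs A := by
  simp [hs]

theorem hs_add_le {k : ℕ+} (A B : Mat k) : hs (A + B) ≤ 2 * hs A + 2 * hs B := by
  have h : ∀ i j, ‖(A + B) i j‖ ^ 2 ≤ 2 * ‖A i j‖ ^ 2 + 2 * ‖B i j‖ ^ 2 := fun i j => by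
    have h1 : ‖(A + B) i j‖ ≤ ‖A i j‖ + ‖B i j‖ := norm_add_le _ _
    nlinarith [norm_nonneg ((A + B) i j), norm_nonneg (A i j), norm_nonneg (B i j),
      sq_nonneg (‖A i j‖ - ‖B i j‖)]
  have h2 : ∑ i, ∑ j, ‖(A + B) i j‖ ^ 2
      ≤ 2 * (∑ i, ∑ j, ‖A i j‖ ^ 2) + 2 * (∑ i, ∑ j, ‖B i j‖ ^ 2) := by
    simp only [Finset.mul_sum, ← Finset.sum_add_distrib]
    exact Finset.sum_le_sum fun i _ => Finset.sum_le_sum fun j _ => h i j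
  have hk : (0 : ℝ) < ((k : ℕ) : ℝ) := by exact_mod_cast k.pos
  unfold hs
  rw [← mul_div_assoc, ← mul_div_assoc, ← add_div]
  gcongr

theorem hs_mul_le_left {k : ℕ+} (A B : Mat k) : hs (A * B) ≤ ‖A‖ ^ 2 * hs B := by
  have hcol : ∀ j, ∑ i, ‖(A * B) i j‖ ^ 2 ≤ ‖A‖ ^ 2 * ∑ i, ‖B i j‖ ^ 2 := fun j => by
    have h := Matrix.l2_opNorm_mulVec A (WithLp.toLp 2 (fun i => B i j))
    have h2 := pow_le_pow_left₀ (norm_nonneg _) h 2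
    rw [mul_pow, EuclideanSpace.norm_sq_eq, EuclideanSpace.norm_sq_eq] at h2
    exact h2
  have hk : (0 : ℝ) < ((k : ℕ) : ℝ) := by exact_mod_cast k.pos
  unfold hs
  rw [← mul_div_assoc]
  gcongr
  rw [Finset.sum_comm, Finset.sum_comm (f := fun i j => ‖B i j‖ ^ 2), Finset.mul_sum]
  exact Finset.sum_le_sum fun j _ => hcol j

theorem hs_mul_le_right {k : ℕ+} (A B : Mat k) : hs (A * B) ≤ ‖B‖ ^ 2 * hs A := by
  have h := hs_mul_le_left (star B) (star A)
  rwa [← star_mul, hs_star, hs_star, norm_star] at h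

theorem norm_ntr_sq_le {k : ℕ+} (A : Mat k) : ‖ntr A‖ ^ 2 ≤ hs A := by
  have hk : (0 : ℝ) < ((k : ℕ) : ℝ) := by exact_mod_cast k.pos
  have h1 : ‖A.trace‖ ≤ ∑ i, ‖A i i‖ := norm_sum_le _ _
  have h2 : (∑ i, ‖A i i‖) ^ 2 ≤ ((k : ℕ) : ℝ) * ∑ i, ‖A i i‖ ^ 2 := by
    simpa using sq_sum_le_card_mul_sum_sq (s := Finset.univ) (f := fun i => ‖A i i‖)
  have h3 : ∑ i, ‖A i i‖ ^ 2 ≤ ∑ i, ∑ j, ‖A i j‖ ^ 2 :=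
    Finset.sum_le_sum fun i _ => Finset.single_le_sum (f := fun j => ‖A i j‖ ^ 2)
      (fun j _ => by positivity) (Finset.mem_univ i)
  have h4 : ‖A.trace‖ ^ 2 ≤ ((k : ℕ) : ℝ) * ∑ i, ∑ j, ‖A i j‖ ^ 2 :=
    (pow_le_pow_left₀ (norm_nonneg _) h1 2).trans (h2.trans (by gcongr))
  unfold ntr hs
  rw [norm_div, div_pow, Complex.norm_natCast, div_le_div_iff₀ (by positivity) hk]
  nlinarith

theorem ntr_sub {k : ℕ+} (A B : Mat k) : ntr (A - B) = ntr A - ntr B := by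
  simp [ntr, Matrix.trace_sub, sub_div]

/-! ## The tracial ultraproduct of the matrix algebras -/

/-- The C*-algebra of all norm bounded sequences `(X_k)_k`, `X_k` a `k × k` matrix. -/
abbrev BddSeq : Type := lp (fun k : ℕ+ => Mat k) ∞

/-- `X - Y` lies in the `0`-ideal of the trace: `lim_{k → ω} τ_k((X_k - Y_k)*(X_k - Y_k)) = 0`. -/
def NullRel (ω : Ultrafilter ℕ+) (X Y : BddSeq) : Prop :=
  Tendsto (fun k => ntr (star (X k - Y k) * (X k - Y k))) (ω : Filter ℕ+) (𝓝 0)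

theorem nullRel_iff (ω : Ultrafilter ℕ+) (X Y : BddSeq) :
    NullRel ω X Y ↔ Tendsto (fun k => hs (X k - Y k)) (ω : Filter ℕ+) (𝓝 0) := by
  simp only [NullRel, ntr_star_mul_self]
  constructor
  · intro h
    simpa [Function.comp_def] using (Complex.continuous_re.tendsto 0).comp h
  · intro h
    simpa [Function.comp_def] using (Complex.continuous_ofReal.tendsto 0).comp h

/-- The congruence on bounded sequences given by the `0`-ideal of the trace along `ω`. -/
def nullCon (ω : Ultrafilter ℕ+) : RingCon BddSeq where
  r := NullRel ω
  iseqv := by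
    refine ⟨fun X => ?_, fun {X Y} h => ?_, fun {X Y Z} h h' => ?_⟩
    · rw [nullRel_iff]
      simp [hs]
    · rw [nullRel_iff] at h ⊢
      refine h.congr fun k => ?_
      rw [← hs_neg, neg_sub]
    · rw [nullRel_iff] at h h' ⊢
      refine squeeze_zero (fun k => hs_nonneg _) (fun k => ?_)
        (by simpa using (h.const_mul 2).add (h'.const_mul 2))
      have := hs_add_le (X k - Y k) (Y k - Z k)
      rwa [sub_add_sub_cancel] at this
  mul' := by
    intro X X' Y Y' h h'
    change NullRel ω _ _ at h h' ⊢
    rw [nullRel_iff] at h h' ⊢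
    refine squeeze_zero (fun k => hs_nonneg _) (fun k => ?_)
      (by simpa using (h.const_mul (2 * ‖Y‖ ^ 2)).add (h'.const_mul (2 * ‖X'‖ ^ 2)))
    have e : (X * Y) k - (X' * Y') k = (X k - X' k) * Y k + X' k * (Y k - Y' k) := by
      simp only [lp.infty_coeFn_mul, Pi.mul_apply]
      noncomm_ring
    rw [e]
    have h1 := hs_add_le ((X k - X' k) * Y k) (X' k * (Y k - Y' k))
    have h2 := hs_mul_le_right (X k - X' k) (Y k)
    have h3 := hs_mul_le_left (X' k) (Y k - Y' k)
    have h4 : ‖Y k‖ ^ 2 ≤ ‖Y‖ ^ 2 :=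
      pow_le_pow_left₀ (norm_nonneg _) (lp.norm_apply_le_norm (by simp) Y k) 2
    have h5 : ‖X' k‖ ^ 2 ≤ ‖X'‖ ^ 2 :=
      pow_le_pow_left₀ (norm_nonneg _) (lp.norm_apply_le_norm (by simp) X' k) 2
    have h6 := mul_le_mul_of_nonneg_right h4 (hs_nonneg (X k - X' k))
    have h7 := mul_le_mul_of_nonneg_right h5 (hs_nonneg (Y k - Y' k))
    linarith
  add' := by
    intro X X' Y Y' h h'
    change NullRel ω _ _ at h h' ⊢
    rw [nullRel_iff] at h h' ⊢
    refine squeeze_zero (fun k => hs_nonneg _) (fun k => ?_)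
      (by simpa using (h.const_mul 2).add (h'.const_mul 2))
    have e : (X + Y) k - (X' + Y') k = (X k - X' k) + (Y k - Y' k) := by
      simp only [lp.coeFn_add, Pi.add_apply]
      abel
    rw [e]
    exact hs_add_le _ _

/-- The tracial ultraproduct `M_k(ℂ)^ω`. -/
def MatUltra (ω : Ultrafilter ℕ+) : Type := (nullCon ω).Quotient

instance instRingMatUltra (ω : Ultrafilter ℕ+) : Ring (MatUltra ω) :=
  inferInstanceAs (Ring (nullCon ω).Quotient)

instance instAlgebraMatUltra (ω : Ultrafilter ℕ+) : Algebra ℂ (MatUltra ω) :=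
  inferInstanceAs (Algebra ℂ (nullCon ω).Quotient)

/-- The class `[(X_k)_k]` of a bounded sequence. -/
def MatUltra.mk (ω : Ultrafilter ℕ+) (X : BddSeq) : MatUltra ω := (nullCon ω).mk' X

theorem nullRel_star {ω : Ultrafilter ℕ+} {X Y : BddSeq} (h : NullRel ω X Y) :
    NullRel ω (star X) (star Y) := by
  rw [nullRel_iff] at h ⊢
  refine h.congr fun k => ?_
  rw [← hs_star, star_sub]
  rfl

instance instStarMatUltra (ω : Ultrafilter ℕ+) : Star (MatUltra ω) where
  star := Quotient.map' star fun _ _ h => nullRel_star h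

instance instStarRingMatUltra (ω : Ultrafilter ℕ+) : StarRing (MatUltra ω) where
  star_involutive := by
    rintro ⟨X⟩
    exact congrArg (MatUltra.mk ω) (star_star X)
  star_mul := by
    rintro ⟨X⟩ ⟨Y⟩
    exact congrArg (MatUltra.mk ω) (star_mul X Y)
  star_add := by
    rintro ⟨X⟩ ⟨Y⟩
    exact congrArg (MatUltra.mk ω) (star_add X Y)

instance instStarModuleMatUltra (ω : Ultrafilter ℕ+) : StarModule ℂ (MatUltra ω) where
  star_smul := by
    rintro c ⟨X⟩
    exact congrArg (MatUltra.mk ω) (star_smul c X)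

theorem limUnder_eq_of_nullRel {ω : Ultrafilter ℕ+} {X Y : BddSeq} (h : NullRel ω X Y) :
    limUnder (ω : Filter ℕ+) (fun k => ntr (X k)) =
      limUnder (ω : Filter ℕ+) (fun k => ntr (Y k)) := by
  have h0 : Tendsto (fun k => ntr (X k) - ntr (Y k)) (ω : Filter ℕ+) (𝓝 0) := by
    rw [nullRel_iff] at h
    have h1 : Tendsto (fun k => √(hs (X k - Y k))) (ω : Filter ℕ+) (𝓝 0) := by
      simpa [Function.comp_def] using (Real.continuous_sqrt.tendsto 0).comp h
    refine squeeze_zero_norm (fun k => ?_) h1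
    rw [← ntr_sub]
    exact Real.le_sqrt_of_sq_le (norm_ntr_sq_le _)
  have key : ∀ z : ℂ, Tendsto (fun k => ntr (X k)) (ω : Filter ℕ+) (𝓝 z) ↔
      Tendsto (fun k => ntr (Y k)) (ω : Filter ℕ+) (𝓝 z) := fun z => by
    constructor
    · intro hX
      simpa using hX.sub h0
    · intro hY
      simpa using hY.add h0
  unfold limUnder lim
  congr 1
  funext z
  exact propext (key z)

/-- The trace `τ_ω([(X_k)_k]) = lim_{k → ω} τ_k(X_k)` on `M_k(ℂ)^ω`. -/
def ultraTrace (ω : Ultrafilter ℕ+) : MatUltra ω → ℂ :=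
  Quotient.lift (fun X : BddSeq => limUnder (ω : Filter ℕ+) (fun k => ntr (X k)))
    fun _ _ h => limUnder_eq_of_nullRel h

/-! ## Embeddings and embedding dimensions

Here `A` is a *-algebra with a linear functional `τ`; these notions will be used for von Neumann
algebras with a faithful normal tracial state. -/

/-- `Θ(A, M_k(ℂ)^ω)`: the faithful trace preserving embeddings. -/
def Embeddings (ω : Ultrafilter ℕ+) {A : Type*} [Ring A] [StarRing A] [Algebra ℂ A]
    (τ : A →ₗ[ℂ] ℂ) : Set (A →⋆ₐ[ℂ] MatUltra ω) :=
  {θ | Function.Injective θ ∧ ∀ a, ultraTrace ω (θ a) = τ a}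

/-- `Ξ`: the sequences `(k_m)_{m ≥ 1}` of positive integers with `k_m → ∞`. -/
def Radii : Set (ℕ+ → ℕ+) := {ξ | Tendsto ξ atTop atTop}

/-- The value at `y` of a *-monomial `y_{j₁}^{ε₁} ⋯ y_{j_p}^{ε_p}`, which is given by the list of
the `(j_i, ε_i)`, with `true` for `*` and `false` for `1`. -/
def wordEval {A : Type*} [Monoid A] [Star A] {n : ℕ} (y : Fin n → A)
    (w : List (Fin n × Bool)) : A :=
  (w.map fun q => if q.2 then star (y q.1) else y q.1).prod

/-- The neighbourhood `𝔑_{R,ξ}(y₁,…,yₙ)` of a tuple in `M_k(ℂ)^ω`. -/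
def nbhd {ω : Ultrafilter ℕ+} {n : ℕ} (R : ℝ) (ξ : ℕ+ → ℕ+) (y : Fin n → MatUltra ω) :
    Set (Fin n → ∀ k : ℕ+, Mat k) :=
  {Y | (∀ i k, ‖Y i k‖ < R) ∧
    ∀ m k : ℕ+, ξ m ≤ k → ∀ w : List (Fin n × Bool), 1 ≤ w.length → w.length ≤ (m : ℕ) →
      ‖ntr (wordEval (fun i => Y i k) w) - ultraTrace ω (wordEval y w)‖ < 1 / ((m : ℕ) : ℝ)}

/-- The neighbourhood `𝔑_{R,ξ}(x₁,…,xₙ)` of a tuple in `A`: the union over all embeddings. -/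
def nbhdOf (ω : Ultrafilter ℕ+) {A : Type*} [Ring A] [StarRing A] [Algebra ℂ A]
    (τ : A →ₗ[ℂ] ℂ) {n : ℕ} (x : Fin n → A) (R : ℝ) (ξ : ℕ+ → ℕ+) :
    Set (Fin n → ∀ k : ℕ+, Mat k) :=
  ⋃ θ ∈ Embeddings ω τ, nbhd R ξ fun i => θ (x i)

/-- The image of a set of tuples of sequences under the projection `ℙ_k`. -/
def projAt {n : ℕ} (k : ℕ+) (S : Set (Fin n → ∀ k : ℕ+, Mat k)) : Set (Fin n → Mat k) :=
  (fun Y i => Y i k) '' S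

/-- `log N` for a covering number `N`, with `log 0 = -∞`. -/
def logCount (N : ℕ∞) : EReal := ENNReal.log (N : ℝ≥0∞)

/-- `δ₀^ω(x₁,…,xₙ; R, ξ, δ)`. -/
def delta0At (ω : Ultrafilter ℕ+) {A : Type*} [Ring A] [StarRing A] [Algebra ℂ A]
    (τ : A →ₗ[ℂ] ℂ) {n : ℕ} (x : Fin n → A) (R : ℝ) (ξ : ℕ+ → ℕ+) (δ : ℝ) : EReal :=
  limUnder (ω : Filter ℕ+) fun k =>
    logCount (coveringNumber (projAt k (nbhdOf ω τ x R ξ)) δ) /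
      ((-(((k : ℕ) : ℝ) ^ 2 * Real.log δ) : ℝ) : EReal)

/-- Voiculescu's embedding dimension `δ₀^ω(x₁,…,xₙ)` of a tuple. -/
def delta0 (ω : Ultrafilter ℕ+) {A : Type*} [Ring A] [StarRing A] [Algebra ℂ A]
    (τ : A →ₗ[ℂ] ℂ) {n : ℕ} (x : Fin n → A) : EReal :=
  limsup (fun δ : ℝ => ⨆ (R : ℝ) (_ : 0 < R) (ξ : ℕ+ → ℕ+) (_ : ξ ∈ Radii),
    delta0At ω τ x R ξ δ) (𝓝[>] 0)

/-- `ℋ_s^ω(x₁,…,xₙ; R, ξ, δ)`. -/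
def embDimAt (s : ℝ) (ω : Ultrafilter ℕ+) {A : Type*} [Ring A] [StarRing A] [Algebra ℂ A]
    (τ : A →ₗ[ℂ] ℂ) {n : ℕ} (x : Fin n → A) (R : ℝ) (ξ : ℕ+ → ℕ+) (δ : ℝ) : EReal :=
  limUnder (ω : Filter ℕ+) fun k =>
    logCount (orbitCoveringNumber (projAt k (nbhdOf ω τ x R ξ)) δ) /
      (((((k : ℕ) : ℝ) ^ (2 * s) : ℝ)) : EReal)

/-- The `s`-embedding dimension `ℋ_s^ω(x₁,…,xₙ)` of a tuple. -/
def embDim (s : ℝ) (ω : Ultrafilter ℕ+) {A : Type*} [Ring A] [StarRing A] [Algebra ℂ A]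
    (τ : A →ₗ[ℂ] ℂ) {n : ℕ} (x : Fin n → A) : EReal :=
  limsup (fun δ : ℝ => ⨆ (R : ℝ) (_ : 0 < R) (ξ : ℕ+ → ℕ+) (_ : ξ ∈ Radii),
    embDimAt s ω τ x R ξ δ) (𝓝[>] 0)

end Matrices

/-! ## Tracial von Neumann algebras -/

section VonNeumann

open scoped ComplexOrder

variable {H : Type*} [NormedAddCommGroup H] [InnerProductSpace ℂ H] [CompleteSpace H]

/-- A faithful normal tracial state on a von Neumann algebra; normal means ultraweakly
continuous. -/
structure FaithfulNormalTrace (N : VonNeumannAlgebra H) where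
  /-- The underlying linear functional. -/
  toLin : N.toStarSubalgebra →ₗ[ℂ] ℂ
  nonneg : ∀ a, 0 ≤ toLin (star a * a)
  map_one : toLin 1 = 1
  tracial : ∀ a b, toLin (a * b) = toLin (b * a)
  faithful : ∀ a, toLin (star a * a) = 0 → a = 0
  normal : ∃ η ζ : ℕ → H, Summable (fun i => ‖η i‖ ^ 2) ∧ Summable (fun i => ‖ζ i‖ ^ 2) ∧
    ∀ a : N.toStarSubalgebra, HasSum (fun i => ⟪η i, (a : H →L[ℂ] H) (ζ i)⟫_ℂ) (toLin a)

/-- `N` is a factor of type II₁: an infinite dimensional algebra with trivial centre that has a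
faithful normal tracial state. -/
def IsIIOneFactor (N : VonNeumannAlgebra H) : Prop :=
  (∀ a ∈ N, a ∈ N.commutant → ∃ c : ℂ, a = c • (1 : H →L[ℂ] H)) ∧
    ¬ FiniteDimensional ℂ N.toStarSubalgebra ∧ Nonempty (FaithfulNormalTrace N)

/-- `x₁,…,xₙ` generate `N` as a von Neumann algebra: `N` is the double commutant of
`{x₁,…,xₙ,x₁*,…,xₙ*}`. -/
def Generates (N : VonNeumannAlgebra H) {n : ℕ} (x : Fin n → N.toStarSubalgebra) : Prop :=
  Set.centralizer (Set.centralizer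
    {a : H →L[ℂ] H | ∃ i, a = (x i : H →L[ℂ] H) ∨ a = star (x i : H →L[ℂ] H)}) =
      (N : Set (H →L[ℂ] H))

/-- `N` is finitely generated as a von Neumann algebra. -/
def FinitelyGenerated (N : VonNeumannAlgebra H) : Prop :=
  ∃ (n : ℕ) (x : Fin n → N.toStarSubalgebra), Generates N x

/-- The inclusion of a von Neumann subalgebra. -/
def incl {N₀ N : VonNeumannAlgebra H} (h : N₀ ≤ N) :
    N₀.toStarSubalgebra →⋆ₐ[ℂ] N.toStarSubalgebra :=
  StarSubalgebra.inclusion (S₁ := N₀.toStarSubalgebra) (S₂ := N.toStarSubalgebra) h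

/-- The restriction of a trace to a von Neumann subalgebra. -/
def FaithfulNormalTrace.restrict {N₀ N : VonNeumannAlgebra H} (τ : FaithfulNormalTrace N)
    (h : N₀ ≤ N) : FaithfulNormalTrace N₀ where
  toLin := τ.toLin.comp (incl h).toAlgHom.toLinearMap
  nonneg a := τ.nonneg (incl h a)
  map_one := τ.map_one
  tracial a b := τ.tracial (incl h a) (incl h b)
  faithful a ha := by
    have h1 : incl h a = 0 := τ.faithful _ ha
    exact Subtype.ext (congrArg (fun z : N.toStarSubalgebra => (z : H →L[ℂ] H)) h1)
  normal := by
    obtain ⟨η, ζ, hη, hζ, hs⟩ := τ.normal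
    exact ⟨η, ζ, hη, hζ, fun a => hs (incl h a)⟩

/-- `ℋ_s^ω(N)`: the value of `ℋ_s^ω` at the families of generators of `N` (it does not depend on
the family; the infimum is over all finite families, so that it is `+∞` if there are none). -/
def algEmbDim (s : ℝ) (ω : Ultrafilter ℕ+) (N : VonNeumannAlgebra H)
    (τ : FaithfulNormalTrace N) : EReal :=
  ⨅ (n : ℕ) (x : Fin n → N.toStarSubalgebra) (_ : Generates N x), embDim s ω τ.toLin x

/-! ### The standard Hilbert space `L²(N, τ)` with its two actions -/

theorem isClosed_vonNeumann (N : VonNeumannAlgebra H) :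
    IsClosed (N.toStarSubalgebra : Set (H →L[ℂ] H)) := by
  have h : (N.toStarSubalgebra : Set (H →L[ℂ] H)) =
      ⋂ b ∈ Set.centralizer (N : Set (H →L[ℂ] H)), {a | b * a = a * b} := by
    rw [VonNeumannAlgebra.coe_toStarSubalgebra]
    conv_lhs => rw [← N.centralizer_centralizer]
    ext a
    simp only [Set.mem_iInter, Set.mem_ofPred_eq]
    rfl
  rw [h]
  exact isClosed_biInter fun b _ =>
    isClosed_eq (continuous_const.mul continuous_id) (continuous_id.mul continuous_const)

theorem exists_star_mul_self_eq {A : Type*} [CStarAlgebra A] (a x : A) :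
    ∃ c : A, star c * c = ((‖a‖ ^ 2 : ℝ) : ℂ) • (star x * x) - star x * (star a * a) * x := by
  let _ : PartialOrder A := CStarAlgebra.spectralOrder _
  have _ : StarOrderedRing A := CStarAlgebra.spectralOrderedRing _
  have h : 0 ≤ ((‖a‖ ^ 2 : ℝ) : ℂ) • (star x * x) - star x * (star a * a) * x := by
    have h0 := CStarAlgebra.star_left_conjugate_le_norm_smul (a := x) (b := star a * a)
    rw [CStarRing.norm_star_mul_self, ← sq] at h0
    exact sub_nonneg.2 h0
  obtain ⟨c, hc⟩ := CStarAlgebra.nonneg_iff_eq_star_mul_self.1 h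
  exact ⟨c, hc.symm⟩

variable {N : VonNeumannAlgebra H}

/-- `N` as a vector space, to carry the inner product `⟨a, b⟩ = τ(a* b)`. -/
def PreL2 (_τ : FaithfulNormalTrace N) : Type _ := N.toStarSubalgebra

namespace PreL2

variable (τ : FaithfulNormalTrace N)

instance : AddCommGroup (PreL2 τ) := inferInstanceAs (AddCommGroup N.toStarSubalgebra)
instance : Module ℂ (PreL2 τ) := inferInstanceAs (Module ℂ N.toStarSubalgebra)

/-- The identity map `N → PreL2 τ`. -/
def of : N.toStarSubalgebra ≃ₗ[ℂ] PreL2 τ := LinearEquiv.refl ℂ _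

end PreL2

theorem FaithfulNormalTrace.map_star (τ : FaithfulNormalTrace N) (a : N.toStarSubalgebra) :
    τ.toLin (star a) = star (τ.toLin a) := by
  have h1 := (Complex.le_def.1 (τ.nonneg (1 + a))).2
  have h2 := (Complex.le_def.1 (τ.nonneg (1 + Complex.I • a))).2
  have h3 := (Complex.le_def.1 (τ.nonneg a)).2
  simp only [star_add, star_one, star_smul, add_mul, mul_add, one_mul, mul_one, map_add,
    smul_mul_assoc, mul_smul_comm, map_smul, τ.map_one] at h1 h2
  simp at h1 h2 h3
  apply Complex.ext
  · simp
    linarith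
  · simp
    linarith

namespace PreL2

variable (τ : FaithfulNormalTrace N)

/-- The inner product `⟨a, b⟩ = τ(a* b)`. -/
abbrev core : InnerProductSpace.Core ℂ (PreL2 τ) where
  inner a b := τ.toLin (star ((of τ).symm a) * (of τ).symm b)
  conj_inner_symm a b := by
    have h := τ.map_star (star ((of τ).symm b) * (of τ).symm a)
    rw [star_mul, star_star] at h
    exact h.symm
  re_inner_nonneg a := (Complex.le_def.1 (τ.nonneg ((of τ).symm a))).1
  add_left a b c := by simp [add_mul]
  smul_left a b r := by simp
  definite a h := (of τ).symm.injective (by simpa using τ.faithful _ h)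

instance : NormedAddCommGroup (PreL2 τ) :=
  InnerProductSpace.Core.toNormedAddCommGroup (cd := core τ)
instance : InnerProductSpace ℂ (PreL2 τ) := InnerProductSpace.ofCore (core τ).toCore

theorem inner_def (a b : PreL2 τ) :
    ⟪a, b⟫_ℂ = τ.toLin (star ((of τ).symm a) * (of τ).symm b) := rfl

theorem norm_sq (a : N.toStarSubalgebra) : ‖of τ a‖ ^ 2 = (τ.toLin (star a * a)).re := by
  rw [← inner_self_eq_norm_sq (𝕜 := ℂ), inner_def]
  simp

theorem norm_mul_le (a x : N.toStarSubalgebra) : ‖of τ (a * x)‖ ≤ ‖a‖ * ‖of τ x‖ := by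
  have := isClosed_vonNeumann N
  obtain ⟨c, hc⟩ := exists_star_mul_self_eq (A := N.toStarSubalgebra) a x
  have h1 := (Complex.le_def.1 (τ.nonneg c)).1
  rw [hc, map_sub, map_smul, Complex.sub_re, smul_eq_mul, Complex.re_ofReal_mul] at h1
  rw [← sq_le_sq₀ (norm_nonneg _) (by positivity), mul_pow, norm_sq, norm_sq, star_mul]
  simp only [Complex.zero_re, mul_assoc] at h1 ⊢
  linarith

theorem norm_star (a : N.toStarSubalgebra) : ‖of τ (star a)‖ = ‖of τ a‖ := by
  rw [← sq_eq_sq₀ (norm_nonneg _) (norm_nonneg _), norm_sq, norm_sq, star_star, τ.tracial]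

/-- Left multiplication by `a`. -/
def left (a : N.toStarSubalgebra) : PreL2 τ →L[ℂ] PreL2 τ :=
  ((of τ).toLinearMap ∘ₗ LinearMap.mulLeft ℂ a ∘ₗ (of τ).symm.toLinearMap).mkContinuous ‖a‖
    fun x => by simpa using norm_mul_le τ a ((of τ).symm x)

/-- Right multiplication by `b`. -/
def right (b : N.toStarSubalgebra) : PreL2 τ →L[ℂ] PreL2 τ :=
  ((of τ).toLinearMap ∘ₗ LinearMap.mulRight ℂ b ∘ₗ (of τ).symm.toLinearMap).mkContinuous ‖b‖
    fun x => by
      have h := norm_mul_le τ (star b) (star ((of τ).symm x))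
      rw [← star_mul, norm_star, norm_star, _root_.norm_star] at h
      simpa using h

end PreL2

/-- `L²(N, τ)`: the completion of `N` for the norm `‖a‖₂ = τ(a* a)^{1/2}`. -/
abbrev L2 (τ : FaithfulNormalTrace N) : Type _ := UniformSpace.Completion (PreL2 τ)

/-- The vector `a ξ b` of `L²(N, τ)`, for `a, b` in `N` and a vector `ξ`. -/
def bimodAct (τ : FaithfulNormalTrace N) (a b : N.toStarSubalgebra) (ξ : L2 τ) : L2 τ :=
  (PreL2.left τ a).completion ((PreL2.right τ b).completion ξ)

/-- The closed linear span of `N₀ {ξ₁,…,ξₙ} N₁` in `L²(N, τ)`. -/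
def closedBimodSpan (τ : FaithfulNormalTrace N) {N₀ N₁ : VonNeumannAlgebra H} (h₀ : N₀ ≤ N)
    (h₁ : N₁ ≤ N) {n : ℕ} (ξ : Fin n → L2 τ) : Submodule ℂ (L2 τ) :=
  (Submodule.span ℂ {v : L2 τ | ∃ (a : N₀.toStarSubalgebra) (b : N₁.toStarSubalgebra) (i : Fin n),
    v = bimodAct τ (incl h₀ a) (incl h₁ b) (ξ i)}).topologicalClosure

end VonNeumann

end

end EmbDim

namespace EmbDim

noncomputable section

set_option linter.unusedSectionVars false

/-! The proof counts parameters of microstates. Let `y₀`, `y₁` generate the two subalgebras. Since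
the bimodule span is dense, `1` and each `x_j` are 2-norm close to finite sums `∑ p(y₀) Q_i(x)
q(y₁)` with *-polynomials `p`, `Q_i`, `q` and `1 ≤ i ≤ n`. A microstate `X` of `x` extends to joint
microstates `(X, X', Y₀, Y₁)`, where `X'` is another copy of `x` (`exists_joint_microstates`), and
these satisfy the same approximate equations. Finiteness of `ℋ₁` gives nets of `exp(O(k²))` orbit
representatives, so `Y₀ ≈ U B₀ U*` and `Y₁ ≈ V B₁ V*` with `B₀`, `B₁` in the nets. Polynomials
commute with unitary conjugation, hence `X'_j ≈ U L_j(Z) V*` and `1 ≈ U L_0(Z) V*`, with `Z_i = U*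
Q_i(X) V`, where `L` is a linear map on `M_k(ℂ)^n` that depends only on `(B₀, B₁)`
(`exists_factored`).

For fixed `(B₀, B₁)` the tuple `L(Z)` lies in a space of real dimension at most `2nk²`, and `U` in
the unitary group, of dimension `k²`. The unitary `V` costs nothing, because the equation for `1`
says `U*V ≈ L_0(Z)` (`IsFactored.hsNorm_sub_le`). Nets of mesh proportional to `δ` thus cover all
microstates by `exp(O(k²)) (c/δ)^{(2n+1)k²}` balls of radius `δ` (`coveringNumber_le_of_factored`).
Division by `-k² log δ` leaves `2n+1` as `δ → 0`; the orbit nets contribute only a constant over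
`-log δ`.

The supremum over `R` and `ξ` is taken inside the limit in `δ`, so `c` must not depend on them. This
is the purpose of `X'`: by a Kaplansky type argument (`exists_bounded_poly`) the added microstates
have operator norms bounded independently of `R`. Only the mesh of the orbit nets depends on `R` and
on the polynomials, and it is harmless, since the `ℋ₁` bound is uniform in small meshes. -/

/-! ## Noncommutative *-polynomials -/

/-- Complex polynomials in noncommuting variables `y_i` and `y_i*`, `i : ι`. -/
abbrev StarPoly (ι : Type*) : Type _ := MonoidAlgebra ℂ (FreeMonoid (ι × Bool))

/-- The value of the letter `(i, ε)`. -/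
def letter {ι A : Type*} [Star A] (y : ι → A) (q : ι × Bool) : A :=
  if q.2 then star (y q.1) else y q.1

/-- The value of a word. -/
def wordVal {ι A : Type*} [Monoid A] [Star A] (y : ι → A) (w : List (ι × Bool)) : A :=
  (w.map (letter y)).prod

theorem wordEval_eq_wordVal {A : Type*} [Monoid A] [Star A] {n : ℕ} (y : Fin n → A)
    (w : List (Fin n × Bool)) : wordEval y w = wordVal y w := rfl

theorem wordVal_map {ι κ A : Type*} [Monoid A] [Star A] (f : κ → ι) (y : ι → A)
    (w : List (κ × Bool)) :
    wordVal y (w.map (Prod.map f id)) = wordVal (y ∘ f) w := by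
  simp only [wordVal, List.map_map]
  rfl

namespace StarPoly

section Algebra

variable {ι A : Type*} [Ring A] [StarRing A] [Algebra ℂ A]

/-- Evaluation of *-polynomials. -/
def ev (y : ι → A) : StarPoly ι →ₐ[ℂ] A :=
  MonoidAlgebra.lift ℂ A (FreeMonoid (ι × Bool)) (FreeMonoid.lift (letter y))

/-- The monomial of a word. -/
def word (w : List (ι × Bool)) : StarPoly ι := MonoidAlgebra.single (FreeMonoid.ofList w) 1

/-- The variables. -/
def var (q : ι × Bool) : StarPoly ι := word [q]

@[simp] theorem ev_word (y : ι → A) (w : List (ι × Bool)) : ev y (word w) = wordVal y w := by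
  simp [ev, word, wordVal, FreeMonoid.lift_apply]

@[simp] theorem ev_var (y : ι → A) (q : ι × Bool) : ev y (var q) = letter y q := by
  simp [var, wordVal]

theorem word_cons (q : ι × Bool) (w : List (ι × Bool)) : word (q :: w) = var q * word w := by
  simp only [word, var, MonoidAlgebra.single_mul_single, one_mul]
  rfl

theorem word_induction {C : StarPoly ι → Prop} (Q : StarPoly ι) (hw : ∀ w, C (word w))
    (hadd : ∀ P Q, C P → C Q → C (P + Q)) (hsmul : ∀ (c : ℂ) P, C P → C (c • P)) : C Q :=
  MonoidAlgebra.induction_on Q (fun w => hw w) hadd hsmul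

/-- This form serves properties that are compatible with products; properties of traces are only
linear and go through `word_induction`. -/
theorem poly_induction {C : StarPoly ι → Prop} (Q : StarPoly ι) (h1 : C 1) (hv : ∀ q, C (var q))
    (hadd : ∀ P Q, C P → C Q → C (P + Q)) (hmul : ∀ P Q, C P → C Q → C (P * Q))
    (hsmul : ∀ (c : ℂ) P, C P → C (c • P)) : C Q := by
  refine word_induction Q (fun w => ?_) hadd hsmul
  induction w with
  | nil => exact h1
  | cons q w ih => rw [word_cons]; exact hmul _ _ (hv q) ih

/-- The formal adjoint of a word. -/
def starWord (w : List (ι × Bool)) : List (ι × Bool) := (w.map (Prod.map id not)).reverse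

theorem letter_not (y : ι → A) (q : ι × Bool) : letter y (Prod.map id not q) = star (letter y q) := by
  rcases q with ⟨i, b⟩
  cases b <;> simp [letter]

/-- The formal adjoint of a *-polynomial. -/
def adj (Q : StarPoly ι) : StarPoly ι :=
  ∑ w ∈ Q.coeff.support, star (Q.coeff w) • word (starWord w.toList)

theorem wordVal_starWord (y : ι → A) (w : List (ι × Bool)) :
    wordVal y (starWord w) = star (wordVal y w) := by
  induction w with
  | nil => simp [wordVal, starWord]
  | cons q w ih =>
    have h : starWord (q :: w) = starWord w ++ [Prod.map id not q] := by simp [starWord]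
    have h2 : wordVal y (starWord (q :: w)) =
        wordVal y (starWord w) * letter y (Prod.map id not q) := by
      rw [h]; simp [wordVal]
    rw [h2, ih, letter_not, ← star_mul]
    simp [wordVal]

theorem ev_adj [StarModule ℂ A] (y : ι → A) (Q : StarPoly ι) : ev y (adj Q) = star (ev y Q) := by
  have h : ev y Q = ∑ w ∈ Q.coeff.support, Q.coeff w • wordVal y w.toList := by
    rw [ev, MonoidAlgebra.lift_apply, Finsupp.sum]
    simp only [FreeMonoid.lift_apply, wordVal]
  rw [h, adj, map_sum, star_sum]
  refine Finset.sum_congr rfl fun w _ => ?_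
  rw [map_smul, ev_word, star_smul, wordVal_starWord]

theorem ev_comp {B : Type*} [Ring B] [StarRing B] [Algebra ℂ B] (φ : A →⋆ₐ[ℂ] B) (y : ι → A)
    (Q : StarPoly ι) : ev (fun i => φ (y i)) Q = φ (ev y Q) := by
  induction Q using poly_induction with
  | h1 => simp
  | hv q => rcases q with ⟨i, b⟩; cases b <;> simp [letter, map_star]
  | hadd P Q hP hQ => simp [hP, hQ]
  | hmul P Q hP hQ => simp [hP, hQ]
  | hsmul c P hP => simp [hP]

/-- The inner factors `star u * u` cancel. This lets an orbit representative replace a microstate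
inside a polynomial. -/
theorem ev_conj (u : A) (hu : u ∈ unitary A) (y : ι → A) (Q : StarPoly ι) :
    ev (fun i => u * y i * star u) Q = u * ev y Q * star u := by
  have h1 : star u * u = 1 := (Unitary.mem_iff.1 hu).1
  have h2 : u * star u = 1 := (Unitary.mem_iff.1 hu).2
  induction Q using poly_induction with
  | h1 => simp [h2]
  | hv q => rcases q with ⟨i, b⟩; cases b <;> simp [letter, mul_assoc]
  | hadd P Q hP hQ => simp [hP, hQ, mul_add, add_mul]
  | hmul P Q hP hQ =>
    rw [map_mul, hP, hQ, map_mul]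
    calc u * ev y P * star u * (u * ev y Q * star u)
        = u * ev y P * (star u * u) * ev y Q * star u := by noncomm_ring
      _ = _ := by rw [h1]; noncomm_ring
  | hsmul c P hP => simp [hP]

/-- Substitution of *-polynomials into *-polynomials. -/
def subst {κ : Type*} (P : κ → StarPoly ι) : StarPoly κ →ₐ[ℂ] StarPoly ι :=
  MonoidAlgebra.lift ℂ _ (FreeMonoid (κ × Bool))
    (FreeMonoid.lift fun q => if q.2 then adj (P q.1) else P q.1)

theorem subst_var {κ : Type*} (P : κ → StarPoly ι) (q : κ × Bool) :
    subst P (var q) = if q.2 then adj (P q.1) else P q.1 := by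
  simp [subst, var, word]

theorem ev_subst [StarModule ℂ A] {κ : Type*} (P : κ → StarPoly ι) (y : ι → A) (Q : StarPoly κ) :
    ev y (subst P Q) = ev (fun i => ev y (P i)) Q := by
  induction Q using poly_induction with
  | h1 => simp
  | hv q => rcases q with ⟨i, b⟩; cases b <;> simp [subst_var, letter, ev_adj]
  | hadd P Q hP hQ => simp [hP, hQ]
  | hmul P Q hP hQ => simp [hP, hQ]
  | hsmul c P hP => simp [hP]

end Algebra

/-! ### Norm bounds and 2-norm Lipschitz bounds for evaluations -/

section Norm

universe u

theorem norm_letter {ι A : Type*} [NormedRing A] [StarRing A] [NormedStarGroup A] (y : ι → A)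
    (q : ι × Bool) : ‖letter y q‖ = ‖y q.1‖ := by
  unfold letter; split_ifs <;> simp

/-- One constant serves all algebras of the universe, in particular all matrix sizes at once. -/
theorem norm_ev_le {ι : Type*} (Q : StarPoly ι) (R : ℝ) :
    ∃ C : ℝ, 0 ≤ C ∧ ∀ (A : Type u) [NormedRing A] [StarRing A] [NormedAlgebra ℂ A]
      [NormedStarGroup A] [NormOneClass A] (y : ι → A), (∀ i, ‖y i‖ ≤ R) → ‖ev y Q‖ ≤ C := by
  induction Q using poly_induction with
  | h1 => exact ⟨1, by simp, fun A _ _ _ _ _ y _ => by simp⟩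
  | hv q =>
    exact ⟨|R|, abs_nonneg _, fun A _ _ _ _ _ y h => by
      rw [ev_var, norm_letter]; exact (h _).trans (le_abs_self R)⟩
  | hadd P Q hP hQ =>
    obtain ⟨C, hC, h⟩ := hP
    obtain ⟨D, hD, h'⟩ := hQ
    refine ⟨C + D, by positivity, fun A _ _ _ _ _ y hy => ?_⟩
    rw [map_add]
    exact (norm_add_le _ _).trans (add_le_add (h A y hy) (h' A y hy))
  | hmul P Q hP hQ =>
    obtain ⟨C, hC, h⟩ := hP
    obtain ⟨D, hD, h'⟩ := hQ
    refine ⟨C * D, by positivity, fun A _ _ _ _ _ y hy => ?_⟩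
    rw [map_mul]
    exact (norm_mul_le _ _).trans
      (mul_le_mul (h A y hy) (h' A y hy) (norm_nonneg _) hC)
  | hsmul c P hP =>
    obtain ⟨C, hC, h⟩ := hP
    refine ⟨‖c‖ * C, by positivity, fun A _ _ _ _ _ y hy => ?_⟩
    rw [map_smul, norm_smul]
    exact mul_le_mul_of_nonneg_left (h A y hy) (norm_nonneg _)

end Norm

end StarPoly

/-- A seminorm that behaves like the 2-norm of a tracial state. -/
structure IsTraceSeminorm {A : Type*} [NormedRing A] [StarRing A] [NormedAlgebra ℂ A]
    (s : A → ℝ) : Prop where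
  nonneg : ∀ a, 0 ≤ s a
  add_le : ∀ a b, s (a + b) ≤ s a + s b
  mul_left : ∀ a b, s (a * b) ≤ ‖a‖ * s b
  mul_right : ∀ a b, s (a * b) ≤ s a * ‖b‖
  map_star : ∀ a, s (star a) = s a
  le_norm : ∀ a, s a ≤ ‖a‖

namespace IsTraceSeminorm

variable {A : Type*} [NormedRing A] [StarRing A] [NormedAlgebra ℂ A] [NormOneClass A] {s : A → ℝ}

theorem map_zero (hs : IsTraceSeminorm s) : s 0 = 0 :=
  le_antisymm (by simpa using hs.le_norm 0) (hs.nonneg 0)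

theorem smul_le (hs : IsTraceSeminorm s) (c : ℂ) (a : A) : s (c • a) ≤ ‖c‖ * s a := by
  have h := hs.mul_left (c • 1) a
  rwa [smul_one_mul, norm_smul, norm_one, mul_one] at h

theorem map_neg (hs : IsTraceSeminorm s) (a : A) : s (-a) = s a := by
  have h : ∀ a, s (-a) ≤ s a := fun a => by simpa using hs.smul_le (-1) a
  exact le_antisymm (h a) (by simpa using h (-a))

theorem sub_comm (hs : IsTraceSeminorm s) (a b : A) : s (a - b) = s (b - a) := by
  rw [← hs.map_neg, neg_sub]

theorem sub_le (hs : IsTraceSeminorm s) (a b c : A) : s (a - c) ≤ s (a - b) + s (b - c) := by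
  simpa using hs.add_le (a - b) (b - c)

theorem le_add_sub (hs : IsTraceSeminorm s) (a b : A) : s a ≤ s b + s (a - b) := by
  simpa using hs.add_le b (a - b)

end IsTraceSeminorm

namespace StarPoly

universe u

/-- Product rule: in each term one factor is measured in `s` and the other in operator norm, which
is bounded on the `R`-ball. -/
theorem ev_lipschitz {ι : Type*} (Q : StarPoly ι) (R : ℝ) :
    ∃ L : ℝ, 0 ≤ L ∧ ∀ (A : Type u) [NormedRing A] [StarRing A] [NormedAlgebra ℂ A]
      [NormedStarGroup A] [NormOneClass A] (s : A → ℝ), IsTraceSeminorm s → ∀ y z : ι → A,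
      (∀ i, ‖y i‖ ≤ R) → (∀ i, ‖z i‖ ≤ R) → ∀ ε, (∀ i, s (y i - z i) ≤ ε) →
      s (ev y Q - ev z Q) ≤ L * ε := by
  induction Q using poly_induction with
  | h1 => exact ⟨0, le_rfl, fun A _ _ _ _ _ s hs y z _ _ ε _ => by simp [hs.map_zero]⟩
  | hv q =>
    refine ⟨1, zero_le_one, fun A _ _ _ _ _ s hs y z _ _ ε h => ?_⟩
    rcases q with ⟨i, b⟩
    cases b
    · simpa [letter] using h i
    · simpa [letter, ← star_sub, hs.map_star] using h i
  | hadd P Q hP hQ =>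
    obtain ⟨C, hC, h⟩ := hP
    obtain ⟨D, hD, h'⟩ := hQ
    refine ⟨C + D, by positivity, fun A _ _ _ _ _ s hs y z hy hz ε hε => ?_⟩
    have e : ev y (P + Q) - ev z (P + Q) = (ev y P - ev z P) + (ev y Q - ev z Q) := by
      simp only [map_add]; abel
    rw [e, add_mul]
    exact (hs.add_le _ _).trans (add_le_add (h A s hs y z hy hz ε hε) (h' A s hs y z hy hz ε hε))
  | hmul P Q hP hQ =>
    obtain ⟨C, hC, h⟩ := hP
    obtain ⟨D, hD, h'⟩ := hQ
    obtain ⟨K, hK, hPK⟩ := norm_ev_le.{u} P R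
    obtain ⟨M, hM, hQM⟩ := norm_ev_le.{u} Q R
    refine ⟨C * M + K * D, by positivity, fun A _ _ _ _ _ s hs y z hy hz ε hε => ?_⟩
    have e : ev y (P * Q) - ev z (P * Q)
        = (ev y P - ev z P) * ev y Q + ev z P * (ev y Q - ev z Q) := by
      simp only [map_mul]; noncomm_ring
    rw [e]
    have h1 := h A s hs y z hy hz ε hε
    have h2 := h' A s hs y z hy hz ε hε
    have h3 := hQM A y hy
    have h4 := hPK A z hz
    calc _ ≤ s ((ev y P - ev z P) * ev y Q) + s (ev z P * (ev y Q - ev z Q)) := hs.add_le _ _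
      _ ≤ s (ev y P - ev z P) * ‖ev y Q‖ + ‖ev z P‖ * s (ev y Q - ev z Q) :=
        add_le_add (hs.mul_right _ _) (hs.mul_left _ _)
      _ ≤ (C * ε) * M + K * (D * ε) := by
        refine add_le_add (mul_le_mul h1 h3 (norm_nonneg _) ((hs.nonneg _).trans h1))
          (mul_le_mul h4 h2 (hs.nonneg _) hK)
      _ = _ := by ring
  | hsmul c P hP =>
    obtain ⟨C, hC, h⟩ := hP
    refine ⟨‖c‖ * C, by positivity, fun A _ _ _ _ _ s hs y z hy hz ε hε => ?_⟩
    rw [map_smul, map_smul, ← smul_sub, mul_assoc]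
    exact (hs.smul_le _ _).trans (mul_le_mul_of_nonneg_left (h A s hs y z hy hz ε hε) (norm_nonneg _))

end StarPoly

/-! ## The normalized Hilbert–Schmidt norm -/

section HilbertSchmidt

open scoped Matrix.Norms.L2Operator

/-- The normalized Hilbert–Schmidt norm. -/
def hsNorm {k : ℕ+} (A : Mat k) : ℝ := √(hs A)

theorem hsNorm_sq {k : ℕ+} (A : Mat k) : hsNorm A ^ 2 = hs A := Real.sq_sqrt (hs_nonneg A)

/-- The entries of a tuple of matrices, as a vector of a Hilbert space. -/
def entries {k : ℕ+} {m : ℕ} :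
    (Fin m → Mat k) →ₗ[ℂ] EuclideanSpace ℂ (Fin m × Fin (k : ℕ) × Fin (k : ℕ)) where
  toFun A := WithLp.toLp 2 fun q => A q.1 q.2.1 q.2.2
  map_add' _ _ := rfl
  map_smul' _ _ := rfl

theorem tnorm_eq {k : ℕ+} {m : ℕ} (A : Fin m → Mat k) : tnorm A = √(∑ i, hs (A i)) := by
  simp only [tnorm, ntr_star_mul_self, Complex.ofReal_re]

theorem norm_entries {k : ℕ+} {m : ℕ} (A : Fin m → Mat k) :
    ‖entries A‖ = √(k : ℕ) * tnorm A := by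
  have hk : (0 : ℝ) < ((k : ℕ) : ℝ) := by exact_mod_cast k.pos
  rw [tnorm_eq, EuclideanSpace.norm_eq, ← Real.sqrt_mul hk.le]
  congr 1
  simp only [entries, Fintype.sum_prod_type, hs, Finset.mul_sum]
  refine Finset.sum_congr rfl fun i _ => ?_
  field_simp
  rfl

theorem hsNorm_eq_tnorm {k : ℕ+} (A : Mat k) : hsNorm A = tnorm (fun _ : Fin 1 => A) := by
  simp [tnorm_eq, hsNorm]

theorem tnorm_add_le {k : ℕ+} {m : ℕ} (A B : Fin m → Mat k) :
    tnorm (A + B) ≤ tnorm A + tnorm B := by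
  have hk : (0 : ℝ) < √((k : ℕ) : ℝ) := by
    rw [Real.sqrt_pos]; exact_mod_cast k.pos
  have h := norm_add_le (entries A) (entries B)
  rw [← map_add, norm_entries, norm_entries, norm_entries, ← mul_add] at h
  exact le_of_mul_le_mul_left h hk

theorem hsNorm_add_le {k : ℕ+} (A B : Mat k) : hsNorm (A + B) ≤ hsNorm A + hsNorm B := by
  simp only [hsNorm_eq_tnorm]
  exact tnorm_add_le (fun _ => A) (fun _ => B)

theorem hsNorm_mul_left {k : ℕ+} (A B : Mat k) : hsNorm (A * B) ≤ ‖A‖ * hsNorm B := by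
  refine (Real.sqrt_le_sqrt (hs_mul_le_left A B)).trans_eq ?_
  rw [Real.sqrt_mul (by positivity), Real.sqrt_sq (norm_nonneg _), hsNorm]

theorem hsNorm_mul_right {k : ℕ+} (A B : Mat k) : hsNorm (A * B) ≤ hsNorm A * ‖B‖ := by
  refine (Real.sqrt_le_sqrt (hs_mul_le_right A B)).trans_eq ?_
  rw [Real.sqrt_mul (by positivity), Real.sqrt_sq (norm_nonneg _), hsNorm, mul_comm]

theorem hsNorm_one {k : ℕ+} : hsNorm (1 : Mat k) = 1 := by
  have h := ntr_star_mul_self (1 : Mat k)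
  have hk : ((k : ℕ) : ℂ) ≠ 0 := by exact_mod_cast k.pos.ne'
  simp [ntr, hk] at h
  rw [hsNorm, Real.sqrt_eq_one]
  exact_mod_cast h.symm

theorem isTraceSeminorm_hsNorm (k : ℕ+) : IsTraceSeminorm (hsNorm : Mat k → ℝ) where
  nonneg _ := Real.sqrt_nonneg _
  add_le := hsNorm_add_le
  mul_left := hsNorm_mul_left
  mul_right := hsNorm_mul_right
  map_star A := by rw [hsNorm, hs_star, hsNorm]
  le_norm A := by
    have h := hsNorm_mul_left A 1
    rwa [hsNorm_one, mul_one, mul_one] at h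

theorem tnorm_le_sum {k : ℕ+} {m : ℕ} (A : Fin m → Mat k) : tnorm A ≤ ∑ i, hsNorm (A i) := by
  rw [tnorm_eq]
  refine Real.sqrt_le_iff.2 ⟨Finset.sum_nonneg fun i _ => Real.sqrt_nonneg _, ?_⟩
  simp only [← hsNorm_sq]
  exact Finset.sum_sq_le_sq_sum_of_nonneg fun i _ => Real.sqrt_nonneg _

theorem hsNorm_le_tnorm {k : ℕ+} {m : ℕ} (A : Fin m → Mat k) (i : Fin m) :
    hsNorm (A i) ≤ tnorm A := by
  rw [tnorm_eq]
  exact Real.sqrt_le_sqrt (Finset.single_le_sum (f := fun i => hs (A i))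
    (fun i _ => hs_nonneg _) (Finset.mem_univ i))

theorem norm_unitary {k : ℕ+} {U : Mat k} (hU : U ∈ unitary (Mat k)) : ‖U‖ = 1 :=
  CStarRing.norm_of_mem_unitary hU

theorem hsNorm_unitary_mul {k : ℕ+} {U : Mat k} (hU : U ∈ unitary (Mat k)) (A : Mat k) :
    hsNorm (U * A) = hsNorm A := by
  refine le_antisymm ?_ ?_
  · simpa [norm_unitary hU] using hsNorm_mul_left U A
  · have h := hsNorm_mul_left (star U) (U * A)
    rwa [norm_star, norm_unitary hU, one_mul, ← mul_assoc, (Unitary.mem_iff.1 hU).1, one_mul] at h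

theorem hsNorm_mul_unitary {k : ℕ+} {U : Mat k} (hU : U ∈ unitary (Mat k)) (A : Mat k) :
    hsNorm (A * U) = hsNorm A := by
  refine le_antisymm ?_ ?_
  · simpa [norm_unitary hU] using hsNorm_mul_right A U
  · have h := hsNorm_mul_right (A * U) (star U)
    rwa [norm_star, norm_unitary hU, mul_one, mul_assoc, (Unitary.mem_iff.1 hU).2, mul_one] at h

/-! ### Microstates -/

/-- `X` is a microstate of order `m` for `x`: the moments of length at most `m` agree up to
`1/m`. -/
def IsMicrostate {ι A : Type*} [Ring A] [StarRing A] [Algebra ℂ A] (τ : A →ₗ[ℂ] ℂ) (x : ι → A)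
    (m : ℕ+) {k : ℕ+} (X : ι → Mat k) : Prop :=
  ∀ w : List (ι × Bool), 1 ≤ w.length → w.length ≤ (m : ℕ) →
    ‖ntr (wordVal X w) - τ (wordVal x w)‖ < 1 / ((m : ℕ) : ℝ)

theorem ntr_add {k : ℕ+} (A B : Mat k) : ntr (A + B) = ntr A + ntr B := by
  simp [ntr, Matrix.trace_add, add_div]

theorem ntr_smul {k : ℕ+} (c : ℂ) (A : Mat k) : ntr (c • A) = c * ntr A := by
  simp [ntr, Matrix.trace_smul, mul_div_assoc]

theorem ntr_one {k : ℕ+} : ntr (1 : Mat k) = 1 := by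
  have hk : ((k : ℕ) : ℂ) ≠ 0 := by exact_mod_cast k.pos.ne'
  simp [ntr, hk]

section Micro

variable {ι A : Type*} [Ring A] [StarRing A] [Algebra ℂ A] {τ : A →ₗ[ℂ] ℂ} {x : ι → A}

theorem IsMicrostate.mono {m m' : ℕ+} {k : ℕ+} {X : ι → Mat k} (h : IsMicrostate τ x m X)
    (hm : m' ≤ m) : IsMicrostate τ x m' X := by
  intro w h1 h2
  have hm' : (m' : ℕ) ≤ m := hm
  refine (h w h1 (h2.trans hm')).trans_le ?_
  have : (0 : ℝ) < (m' : ℕ) := by exact_mod_cast m'.pos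
  gcongr

theorem IsMicrostate.comp {κ : Type*} {m : ℕ+} {k : ℕ+} {X : ι → Mat k}
    (h : IsMicrostate τ x m X) (f : κ → ι) : IsMicrostate τ (x ∘ f) m (X ∘ f) := by
  intro w h1 h2
  have := h (w.map (Prod.map f id)) (by simpa using h1) (by simpa using h2)
  rwa [wordVal_map, wordVal_map] at this

/-- Microstates only control nonempty words; for the empty word both traces equal `1`. -/
theorem exists_order_ntr_ev (hτ : τ 1 = 1) (x : ι → A) (Q : StarPoly ι) {ε : ℝ} (hε : 0 < ε) :
    ∃ m : ℕ+, ∀ (k : ℕ+) (X : ι → Mat k), IsMicrostate τ x m X →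
      ‖ntr (StarPoly.ev X Q) - τ (StarPoly.ev x Q)‖ < ε := by
  induction Q using StarPoly.word_induction generalizing ε with
  | hw w =>
    obtain ⟨l, hl⟩ := exists_nat_one_div_lt hε
    let m : ℕ+ := ⟨l + 1 + w.length, by omega⟩
    refine ⟨m, fun k X hX => ?_⟩
    rw [StarPoly.ev_word, StarPoly.ev_word]
    rcases Nat.eq_zero_or_pos w.length with h0 | h0
    · rw [List.length_eq_zero_iff] at h0
      simp [h0, wordVal, ntr_one, hτ, hε]
    · refine (hX w h0 (by simp [m])).trans_le (le_trans ?_ hl.le)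
      refine one_div_le_one_div_of_le (by positivity) ?_
      simp [m]
  | hadd P Q hP hQ =>
    obtain ⟨m, hm⟩ := hP (half_pos hε)
    obtain ⟨m', hm'⟩ := hQ (half_pos hε)
    refine ⟨max m m', fun k X hX => ?_⟩
    have h1 := hm k X (hX.mono (le_max_left _ _))
    have h2 := hm' k X (hX.mono (le_max_right _ _))
    rw [map_add, map_add, map_add, ntr_add, add_sub_add_comm]
    linarith [norm_add_le (ntr (StarPoly.ev X P) - τ (StarPoly.ev x P))
      (ntr (StarPoly.ev X Q) - τ (StarPoly.ev x Q))]
  | hsmul c P hP =>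
    obtain ⟨m, hm⟩ := hP (ε := ε / (‖c‖ + 1)) (by positivity)
    refine ⟨m, fun k X hX => ?_⟩
    have h1 := hm k X hX
    rw [map_smul, map_smul, map_smul, ntr_smul, smul_eq_mul, ← mul_sub, norm_mul]
    rw [lt_div_iff₀ (by positivity)] at h1
    nlinarith [norm_nonneg c, norm_nonneg (ntr (StarPoly.ev X P) - τ (StarPoly.ev x P))]

/-- The squared 2-norm of `Q` is the trace of the polynomial `adj Q * Q`, so approximate relations
of `x` in 2-norm pass to its microstates. -/
theorem exists_order_hsNorm_ev [StarModule ℂ A] (hτ : τ 1 = 1) (x : ι → A) (Q : StarPoly ι)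
    {ε : ℝ} (hε : 0 < ε)
    (hQ : (τ (star (StarPoly.ev x Q) * StarPoly.ev x Q)).re < ε ^ 2) :
    ∃ m : ℕ+, ∀ (k : ℕ+) (X : ι → Mat k), IsMicrostate τ x m X →
      hsNorm (StarPoly.ev X Q) < ε := by
  obtain ⟨m, hm⟩ := exists_order_ntr_ev hτ x (StarPoly.adj Q * Q) (sub_pos.2 hQ)
  refine ⟨m, fun k X hX => ?_⟩
  have h := hm k X hX
  rw [map_mul, map_mul, StarPoly.ev_adj, StarPoly.ev_adj, ntr_star_mul_self, ← hsNorm_sq] at h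
  have h2 := (Complex.abs_re_le_norm _).trans_lt h
  rw [Complex.sub_re, Complex.ofReal_re] at h2
  have h3 := (abs_lt.1 h2).2
  exact lt_of_pow_lt_pow_left₀ 2 hε.le (by linarith)

end Micro

end HilbertSchmidt

/-! ### The 2-norm of a faithful normal tracial state -/

section VonNeumann

variable {H : Type*} [NormedAddCommGroup H] [InnerProductSpace ℂ H] [CompleteSpace H]
  {N : VonNeumannAlgebra H}

namespace FaithfulNormalTrace

variable (τ : FaithfulNormalTrace N)

/-- The 2-norm `‖a‖₂ = τ(a* a)^{1/2}`. -/
def norm2 (a : N.toStarSubalgebra) : ℝ := ‖PreL2.of τ a‖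

include τ in
theorem nontrivial : Nontrivial N.toStarSubalgebra := by
  refine ⟨1, 0, fun h => ?_⟩
  have h1 := τ.map_one
  rw [h, map_zero] at h1
  exact zero_ne_one h1

include τ in
theorem normOneClass : NormOneClass N.toStarSubalgebra := by
  have := τ.nontrivial
  infer_instance

theorem norm2_sq (a : N.toStarSubalgebra) : τ.norm2 a ^ 2 = (τ.toLin (star a * a)).re :=
  PreL2.norm_sq τ a

theorem norm2_star (a : N.toStarSubalgebra) : τ.norm2 (star a) = τ.norm2 a := PreL2.norm_star τ a

theorem norm2_mul_left (a b : N.toStarSubalgebra) : τ.norm2 (a * b) ≤ ‖a‖ * τ.norm2 b :=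
  PreL2.norm_mul_le τ a b

theorem norm2_one : τ.norm2 1 = 1 := by
  have h := τ.norm2_sq 1
  simp [τ.map_one] at h
  rcases h with h | h
  · exact h
  · linarith [norm_nonneg (PreL2.of τ 1), show τ.norm2 1 = ‖PreL2.of τ 1‖ from rfl]

theorem isTraceSeminorm : IsTraceSeminorm τ.norm2 where
  nonneg _ := norm_nonneg _
  add_le a b := norm_add_le (PreL2.of τ a) (PreL2.of τ b)
  mul_left := τ.norm2_mul_left
  mul_right a b := by
    have h := τ.norm2_mul_left (star b) (star a)
    rwa [← star_mul, norm2_star, norm2_star, norm_star, mul_comm] at h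
  map_star := τ.norm2_star
  le_norm a := by
    have h := τ.norm2_mul_left a 1
    rwa [mul_one, norm2_one, mul_one] at h

theorem norm_apply_le (a : N.toStarSubalgebra) : ‖τ.toLin a‖ ≤ τ.norm2 a := by
  have h := norm_inner_le_norm (𝕜 := ℂ) (PreL2.of τ 1) (PreL2.of τ a)
  rw [PreL2.inner_def] at h
  change ‖τ.toLin (star 1 * a)‖ ≤ τ.norm2 1 * τ.norm2 a at h
  rwa [norm2_one, star_one, one_mul, one_mul] at h

end FaithfulNormalTrace

end VonNeumann

/-! ## Density of the polynomials in a generating family -/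

section Amplification

variable {H : Type*} [NormedAddCommGroup H] [InnerProductSpace ℂ H] {I : Type*}

/-- The Hilbert space direct sum of copies of `H`. -/
abbrev HilbertSum (I H : Type*) [NormedAddCommGroup H] : Type _ := lp (fun _ : I => H) 2

theorem memLp_amplify (T : H →L[ℂ] H) (f : HilbertSum I H) :
    Memℓp (fun i => T (f i)) 2 := by
  refine memℓp_gen ?_
  have h := ((memℓp_gen_iff (by simp)).1 (lp.memℓp f)).mul_left (‖T‖ ^ (2 : ℝ))
  refine Summable.of_nonneg_of_le (fun i => by positivity) (fun i => ?_) h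
  simp only [ENNReal.toReal_ofNat]
  rw [← Real.mul_rpow (norm_nonneg _) (norm_nonneg _)]
  gcongr
  exact T.le_opNorm _

/-- The diagonal action of an operator on the direct sum of copies of `H`. -/
def amplify (T : H →L[ℂ] H) : HilbertSum I H →L[ℂ] HilbertSum I H :=
  LinearMap.mkContinuous
    { toFun := fun f => ⟨fun i => T (f i), memLp_amplify T f⟩
      map_add' := fun f g => by ext i; exact map_add T (f i) (g i)
      map_smul' := fun c f => by ext i; exact map_smul T c (f i) } ‖T‖ fun f => by
    have h : ‖(‖T‖ : ℂ) • f‖ = ‖T‖ * ‖f‖ := by rw [norm_smul]; simp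
    rw [← h]
    refine lp.norm_mono (by simp) fun i => ?_
    rw [lp.coeFn_smul, Pi.smul_apply, norm_smul]
    simpa using T.le_opNorm (f i)

@[simp] theorem amplify_apply (T : H →L[ℂ] H) (f : HilbertSum I H) (i : I) :
    amplify T f i = T (f i) := rfl

theorem inner_amplify [CompleteSpace H] (T : H →L[ℂ] H) (f g : HilbertSum I H) :
    ⟪f, amplify T g⟫_ℂ = ⟪amplify (star T) f, g⟫_ℂ := by
  rw [lp.inner_eq_tsum, lp.inner_eq_tsum]
  refine tsum_congr fun i => ?_
  simp [ContinuousLinearMap.star_eq_adjoint, ContinuousLinearMap.adjoint_inner_left]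

theorem commute_of_forall_entry [DecidableEq I] {T : H →L[ℂ] H}
    {P : HilbertSum I H →L[ℂ] HilbertSum I H}
    (h : ∀ i j v, P (lp.single 2 j (T v)) i = T (P (lp.single 2 j v) i)) (f : HilbertSum I H) :
    P (amplify T f) = amplify T (P f) := by
  have h1 := (lp.hasSum_single (by simp) (amplify T f)).mapL P
  have h2 := (lp.hasSum_single (p := 2) (by simp) f).mapL ((amplify T).comp P)
  have e : (fun j => P (lp.single 2 j (amplify T f j))) =
      fun j => (amplify T).comp P (lp.single 2 j (f j)) := by
    funext j
    ext i
    simp [h]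
  rw [e] at h1
  exact h1.unique h2

/-- Von Neumann's double commutant argument. The projection onto the closure `E` of the polynomials
applied to `v` commutes with the amplified letters, hence with the amplification of `T`. As `v` is
in `E`, so is its image under the amplified `T`. -/
theorem amplify_mem_closure [CompleteSpace H] {ι : Type*} (y : ι → H →L[ℂ] H) {T : H →L[ℂ] H}
    (hT : T ∈ Set.centralizer (Set.centralizer {a : H →L[ℂ] H | ∃ i, a = y i ∨ a = star (y i)}))
    (v : HilbertSum I H) {ε : ℝ} (hε : 0 < ε) :
    ∃ Q : StarPoly ι, ‖amplify (T - StarPoly.ev y Q) v‖ < ε := by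
  classical
  have amp_sub : ∀ S S' : H →L[ℂ] H, amplify (S - S') v = amplify S v - amplify S' v := fun S S' => by
    ext i; simp
  let Φ : StarPoly ι →ₗ[ℂ] HilbertSum I H :=
    { toFun := fun Q => amplify (StarPoly.ev y Q) v
      map_add' := fun P Q => by ext i; simp
      map_smul' := fun c P => by ext i; simp }
  let E : Submodule ℂ (HilbertSum I H) := (LinearMap.range Φ).topologicalClosure
  have hEc : IsClosed (E : Set (HilbertSum I H)) := Submodule.isClosed_topologicalClosure _
  have : CompleteSpace E := hEc.completeSpace_coe
  have hinv : ∀ q : ι × Bool, ∀ w ∈ E, amplify (letter y q) w ∈ E := by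
    intro q w hw
    have hmap : Set.MapsTo (amplify (letter y q)) (LinearMap.range Φ : Set (HilbertSum I H))
        (LinearMap.range Φ) := by
      rintro _ ⟨Q, rfl⟩
      refine ⟨StarPoly.var q * Q, ?_⟩
      ext i
      simp [Φ]
    exact hmap.closure (amplify (letter y q)).continuous hw
  have hstar : ∀ q : ι × Bool, star (letter y q) = letter y (q.1, !q.2) := by
    rintro ⟨i, b⟩; cases b <;> simp [letter]
  have hcomm : ∀ q w, E.starProjection (amplify (letter y q) w) =
      amplify (letter y q) (E.starProjection w) := by
    intro q w
    refine Submodule.eq_starProjection_of_mem_of_inner_eq_zero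
      (hinv q _ (Submodule.starProjection_apply_mem _ _)) fun z hz => ?_
    rw [← map_sub, ← inner_conj_symm, inner_amplify, hstar]
    have := Submodule.sub_starProjection_mem_orthogonal (K := E) w
    rw [(Submodule.mem_orthogonal _ _).1 this _ (hinv _ z hz), map_zero]
  -- The matrix entries of the projection are operators on `H` that commute with the letters, so `T`
  -- commutes with each of them.
  let entry (i j : I) : H →L[ℂ] H := (lp.evalCLM ℂ (fun _ : I => H) 2 i) ∘L E.starProjection ∘L
    (lp.singleContinuousLinearMap ℂ (fun _ : I => H) 2 j)
  have hsingle : ∀ (S : H →L[ℂ] H) j u, amplify S (lp.single (E := fun _ : I => H) 2 j u) =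
      lp.single 2 j (S u) := by
    intro S j u
    ext i
    rcases eq_or_ne i j with rfl | hij
    · simp
    · simp [hij]
  have hentry : ∀ i j, entry i j ∈
      Set.centralizer {a : H →L[ℂ] H | ∃ i, a = y i ∨ a = star (y i)} := by
    intro i j a ha
    obtain ⟨q, rfl⟩ : ∃ q, a = letter y q := by
      obtain ⟨l, rfl | rfl⟩ := ha
      · exact ⟨(l, false), rfl⟩
      · exact ⟨(l, true), rfl⟩
    ext u
    have h := congrArg (fun f : HilbertSum I H => f i) (hcomm q (lp.single 2 j u))
    rw [hsingle] at h
    exact h.symm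
  have hT' : E.starProjection (amplify T v) = amplify T (E.starProjection v) := by
    refine commute_of_forall_entry (fun i j u => ?_) v
    exact DFunLike.congr_fun (hT _ (hentry i j)) u
  have hv : v ∈ E := by
    refine Submodule.le_topologicalClosure _ ⟨1, ?_⟩
    ext i
    simp [Φ]
  rw [Submodule.starProjection_eq_self_iff.2 hv, Submodule.starProjection_eq_self_iff] at hT'
  have h2 : amplify T v ∈ closure (LinearMap.range Φ : Set (HilbertSum I H)) := hT'
  obtain ⟨_, ⟨Q, rfl⟩, hQ⟩ := Metric.mem_closure_iff.1 h2 ε hε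
  refine ⟨Q, ?_⟩
  rw [amp_sub, ← dist_eq_norm]
  exact hQ

end Amplification

section VonNeumann

variable {H : Type*} [NormedAddCommGroup H] [InnerProductSpace ℂ H] [CompleteSpace H]
  {N : VonNeumannAlgebra H}

/-- Normality writes `τ(b*b)` as `∑ ⟨b η_i, b ζ_i⟩`. Collecting all `η_i` and `ζ_i` in one vector
`f` of the amplified space bounds this by the square of the norm of `amplify b f`, and the double
commutant argument makes the latter small. -/
theorem exists_norm2_sub_ev_lt (τ : FaithfulNormalTrace N) {ι : Type*}
    (y : ι → N.toStarSubalgebra) (a : N.toStarSubalgebra)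
    (ha : (a : H →L[ℂ] H) ∈ Set.centralizer (Set.centralizer
      {b : H →L[ℂ] H | ∃ i, b = (y i : H →L[ℂ] H) ∨ b = star (y i : H →L[ℂ] H)}))
    {ε : ℝ} (hε : 0 < ε) : ∃ Q : StarPoly ι, τ.norm2 (a - StarPoly.ev y Q) < ε := by
  obtain ⟨η, ζ, hη, hζ, hs⟩ := τ.normal
  let f : ℕ ⊕ ℕ → H := Sum.elim η ζ
  have hf : Memℓp f 2 := by
    refine memℓp_gen ?_
    simp only [ENNReal.toReal_ofNat, Real.rpow_ofNat]
    exact Summable.sum _ hη hζ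
  obtain ⟨Q, hQ⟩ := amplify_mem_closure (fun i => (y i : H →L[ℂ] H)) ha (⟨f, hf⟩ : HilbertSum _ H) hε
  refine ⟨Q, lt_of_pow_lt_pow_left₀ 2 hε.le (lt_of_le_of_lt ?_ (pow_lt_pow_left₀ hQ (norm_nonneg _)
    two_ne_zero))⟩
  set b := a - StarPoly.ev y Q with hb
  have hb' : (b : H →L[ℂ] H) = a - StarPoly.ev (fun i => (y i : H →L[ℂ] H)) Q := by
    have := StarPoly.ev_comp N.toStarSubalgebra.subtype y Q
    simp only [StarSubalgebra.subtype_apply] at this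
    rw [this, hb]
    rfl
  rw [← hb']
  set g := amplify (b : H →L[ℂ] H) (⟨f, hf⟩ : HilbertSum _ H) with hg
  have hgs : HasSum (fun i => ‖g i‖ ^ 2) (‖g‖ ^ 2) := by
    have := lp.hasSum_norm (p := 2) (by simp) g
    simpa using this
  have h1 : HasSum (fun i => ‖g (Sum.inl i)‖ ^ 2 + ‖g (Sum.inr i)‖ ^ 2) (‖g‖ ^ 2) := by
    have e1 := (hgs.summable.comp_injective Sum.inl_injective).hasSum
    have e2 := (hgs.summable.comp_injective Sum.inr_injective).hasSum
    have e3 := (e1.sum e2 : HasSum (fun i => ‖g i‖ ^ 2) _)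
    rw [hgs.unique e3]
    exact e1.add e2
  rw [FaithfulNormalTrace.norm2_sq]
  have h2 : HasSum (fun i => (⟪η i, ((star b * b : N.toStarSubalgebra) : H →L[ℂ] H) (ζ i)⟫_ℂ).re)
      (τ.toLin (star b * b)).re := Complex.hasSum_re (hs _)
  refine hasSum_le (fun i => ?_) h2 h1
  have e : ⟪η i, ((star b * b : N.toStarSubalgebra) : H →L[ℂ] H) (ζ i)⟫_ℂ =
      ⟪g (Sum.inl i), g (Sum.inr i)⟫_ℂ := by
    change ⟪η i, (star (b : H →L[ℂ] H)) ((b : H →L[ℂ] H) (ζ i))⟫_ℂ =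
      ⟪(b : H →L[ℂ] H) (η i), (b : H →L[ℂ] H) (ζ i)⟫_ℂ
    rw [ContinuousLinearMap.star_eq_adjoint, ContinuousLinearMap.adjoint_inner_right]
  rw [e]
  have e2 : (⟪g (Sum.inl i), g (Sum.inr i)⟫_ℂ).re ≤ ‖g (Sum.inl i)‖ * ‖g (Sum.inr i)‖ :=
    (Complex.re_le_norm _).trans (norm_inner_le_norm _ _)
  nlinarith [sq_nonneg (‖g (Sum.inl i)‖ - ‖g (Sum.inr i)‖), sq_nonneg ‖g (Sum.inl i)‖,
    sq_nonneg ‖g (Sum.inr i)‖]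

end VonNeumann

section

/-! ## Norm bounded approximation by polynomials -/

/-- Kaplansky's function `t ↦ 2t/(1+t²)`. -/
def kap (t : ℝ) : ℝ := 2 * t * (1 + t ^ 2)⁻¹

/-- A right inverse of `kap` on `[-1, 1]`. -/
def kapInv (t : ℝ) : ℝ := t * (1 + √(1 - t ^ 2))⁻¹

theorem continuous_kap : Continuous kap := by
  unfold kap
  refine (by fun_prop : Continuous fun t : ℝ => 2 * t).mul
    (Continuous.inv₀ (by fun_prop) fun t => by positivity)

theorem continuous_kapInv : Continuous kapInv := by
  unfold kapInv
  refine continuous_id.mul (Continuous.inv₀ (by fun_prop) fun t => by positivity)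

theorem abs_kap_le (t : ℝ) : |kap t| ≤ 1 := by
  have h : (0 : ℝ) < 1 + t ^ 2 := by positivity
  rw [kap, ← div_eq_mul_inv, abs_div, abs_of_pos h, div_le_one h, abs_mul, abs_two]
  nlinarith [sq_nonneg (|t| - 1), sq_abs t]

theorem kap_kapInv {t : ℝ} (ht : |t| ≤ 1) : kap (kapInv t) = t := by
  have h0 : 0 ≤ 1 - t ^ 2 := by
    have := sq_abs t
    nlinarith [abs_nonneg t]
  have h1 := Real.sq_sqrt h0
  have h2 := Real.sqrt_nonneg (1 - t ^ 2)
  unfold kap kapInv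
  set c := √(1 - t ^ 2)
  have h3 : (1 + c) ≠ 0 := by positivity
  have h4 : (1 + c) ^ 2 + t ^ 2 ≠ 0 := by positivity
  have h5 : 1 + (t * (1 + c)⁻¹) ^ 2 = ((1 + c) ^ 2 + t ^ 2) / (1 + c) ^ 2 := by
    field_simp
  rw [h5, inv_div]
  field_simp
  linear_combination (-t) * h1

theorem StarPoly.ev_re {ι A : Type*} [Ring A] [StarRing A] [Algebra ℂ A] [StarModule ℂ A]
    (y : ι → A) (Q : StarPoly ι) : StarPoly.ev y ((1 / 2 : ℂ) • (Q + StarPoly.adj Q)) =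
      (1 / 2 : ℂ) • (StarPoly.ev y Q + star (StarPoly.ev y Q)) := by
  simp only [map_smul, map_add, StarPoly.ev_adj]

theorem StarPoly.isSelfAdjoint_ev_re {ι A : Type*} [Ring A] [StarRing A] [Algebra ℂ A]
    [StarModule ℂ A] (y : ι → A) (Q : StarPoly ι) :
    IsSelfAdjoint (StarPoly.ev y ((1 / 2 : ℂ) • (Q + StarPoly.adj Q))) := by
  rw [StarPoly.ev_re, IsSelfAdjoint, star_smul, star_add, star_star, add_comm]
  simp

section CStar

variable {A : Type*} [CStarAlgebra A]

theorem abs_le_of_mem_spectrum [Nontrivial A] {T : A} {C : ℝ} (hC : ‖T‖ ≤ C) {t : ℝ}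
    (ht : t ∈ spectrum ℝ T) : |t| ≤ C := by
  have h := spectrum.norm_le_norm_of_mem ht
  exact h.trans hC

/-- With `a = (1+T²)⁻¹` and `b = (1+S²)⁻¹`, half the difference is `aT - Sb = a(T-S)b + aT(S-T)Sb`,
and `a`, `b`, `aT`, `Sb` are contractions. Unlike for a general continuous function, the bound does
not involve the operator norms of `T` and `S`. -/
theorem kap_lipschitz [Nontrivial A] {s : A → ℝ} (hs : IsTraceSeminorm s) {T S : A}
    (hT : IsSelfAdjoint T) (hS : IsSelfAdjoint S) :
    s (cfc kap T - cfc kap S) ≤ 4 * s (T - S) := by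
  let r : ℝ → ℝ := fun t => (1 + t ^ 2)⁻¹
  have hr : Continuous r := Continuous.inv₀ (by fun_prop) fun t => by positivity
  have hr1 : ∀ t, ‖r t‖ ≤ 1 := fun t => by
    rw [Real.norm_of_nonneg (by positivity)]
    exact inv_le_one_of_one_le₀ (by nlinarith [sq_nonneg t])
  have hr2 : ∀ t, ‖t * r t‖ ≤ 1 := fun t => by
    have h : (0 : ℝ) < 1 + t ^ 2 := by positivity
    rw [← div_eq_mul_inv, norm_div, Real.norm_of_nonneg h.le, div_le_one h, Real.norm_eq_abs]
    nlinarith [sq_nonneg (|t| - 1), sq_abs t, abs_nonneg t]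
  have key : ∀ {X : A}, IsSelfAdjoint X → cfc r X * (1 + X ^ 2) = 1 ∧ (1 + X ^ 2) * cfc r X = 1 ∧
      cfc kap X = (2 : ℝ) • (cfc r X * X) ∧ cfc kap X = (2 : ℝ) • (X * cfc r X) ∧
      ‖cfc r X‖ ≤ 1 ∧ ‖cfc r X * X‖ ≤ 1 ∧ ‖X * cfc r X‖ ≤ 1 := by
    intro X hX
    have e1 : (1 + X ^ 2) = cfc (fun t : ℝ => 1 + t ^ 2) X := by
      rw [cfc_const_add (1 : ℝ) (fun t => t ^ 2) X (by fun_prop) hX, cfc_pow_id X 2 hX, map_one]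
    have e2 : cfc r X * X = cfc (fun t => t * r t) X := by
      conv_lhs => enter [2]; rw [← cfc_id ℝ X hX]
      rw [← cfc_mul r id X hr.continuousOn continuousOn_id]
      exact congrArg (fun f => cfc f X) (funext fun t => mul_comm _ _)
    have e3 : X * cfc r X = cfc (fun t => t * r t) X := by
      conv_lhs => enter [1]; rw [← cfc_id ℝ X hX]
      rw [← cfc_mul id r X continuousOn_id hr.continuousOn]
      rfl
    have e4 : cfc kap X = (2 : ℝ) • cfc (fun t => t * r t) X := by
      rw [← cfc_smul (2 : ℝ) (fun t => t * r t) X (continuous_id.mul hr).continuousOn]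
      exact congrArg (fun f => cfc f X) (funext fun t => by simp [kap, r, mul_assoc])
    have e5 : ∀ t : ℝ, r t * (1 + t ^ 2) = 1 := fun t => inv_mul_cancel₀ (by positivity)
    refine ⟨?_, ?_, e2 ▸ e4, e3 ▸ e4, norm_cfc_le zero_le_one fun t _ => hr1 t,
      e2 ▸ norm_cfc_le zero_le_one fun t _ => hr2 t, e3 ▸ norm_cfc_le zero_le_one fun t _ => hr2 t⟩
    · rw [e1, ← cfc_mul r _ X hr.continuousOn (by fun_prop), ← cfc_one ℝ X hX]
      exact congrArg (fun f => cfc f X) (funext e5)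
    · rw [e1, ← cfc_mul _ r X (by fun_prop) hr.continuousOn, ← cfc_one ℝ X hX]
      exact congrArg (fun f => cfc f X) (funext fun t => (mul_comm _ _).trans (e5 t))
  obtain ⟨a1, -, a2, -, a3, a4, -⟩ := key hT
  obtain ⟨-, b1, -, b2, b3, -, b4⟩ := key hS
  set a := cfc r T
  set b := cfc r S
  have e : cfc kap T - cfc kap S =
      (2 : ℂ) • (a * (T - S) * b) + (2 : ℂ) • (a * T * (S - T) * (S * b)) := by
    have h1 : a * T = a * T * ((1 + S ^ 2) * b) := by rw [b1, mul_one]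
    have h2 : S * b = a * (1 + T ^ 2) * (S * b) := by rw [a1, one_mul]
    have h3 : a * T - S * b = a * (T - S) * b + a * T * (S - T) * (S * b) := by
      conv_lhs => rw [h1, h2]
      noncomm_ring
    have h4 : ∀ z : A, (2 : ℂ) • z = (2 : ℝ) • z := fun z => by
      rw [two_smul, two_smul]
    rw [a2, b2, h4, h4, ← smul_add, ← h3, smul_sub]
  rw [e]
  have : NormOneClass A := inferInstance
  have h1 : s (a * (T - S) * b) ≤ s (T - S) := by
    refine (hs.mul_right _ _).trans ?_
    refine (mul_le_of_le_one_right (hs.nonneg _) b3).trans ?_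
    exact (hs.mul_left _ _).trans (mul_le_of_le_one_left (hs.nonneg _) a3)
  have h2 : s (a * T * (S - T) * (S * b)) ≤ s (T - S) := by
    refine (hs.mul_right _ _).trans ?_
    refine (mul_le_of_le_one_right (hs.nonneg _) b4).trans ?_
    refine (hs.mul_left _ _).trans ((mul_le_of_le_one_left (hs.nonneg _) a4).trans ?_)
    rw [hs.sub_comm]
  have h3 := hs.smul_le 2 (a * (T - S) * b)
  have h4 := hs.smul_le 2 (a * T * (S - T) * (S * b))
  have h5 := hs.add_le ((2 : ℂ) • (a * (T - S) * b)) ((2 : ℂ) • (a * T * (S - T) * (S * b)))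
  norm_num at h3 h4
  linarith

theorem norm_aeval_sub_cfc_kap_le [Nontrivial A] {C η : ℝ} (hη : 0 ≤ η) {q : Polynomial ℝ}
    (hq : ∀ t ∈ Set.Icc (-C) C, |q.eval t - kap t| ≤ η) {T : A} (hT : IsSelfAdjoint T)
    (hC : ‖T‖ ≤ C) : ‖Polynomial.aeval T q - cfc kap T‖ ≤ η := by
  rw [← cfc_polynomial q T hT, ← cfc_sub q.eval kap T q.continuous.continuousOn
    continuous_kap.continuousOn]
  exact norm_cfc_le hη fun t ht => hq t (abs_le.1 (abs_le_of_mem_spectrum hC ht))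

theorem norm_cfc_kap_le {T : A} : ‖cfc kap T‖ ≤ 1 :=
  norm_cfc_le zero_le_one fun t _ => abs_kap_le t

theorem exists_cfc_kap_eq [Nontrivial A] {y : A} (hy : IsSelfAdjoint y) (h1 : ‖y‖ ≤ 1) :
    ∃ h : A, IsSelfAdjoint h ∧ cfc kap h = y := by
  refine ⟨cfc kapInv y, cfc_predicate _ _, ?_⟩
  rw [← cfc_comp kap kapInv y hy continuous_kap.continuousOn continuous_kapInv.continuousOn]
  conv_rhs => rw [← cfc_id ℝ y hy]
  exact cfc_congr fun t ht => kap_kapInv (abs_le_of_mem_spectrum h1 ht)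

end CStar

open scoped Matrix.Norms.L2Operator ComplexStarModule

variable {H : Type*} [NormedAddCommGroup H] [InnerProductSpace ℂ H] [CompleteSpace H]
  {N : VonNeumannAlgebra H}

/-- Kaplansky's density argument made polynomial. Write `y = kap(h)`, approximate `h` in 2-norm by a
selfadjoint polynomial `S` in `x`, and replace `kap` by a real polynomial `q` close to it on an
interval that contains the spectra of all evaluations of `S`. As `|kap| ≤ 1`, the evaluations of
`q(S)` have norm at most `2`, even at matrix tuples that are not microstates. -/
theorem exists_bounded_poly_of_isSelfAdjoint (τ : FaithfulNormalTrace N) {ι : Type*}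
    {x : ι → N.toStarSubalgebra}
    (hx : ∀ (a : N.toStarSubalgebra) (ε : ℝ), 0 < ε → ∃ Q, τ.norm2 (a - StarPoly.ev x Q) < ε)
    {y : N.toStarSubalgebra} (hy : IsSelfAdjoint y) (hy1 : ‖y‖ ≤ 1) {R : ℝ}
    (hR : ∀ i, ‖x i‖ ≤ R) {ε : ℝ} (hε : 0 < ε) :
    ∃ Q : StarPoly ι, τ.norm2 (y - StarPoly.ev x Q) < ε ∧ ‖StarPoly.ev x Q‖ ≤ 2 ∧
      ∀ (k : ℕ+) (X : ι → Mat k), (∀ i, ‖X i‖ ≤ R) → ‖StarPoly.ev X Q‖ ≤ 2 := by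
  have := isClosed_vonNeumann N
  have := τ.nontrivial
  have := τ.normOneClass
  have hs := τ.isTraceSeminorm
  let _ : CStarAlgebra N.toStarSubalgebra := inferInstance
  obtain ⟨h, hh, rfl⟩ := exists_cfc_kap_eq hy hy1
  -- The Lipschitz constant `4` turns `ε/8` into `ε/2`; replacing `kap` by a polynomial costs at
  -- most another `ε/4`.
  obtain ⟨Q, hQ⟩ := hx h (ε / 8) (by positivity)
  let S : StarPoly ι := (1 / 2 : ℂ) • (Q + StarPoly.adj Q)
  -- Two bounds are needed because `N` and the matrix algebras may live in different universes: `C`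
  -- is used for `N`, `D` for matrices.
  obtain ⟨C, hC0, hC⟩ := StarPoly.norm_ev_le S R
  obtain ⟨D, hD0, hD⟩ := StarPoly.norm_ev_le S R
  obtain ⟨q, hq⟩ := exists_polynomial_near_of_continuousOn (-max C D) (max C D) kap
    continuous_kap.continuousOn (min 1 (ε / 4)) (by positivity)
  replace hq : ∀ t ∈ Set.Icc (-max C D) (max C D), |q.eval t - kap t| ≤ min 1 (ε / 4) :=
    fun t ht => (hq t ht).le
  let P : StarPoly ι := Polynomial.aeval S (q.map (algebraMap ℝ ℂ))
  have hη : (0 : ℝ) ≤ min 1 (ε / 4) := by positivity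
  have hxC : ‖StarPoly.ev x S‖ ≤ max C D := (hC N.toStarSubalgebra x hR).trans (le_max_left _ _)
  have h1 := norm_aeval_sub_cfc_kap_le hη hq (StarPoly.isSelfAdjoint_ev_re x Q) hxC
  have hPx : StarPoly.ev x P = Polynomial.aeval (StarPoly.ev x S) q := by
    rw [← Polynomial.aeval_map_algebraMap ℂ, ← Polynomial.aeval_algHom_apply]
  refine ⟨P, ?_, ?_, fun k X hX => ?_⟩
  · have h2 := kap_lipschitz hs hh (StarPoly.isSelfAdjoint_ev_re x Q)
    have h3 : τ.norm2 (h - StarPoly.ev x S) ≤ ε / 8 := by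
      have e : h - StarPoly.ev x S =
          (1 / 2 : ℂ) • ((h - StarPoly.ev x Q) + star (h - StarPoly.ev x Q)) := by
        rw [StarPoly.ev_re, star_sub, hh.star_eq]
        module
      rw [e]
      have h4 := hs.smul_le (1 / 2 : ℂ) ((h - StarPoly.ev x Q) + star (h - StarPoly.ev x Q))
      have h5 := hs.add_le (h - StarPoly.ev x Q) (star (h - StarPoly.ev x Q))
      rw [hs.map_star] at h5
      have h6 : ‖(1 / 2 : ℂ)‖ = 1 / 2 := by norm_num
      rw [h6] at h4
      linarith
    have h4 := hs.sub_le (cfc kap h) (cfc kap (StarPoly.ev x S)) (StarPoly.ev x P)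
    have h5 := (hs.le_norm (cfc kap (StarPoly.ev x S) - StarPoly.ev x P))
    rw [hPx, norm_sub_rev] at h5
    have h6 : min 1 (ε / 4) ≤ ε / 4 := min_le_right _ _
    rw [hPx] at h4 ⊢
    linarith
  · rw [hPx]
    have h2 := norm_le_norm_add_norm_sub' (Polynomial.aeval (StarPoly.ev x S) q)
      (cfc kap (StarPoly.ev x S))
    have h3 : ‖cfc kap (StarPoly.ev x S)‖ ≤ 1 := norm_cfc_kap_le
    have h6 : min 1 (ε / 4) ≤ 1 := min_le_left _ _
    linarith
  · have hPX : StarPoly.ev X P = Polynomial.aeval (StarPoly.ev X S) q := by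
      rw [← Polynomial.aeval_map_algebraMap ℂ, ← Polynomial.aeval_algHom_apply]
    have h1 := norm_aeval_sub_cfc_kap_le hη hq (StarPoly.isSelfAdjoint_ev_re X Q) ((hD (Mat k) X hX).trans (le_max_right _ _))
    rw [hPX]
    have h2 := norm_le_norm_add_norm_sub' (Polynomial.aeval (StarPoly.ev X S) q)
      (cfc kap (StarPoly.ev X S))
    have h3 : ‖cfc kap (StarPoly.ev X S)‖ ≤ 1 := norm_cfc_kap_le
    have h6 : min 1 (ε / 4) ≤ 1 := min_le_left _ _
    linarith

/-- The selfadjoint case applies to the real and imaginary parts of `y / (‖y‖ + 1)`. The resulting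
bound is independent of `R`. -/
theorem exists_bounded_poly (τ : FaithfulNormalTrace N) {ι : Type*}
    {x : ι → N.toStarSubalgebra}
    (hx : ∀ (a : N.toStarSubalgebra) (ε : ℝ), 0 < ε → ∃ Q, τ.norm2 (a - StarPoly.ev x Q) < ε)
    (y : N.toStarSubalgebra) {R : ℝ} (hR : ∀ i, ‖x i‖ ≤ R) {ε : ℝ} (hε : 0 < ε) :
    ∃ Q : StarPoly ι, τ.norm2 (y - StarPoly.ev x Q) < ε ∧ ‖StarPoly.ev x Q‖ ≤ 4 * (‖y‖ + 1) ∧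
      ∀ (k : ℕ+) (X : ι → Mat k), (∀ i, ‖X i‖ ≤ R) → ‖StarPoly.ev X Q‖ ≤ 4 * (‖y‖ + 1) := by
  have := τ.normOneClass
  have hs := τ.isTraceSeminorm
  set c : ℝ := ‖y‖ + 1 with hc
  have hc0 : 0 < c := by positivity
  let y' : N.toStarSubalgebra := ((c⁻¹ : ℝ) : ℂ) • y
  have hy' : ‖y'‖ ≤ 1 := by
    rw [norm_smul, Complex.norm_real, Real.norm_of_nonneg (by positivity), inv_mul_le_one₀ hc0]
    linarith
  have hyc : y = (c : ℂ) • y' := by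
    rw [smul_smul]
    have : (c : ℂ) ≠ 0 := by exact_mod_cast hc0.ne'
    simp [this]
  have hre : ‖(ℜ y' : N.toStarSubalgebra)‖ ≤ 1 := (realPart.norm_le y').trans hy'
  have him : ‖(ℑ y' : N.toStarSubalgebra)‖ ≤ 1 := (imaginaryPart.norm_le y').trans hy'
  have hε' : 0 < ε / (2 * c) := by positivity
  obtain ⟨P, hP1, hP2, hP3⟩ := exists_bounded_poly_of_isSelfAdjoint τ hx (ℜ y').2 hre hR hε'
  obtain ⟨Q, hQ1, hQ2, hQ3⟩ := exists_bounded_poly_of_isSelfAdjoint τ hx (ℑ y').2 him hR hε'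
  have hnorm : ∀ {B : Type _} [SeminormedAddCommGroup B] [NormedSpace ℂ B] (p q : B), ‖p‖ ≤ 2 →
      ‖q‖ ≤ 2 → ‖(c : ℂ) • (p + Complex.I • q)‖ ≤ 4 * c := fun p q hp hq => by
    rw [norm_smul, Complex.norm_real, Real.norm_of_nonneg hc0.le]
    have h1 := norm_add_le p (Complex.I • q)
    rw [norm_smul, Complex.norm_I, one_mul] at h1
    nlinarith
  refine ⟨(c : ℂ) • (P + Complex.I • Q), ?_, ?_, fun k X hX => ?_⟩
  · have e : y - StarPoly.ev x ((c : ℂ) • (P + Complex.I • Q)) =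
        (c : ℂ) • (((ℜ y' : N.toStarSubalgebra) - StarPoly.ev x P) +
          Complex.I • ((ℑ y' : N.toStarSubalgebra) - StarPoly.ev x Q)) := by
      conv_lhs => rw [hyc, ← realPart_add_I_smul_imaginaryPart y']
      simp only [map_smul, map_add]
      module
    rw [e]
    refine (hs.smul_le _ _).trans_lt ?_
    rw [Complex.norm_real, Real.norm_of_nonneg hc0.le]
    have h1 := hs.add_le ((ℜ y' : N.toStarSubalgebra) - StarPoly.ev x P)
      (Complex.I • ((ℑ y' : N.toStarSubalgebra) - StarPoly.ev x Q))
    have h2 := hs.smul_le Complex.I ((ℑ y' : N.toStarSubalgebra) - StarPoly.ev x Q)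
    rw [Complex.norm_I, one_mul] at h2
    have h3 : c * (ε / (2 * c) + ε / (2 * c)) = ε := by field_simp; ring
    rw [← h3]
    exact mul_lt_mul_of_pos_left (by linarith) hc0
  · simp only [map_smul, map_add]
    exact hnorm _ _ hP2 hQ2
  · simp only [map_smul, map_add]
    rw [norm_smul, Complex.norm_real, Real.norm_of_nonneg hc0.le]
    have h1 := norm_add_le (StarPoly.ev X P) (Complex.I • StarPoly.ev X Q)
    rw [norm_smul, Complex.norm_I, one_mul] at h1
    nlinarith [hP3 k X hX, hQ3 k X hX]

end

section

/-! ## Joint microstates -/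

open scoped Matrix.Norms.L2Operator

variable {H : Type*} [NormedAddCommGroup H] [InnerProductSpace ℂ H] [CompleteSpace H]
  {N : VonNeumannAlgebra H}

theorem exists_forall_le_of_finite {α β : Type*} [Finite α] [SemilatticeSup β] [Nonempty β]
    (f : α → β) : ∃ b, ∀ a, f a ≤ b := by
  obtain ⟨b, hb⟩ := (Set.finite_range f).bddAbove
  exact ⟨b, fun a => hb ⟨a, rfl⟩⟩

/-- The polynomials in `x` are dense in `N` for the 2-norm. -/
def PolyDense (τ : FaithfulNormalTrace N) {ι : Type*} (x : ι → N.toStarSubalgebra) : Prop :=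
  ∀ (a : N.toStarSubalgebra) (ε : ℝ), 0 < ε → ∃ Q, τ.norm2 (a - StarPoly.ev x Q) < ε

theorem Generates.exists_norm2_lt {N₀ : VonNeumannAlgebra H} (τ : FaithfulNormalTrace N)
    (h : N₀ ≤ N) {q : ℕ} {y : Fin q → N₀.toStarSubalgebra} (hy : Generates N₀ y)
    (a : N₀.toStarSubalgebra) {ε : ℝ} (hε : 0 < ε) :
    ∃ Q, τ.norm2 (incl h a - StarPoly.ev (fun i => incl h (y i)) Q) < ε := by
  refine exists_norm2_sub_ev_lt τ (fun i => incl h (y i)) (incl h a) ?_ hε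
  have ha : (a : H →L[ℂ] H) ∈ (N₀ : Set (H →L[ℂ] H)) := a.2
  rw [← hy] at ha
  exact ha

theorem Generates.polyDense (τ : FaithfulNormalTrace N) {p : ℕ} {x : Fin p → N.toStarSubalgebra}
    (hx : Generates N x) : PolyDense τ x :=
  fun a _ hε => hx.exists_norm2_lt τ le_rfl a hε

theorem StarPoly.ev_elim_var {ι κ A : Type*} [Ring A] [StarRing A] [Algebra ℂ A] (X : ι → A)
    (P : κ → StarPoly ι) :
    (fun i => StarPoly.ev X (Sum.elim (fun i => StarPoly.var (i, false)) P i)) =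
      Sum.elim X fun i => StarPoly.ev X (P i) := by
  funext i
  rcases i with i | i <;> simp [letter]

/-- Microstates of `w` are obtained by evaluating at `X` polynomials `P` with `P(x)` close to `w` in
2-norm: moments of `(X, P(X))` are traces of polynomials in `X` alone. The norm bound involves only
`w`, although `P` depends on `R` and `M`. -/
theorem exists_poly_microstates (τ : FaithfulNormalTrace N) {ι κ : Type*} [Finite ι] [Finite κ]
    {x : ι → N.toStarSubalgebra} (hx : PolyDense τ x) (w : κ → N.toStarSubalgebra) (R : ℝ)
    (M : ℕ+) :
    ∃ (P : κ → StarPoly ι) (m : ℕ+),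
      (∀ (k : ℕ+) (X : ι → Mat k), (∀ i, ‖X i‖ ≤ R) →
        ∀ i, ‖StarPoly.ev X (P i)‖ ≤ 4 * (‖w i‖ + 1)) ∧
      ∀ (k : ℕ+) (X : ι → Mat k), IsMicrostate τ.toLin x m X →
        IsMicrostate τ.toLin (Sum.elim x w) M (Sum.elim X fun i => StarPoly.ev X (P i)) := by
  have := τ.normOneClass
  have hs := τ.isTraceSeminorm
  obtain ⟨B₁, hB₁⟩ := exists_forall_le_of_finite fun i => ‖x i‖
  obtain ⟨B₂, hB₂⟩ := exists_forall_le_of_finite fun i => 4 * (‖w i‖ + 1)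
  set B := max (max R B₁) B₂
  have hfin : Finite {v : List ((ι ⊕ κ) × Bool) // v.length ≤ (M : ℕ)} :=
    (List.finite_length_le _ _).to_subtype
  choose L hL0 hL using fun v : {v : List ((ι ⊕ κ) × Bool) // v.length ≤ (M : ℕ)} =>
    StarPoly.ev_lipschitz (StarPoly.word v.1) B
  obtain ⟨L', hL'⟩ := exists_forall_le_of_finite L
  have hM : (0 : ℝ) < (M : ℕ) := by exact_mod_cast M.pos
  have hL'0 : 0 < |L'| + 1 := by positivity
  -- Half of the allowed error `1/M` is for replacing `w` by `P(x)`, half for passing from `x` to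
  -- `X`.
  let ε : ℝ := 1 / (2 * (M : ℕ)) / (|L'| + 1)
  have hε : 0 < ε := by positivity
  choose P hP1 hP2 hP3 using fun i => exists_bounded_poly τ hx (w i)
    (fun j => (hB₁ j).trans (le_max_right R B₁)) hε
  let P' : ι ⊕ κ → StarPoly ι := Sum.elim (fun i => StarPoly.var (i, false)) P
  have hM2 : (0 : ℝ) < 1 / (2 * (M : ℕ)) := by positivity
  choose m hm using fun v : {v : List ((ι ⊕ κ) × Bool) // v.length ≤ (M : ℕ)} =>
    exists_order_ntr_ev τ.map_one x (StarPoly.subst P' (StarPoly.word v.1)) hM2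
  obtain ⟨m', hm'⟩ := exists_forall_le_of_finite m
  refine ⟨P, m', fun k X hX i => hP3 i k X fun j => (hX j).trans (le_max_left R B₁),
    fun k X hX v _ hv => ?_⟩
  have h1 := hm ⟨v, hv⟩ k X (hX.mono (hm' _))
  rw [StarPoly.ev_subst, StarPoly.ev_subst, StarPoly.ev_elim_var, StarPoly.ev_elim_var,
    StarPoly.ev_word] at h1
  have h2 : ‖τ.toLin (StarPoly.ev (Sum.elim x fun i => StarPoly.ev x (P i)) (StarPoly.word v)) -
      τ.toLin (wordVal (Sum.elim x w) v)‖ ≤ 1 / (2 * (M : ℕ)) := by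
    rw [← map_sub, ← StarPoly.ev_word]
    refine (τ.norm_apply_le _).trans ?_
    refine (hL ⟨v, hv⟩ N.toStarSubalgebra τ.norm2 hs (Sum.elim x fun i => StarPoly.ev x (P i))
      (Sum.elim x w) ?_ ?_ ε ?_).trans ?_
    · rintro (i | i)
      · exact (hB₁ i).trans ((le_max_right _ _).trans (le_max_left _ _))
      · exact (hP2 i).trans ((hB₂ i).trans (le_max_right _ _))
    · rintro (i | i)
      · exact (hB₁ i).trans ((le_max_right _ _).trans (le_max_left _ _))
      · refine le_trans ?_ ((hB₂ i).trans (le_max_right _ _))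
        simp only [Sum.elim_inr]
        linarith [norm_nonneg (w i)]
    · rintro (i | i)
      · simp [hs.map_zero, hε.le]
      · simp only [Sum.elim_inr]
        rw [hs.sub_comm]
        exact (hP1 i).le
    · have h3 : L ⟨v, hv⟩ ≤ |L'| + 1 := ((hL' _).trans (le_abs_self _)).trans (by linarith)
      calc L ⟨v, hv⟩ * ε ≤ (|L'| + 1) * ε := by gcongr
        _ = 1 / (2 * (M : ℕ)) := by
          simp only [ε]
          field_simp
  have h4 : (1 : ℝ) / (M : ℕ) = 1 / (2 * (M : ℕ)) + 1 / (2 * (M : ℕ)) := by field_simp; ring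
  rw [h4]
  exact (norm_sub_le_norm_sub_add_norm_sub _ _ _).trans_lt (add_lt_add_of_lt_of_le h1 h2)

/-- Diagonal choice: `M` is the largest order reached at size `k`. Requiring `m ≤ k` makes the
candidates finite in number. -/
theorem exists_level (K : ℕ+ → ℕ+) (k : ℕ+) :
    ∃ M, (∀ m, m ≤ k → K m ≤ k → m ≤ M) ∧ ∀ m, m ≤ k → K m ≤ k → K M ≤ k := by
  classical
  let S : Finset ℕ+ := (Finset.Icc 1 k).filter fun m => K m ≤ k
  have hS : ∀ m, m ≤ k → K m ≤ k → m ∈ S := fun m h1 h2 => by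
    simp [S, h1, h2]
  rcases S.eq_empty_or_nonempty with h | h
  · refine ⟨1, fun m h1 h2 => ?_, fun m h1 h2 => ?_⟩ <;>
    · have := hS m h1 h2
      simp [h] at this
  · obtain ⟨M, hM, hmax⟩ := S.exists_max_image id h
    refine ⟨M, fun m h1 h2 => hmax m (hS m h1 h2), fun m _ _ => ?_⟩
    exact (Finset.mem_filter.1 hM).2

/-- A neighbourhood constrains a whole sequence at every order, so the polynomials vary with `k`: at
size `k` those of the best order available there are used. It matters that `R'` is chosen before `R`
and `ξ`. -/
theorem exists_joint_microstates (τ : FaithfulNormalTrace N) {ι κ : Type*} [Finite ι] [Finite κ]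
    {x : ι → N.toStarSubalgebra} (hx : PolyDense τ x) (w : κ → N.toStarSubalgebra) :
    ∃ R' : ℝ, 0 < R' ∧ ∀ (R : ℝ) (ξ : ℕ+ → ℕ+), ∃ ξ' ∈ Radii,
      ∃ Φ : ∀ k : ℕ+, (ι → Mat k) → κ → Mat k,
        (∀ k X, (∀ i, ‖X i‖ < R) → ∀ i, ‖Φ k X i‖ < R') ∧
        ∀ (k : ℕ+) (X : ι → Mat k), (∀ m, ξ m ≤ k → IsMicrostate τ.toLin x m X) →
          ∀ m, ξ' m ≤ k → IsMicrostate τ.toLin (Sum.elim x w) m (Sum.elim X (Φ k X)) := by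
  obtain ⟨B, hB⟩ := exists_forall_le_of_finite fun i => 4 * (‖w i‖ + 1)
  refine ⟨|B| + 1, by positivity, fun R ξ => ?_⟩
  choose P m hP hm using exists_poly_microstates τ hx w R
  choose level h1 h2 using exists_level fun M => ξ (m M)
  -- The maximum with `M` puts the sequence in `Radii` and gives the inequality `M ≤ k` that
  -- `exists_level` requires.
  refine ⟨fun M => max (ξ (m M)) M, tendsto_atTop_mono (fun M => le_max_right _ _) tendsto_id,
    fun k X i => StarPoly.ev X (P (level k) i), fun k X hX i => ?_, fun k X hX M hM => ?_⟩
  · refine (hP _ k X (fun j => (hX j).le) i).trans_lt ?_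
    linarith [hB i, le_abs_self B]
  · have h3 : M ≤ k := (le_max_right _ _).trans hM
    have h4 : ξ (m M) ≤ k := (le_max_left _ _).trans hM
    exact (hm (level k) k X (hX _ (h2 k M h3 h4))).mono (h1 k M h3 h4)

end

section

/-! ## Approximation in the bimodule -/

variable {H : Type*} [NormedAddCommGroup H] [InnerProductSpace ℂ H] [CompleteSpace H]
  {N : VonNeumannAlgebra H}

/-- The value `∑ p(a) z_i q(b)` of a list of triples `(p, i, q)`. -/
def bimodEval {A : Type*} [Ring A] [StarRing A] [Algebra ℂ A] {κ κ' : Type*} {n : ℕ}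
    (a : κ → A) (b : κ' → A) (z : Fin n → A)
    (l : List (StarPoly κ × Fin n × StarPoly κ')) : A :=
  (l.map fun t => StarPoly.ev a t.1 * z t.2.1 * StarPoly.ev b t.2.2).sum

section Span

variable (τ : FaithfulNormalTrace N)

theorem continuous_bimodAct (a b : N.toStarSubalgebra) : Continuous (bimodAct τ a b) :=
  (ContinuousLinearMap.continuous _).comp (ContinuousLinearMap.continuous _)

theorem bimodAct_coe (a b z : N.toStarSubalgebra) :
    bimodAct τ a b ((PreL2.of τ z : PreL2 τ) : L2 τ) = ((PreL2.of τ (a * z * b) : PreL2 τ) : L2 τ) := by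
  rw [bimodAct, ContinuousLinearMap.completion_apply_coe, ContinuousLinearMap.completion_apply_coe,
    mul_assoc]
  rfl

theorem smul_bimodAct (c : ℂ) (a b : N.toStarSubalgebra) (v : L2 τ) :
    c • bimodAct τ a b v = bimodAct τ (c • a) b v := by
  induction v using UniformSpace.Completion.induction_on with
  | hp =>
    exact isClosed_eq ((continuous_bimodAct τ a b).const_smul c) (continuous_bimodAct τ _ b)
  | ih z =>
    have h := bimodAct_coe τ a b ((PreL2.of τ).symm z)
    have h' := bimodAct_coe τ (c • a) b ((PreL2.of τ).symm z)
    rw [LinearEquiv.apply_symm_apply] at h h'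
    rw [h, h', ← UniformSpace.Completion.coe_smul, ← map_smul, smul_mul_assoc, smul_mul_assoc]

/-- The vector `∑ a v_i b` of a list of triples `(a, i, b)`. -/
def bimodSum {n : ℕ} (v : Fin n → L2 τ)
    (l : List (N.toStarSubalgebra × Fin n × N.toStarSubalgebra)) : L2 τ :=
  (l.map fun t => bimodAct τ t.1 t.2.2 (v t.2.1)).sum

/-- The inclusion of lists of triples. -/
def inclTriples {N₀ N₁ : VonNeumannAlgebra H} (h₀ : N₀ ≤ N) (h₁ : N₁ ≤ N) {n : ℕ}
    (l : List (N₀.toStarSubalgebra × Fin n × N₁.toStarSubalgebra)) :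
    List (N.toStarSubalgebra × Fin n × N.toStarSubalgebra) :=
  l.map fun t => (incl h₀ t.1, t.2.1, incl h₁ t.2.2)

theorem continuous_bimodSum {n : ℕ}
    (l : List (N.toStarSubalgebra × Fin n × N.toStarSubalgebra)) :
    Continuous fun v : Fin n → L2 τ => bimodSum τ v l := by
  induction l with
  | nil => exact continuous_const
  | cons t l ih =>
    simp only [bimodSum, List.map_cons, List.sum_cons]
    exact ((continuous_bimodAct τ _ _).comp (continuous_apply t.2.1)).add ih

theorem bimodSum_coe {n : ℕ} (z : Fin n → N.toStarSubalgebra)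
    (l : List (N.toStarSubalgebra × Fin n × N.toStarSubalgebra)) :
    bimodSum τ (fun i => ((PreL2.of τ (z i) : PreL2 τ) : L2 τ)) l =
      ((PreL2.of τ (l.map fun t => t.1 * z t.2.1 * t.2.2).sum : PreL2 τ) : L2 τ) := by
  induction l with
  | nil => simp [bimodSum, UniformSpace.Completion.coe_zero]
  | cons t l ih =>
    simp only [bimodSum, List.map_cons, List.sum_cons] at ih ⊢
    rw [ih, bimodAct_coe, map_add, UniformSpace.Completion.coe_add]

theorem exists_bimodSum_eq {N₀ N₁ : VonNeumannAlgebra H} (h₀ : N₀ ≤ N) (h₁ : N₁ ≤ N) {n : ℕ}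
    (ξ : Fin n → L2 τ) {v : L2 τ}
    (hv : v ∈ Submodule.span ℂ {v : L2 τ | ∃ (a : N₀.toStarSubalgebra) (b : N₁.toStarSubalgebra)
      (i : Fin n), v = bimodAct τ (incl h₀ a) (incl h₁ b) (ξ i)}) :
    ∃ l, v = bimodSum τ ξ (inclTriples h₀ h₁ l) := by
  induction hv using Submodule.span_induction with
  | mem v hv =>
    obtain ⟨a, b, i, rfl⟩ := hv
    exact ⟨[(a, i, b)], by simp [bimodSum, inclTriples]⟩
  | zero => exact ⟨[], by simp [bimodSum, inclTriples]⟩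
  | add v w _ _ hv hw =>
    obtain ⟨l, rfl⟩ := hv
    obtain ⟨l', rfl⟩ := hw
    exact ⟨l ++ l', by simp [bimodSum, inclTriples]⟩
  | smul c v hvm hv =>
    clear hvm
    obtain ⟨l, rfl⟩ := hv
    refine ⟨l.map fun t => (c • t.1, t.2), ?_⟩
    induction l with
    | nil => simp [bimodSum, inclTriples]
    | cons t l ih =>
      simp only [bimodSum, inclTriples, List.map_cons, List.sum_cons, List.map_map] at ih ⊢
      rw [smul_add, ih, smul_bimodAct, map_smul]

end Span

theorem PolyDense.exists_norm_sub_lt {τ : FaithfulNormalTrace N} {ι : Type*}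
    {x : ι → N.toStarSubalgebra} (hx : PolyDense τ x) (v : L2 τ) {ε : ℝ} (hε : 0 < ε) :
    ∃ Q, ‖v - ((PreL2.of τ (StarPoly.ev x Q) : PreL2 τ) : L2 τ)‖ < ε := by
  obtain ⟨z, hz⟩ := UniformSpace.Completion.denseRange_coe.exists_dist_lt v (half_pos hε)
  obtain ⟨Q, hQ⟩ := hx ((PreL2.of τ).symm z) (ε / 2) (half_pos hε)
  refine ⟨Q, ?_⟩
  rw [FaithfulNormalTrace.norm2, map_sub, LinearEquiv.apply_symm_apply,
    ← UniformSpace.Completion.norm_coe, UniformSpace.Completion.coe_sub] at hQ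
  rw [dist_eq_norm] at hz
  linarith [norm_sub_le_norm_sub_add_norm_sub v (z : L2 τ)
    ((PreL2.of τ (StarPoly.ev x Q) : PreL2 τ) : L2 τ)]

theorem exists_bimodEval_near {τ : FaithfulNormalTrace N} {N₀ N₁ : VonNeumannAlgebra H}
    (h₀ : N₀ ≤ N) (h₁ : N₁ ≤ N) {q₀ q₁ : ℕ} {y₀ : Fin q₀ → N₀.toStarSubalgebra}
    {y₁ : Fin q₁ → N₁.toStarSubalgebra} (hy₀ : Generates N₀ y₀) (hy₁ : Generates N₁ y₁) {n : ℕ}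
    (z : Fin n → N.toStarSubalgebra)
    (l : List (N₀.toStarSubalgebra × Fin n × N₁.toStarSubalgebra)) {ε : ℝ} (hε : 0 < ε) :
    ∃ l', τ.norm2 (((inclTriples h₀ h₁ l).map fun t => t.1 * z t.2.1 * t.2.2).sum -
      bimodEval (fun i => incl h₀ (y₀ i)) (fun i => incl h₁ (y₁ i)) z l') < ε := by
  have := τ.normOneClass
  have hs := τ.isTraceSeminorm
  induction l generalizing ε with
  | nil => exact ⟨[], by simp [bimodEval, inclTriples, hs.map_zero, hε]⟩
  | cons t l ih =>
    obtain ⟨l', hl'⟩ := ih (half_pos hε)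
    obtain ⟨a, i, b⟩ := t
    have hε4 : 0 < ε / 4 := by positivity
    -- The order of choice matters: the operator norm of `b'` is not controlled, so the tolerance
    -- for `a` is fixed only once `b'` is known.
    obtain ⟨Q, hQ⟩ := hy₁.exists_norm2_lt τ h₁ b
      (ε := ε / 4 / (‖incl h₀ a‖ * ‖z i‖ + 1)) (by positivity)
    set b' := StarPoly.ev (fun i => incl h₁ (y₁ i)) Q
    obtain ⟨P, hP⟩ := hy₀.exists_norm2_lt τ h₀ a
      (ε := ε / 4 / (‖z i‖ * ‖b'‖ + 1)) (by positivity)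
    set a' := StarPoly.ev (fun i => incl h₀ (y₀ i)) P
    refine ⟨(P, i, Q) :: l', ?_⟩
    rw [lt_div_iff₀ (by positivity)] at hP hQ
    have h1 : τ.norm2 (incl h₀ a * z i * (incl h₁ b - b')) < ε / 4 := by
      refine (hs.mul_left _ _).trans_lt (lt_of_le_of_lt ?_ hQ)
      rw [mul_comm]
      refine mul_le_mul_of_nonneg_left ?_ (hs.nonneg _)
      exact (norm_mul_le _ _).trans (by linarith)
    have h2 : τ.norm2 ((incl h₀ a - a') * (z i * b')) < ε / 4 := by
      refine (hs.mul_right _ _).trans_lt (lt_of_le_of_lt ?_ hP)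
      refine mul_le_mul_of_nonneg_left ?_ (hs.nonneg _)
      exact (norm_mul_le _ _).trans (by linarith)
    have e : ((inclTriples h₀ h₁ ((a, i, b) :: l)).map fun t => t.1 * z t.2.1 * t.2.2).sum -
        bimodEval (fun i => incl h₀ (y₀ i)) (fun i => incl h₁ (y₁ i)) z ((P, i, Q) :: l') =
        (incl h₀ a * z i * (incl h₁ b - b') + (incl h₀ a - a') * (z i * b')) +
        (((inclTriples h₀ h₁ l).map fun t => t.1 * z t.2.1 * t.2.2).sum -
          bimodEval (fun i => incl h₀ (y₀ i)) (fun i => incl h₁ (y₁ i)) z l') := by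
      simp only [inclTriples, bimodEval, List.map_cons, List.sum_cons]
      change _ - (a' * z i * b' + _) = _
      noncomm_ring
    rw [e]
    linarith [hs.add_le (incl h₀ a * z i * (incl h₁ b - b') + (incl h₀ a - a') * (z i * b'))
      (((inclTriples h₀ h₁ l).map fun t => t.1 * z t.2.1 * t.2.2).sum -
          bimodEval (fun i => incl h₀ (y₀ i)) (fun i => incl h₁ (y₁ i)) z l'),
      hs.add_le (incl h₀ a * z i * (incl h₁ b - b')) ((incl h₀ a - a') * (z i * b'))]

/-- All targets must share the same `n` middle factors, since these are the parameters to be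
counted. The lists of coefficients are therefore fixed first, with the true vectors `ξ_i`; then the
`ξ_i` are replaced by polynomials in `x`, by continuity of finitely many sums; last come polynomials
for the coefficients. -/
theorem exists_bimodule_approx (τ : FaithfulNormalTrace N) {ι : Type*}
    {x : ι → N.toStarSubalgebra} (hx : PolyDense τ x) {N₀ N₁ : VonNeumannAlgebra H}
    (h₀ : N₀ ≤ N) (h₁ : N₁ ≤ N) {q₀ q₁ : ℕ} {y₀ : Fin q₀ → N₀.toStarSubalgebra}
    {y₁ : Fin q₁ → N₁.toStarSubalgebra} (hy₀ : Generates N₀ y₀) (hy₁ : Generates N₁ y₁) {n : ℕ}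
    {ξ : Fin n → L2 τ} (hξ : closedBimodSpan τ h₀ h₁ ξ = ⊤) {κ : Type*} [Finite κ]
    (t : κ → N.toStarSubalgebra) {ε : ℝ} (hε : 0 < ε) :
    ∃ (Q : Fin n → StarPoly ι) (l : κ → List (StarPoly (Fin q₀) × Fin n × StarPoly (Fin q₁))),
      ∀ j, τ.norm2 (t j - bimodEval (fun i => incl h₀ (y₀ i)) (fun i => incl h₁ (y₁ i))
        (fun i => StarPoly.ev x (Q i)) (l j)) < ε := by
  have := τ.normOneClass
  have hs := τ.isTraceSeminorm
  have hε3 : 0 < ε / 3 := by positivity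
  have step1 : ∀ j, ∃ l, ‖((PreL2.of τ (t j) : PreL2 τ) : L2 τ) -
      bimodSum τ ξ (inclTriples h₀ h₁ l)‖ < ε / 3 := by
    intro j
    have hmem : ((PreL2.of τ (t j) : PreL2 τ) : L2 τ) ∈ closedBimodSpan τ h₀ h₁ ξ := by
      rw [hξ]; trivial
    obtain ⟨v, hv, hd⟩ := Metric.mem_closure_iff.1 hmem (ε / 3) hε3
    obtain ⟨l, rfl⟩ := exists_bimodSum_eq τ h₀ h₁ ξ hv
    exact ⟨l, by rwa [← dist_eq_norm]⟩
  choose l hl using step1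
  choose Q hQ using fun (m : ℕ) (i : Fin n) =>
    hx.exists_norm_sub_lt (ξ i) (Nat.one_div_pos_of_nat (n := m) (α := ℝ))
  have hlim : Tendsto (fun m i => ((PreL2.of τ (StarPoly.ev x (Q m i)) : PreL2 τ) : L2 τ)) atTop
      (𝓝 ξ) := by
    rw [tendsto_pi_nhds]
    intro i
    rw [tendsto_iff_norm_sub_tendsto_zero]
    refine squeeze_zero (fun _ => norm_nonneg _) (fun m => ?_)
      tendsto_one_div_add_atTop_nhds_zero_nat
    rw [norm_sub_rev]
    exact (hQ m i).le
  have hev : ∀ᶠ m in atTop, ∀ j, ‖bimodSum τ (fun i => ((PreL2.of τ (StarPoly.ev x (Q m i)) :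
      PreL2 τ) : L2 τ)) (inclTriples h₀ h₁ (l j)) - bimodSum τ ξ (inclTriples h₀ h₁ (l j))‖
      < ε / 3 := by
    rw [eventually_all]
    intro j
    have := ((continuous_bimodSum τ (inclTriples h₀ h₁ (l j))).tendsto ξ).comp hlim
    rw [tendsto_iff_norm_sub_tendsto_zero] at this
    exact this.eventually (gt_mem_nhds hε3)
  obtain ⟨m, hm⟩ := hev.exists
  choose l' hl' using fun j => exists_bimodEval_near (τ := τ) h₀ h₁ hy₀ hy₁
    (fun i => StarPoly.ev x (Q m i)) (l j) hε3
  refine ⟨Q m, l', fun j => ?_⟩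
  have h1 := hl j
  have h2 := hm j
  have h3 := hl' j
  rw [bimodSum_coe] at h2
  have h4 := norm_sub_le_norm_sub_add_norm_sub ((PreL2.of τ (t j) : PreL2 τ) : L2 τ)
    (bimodSum τ ξ (inclTriples h₀ h₁ (l j)))
    ((PreL2.of τ ((inclTriples h₀ h₁ (l j)).map fun s =>
      s.1 * StarPoly.ev x (Q m s.2.1) * s.2.2).sum : PreL2 τ) : L2 τ)
  rw [← UniformSpace.Completion.coe_sub, ← map_sub, UniformSpace.Completion.norm_coe] at h4
  rw [norm_sub_rev] at h2
  have h5 := hs.sub_le (t j) ((inclTriples h₀ h₁ (l j)).map fun s =>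
      s.1 * StarPoly.ev x (Q m s.2.1) * s.2.2).sum (bimodEval (fun i => incl h₀ (y₀ i))
        (fun i => incl h₁ (y₁ i)) (fun i => StarPoly.ev x (Q m i)) (l' j))
  change τ.norm2 _ ≤ _ at h4
  linarith

end

/-! ## Nets -/

section Net

variable {E : Type*} [NormedAddCommGroup E] [NormedSpace ℝ E] [FiniteDimensional ℝ E]

/-- Volume comparison: the balls of radius `η/2` about the points are disjoint and lie in the ball
of radius `r + η/2`. -/
theorem card_le_of_separated {s : Finset E} {r η : ℝ} (hr : 0 ≤ r) (hη : 0 < η)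
    (hs : ∀ c ∈ s, ‖c‖ ≤ r) (h : ∀ c ∈ s, ∀ d ∈ s, c ≠ d → η ≤ ‖c - d‖) :
    (s.card : ℝ) ≤ (1 + 2 * r / η) ^ Module.finrank ℝ E := by
  borelize E
  let μ : MeasureTheory.Measure E := MeasureTheory.Measure.addHaar
  have hη2 : 0 < η / 2 := half_pos hη
  have hρ : 0 < r + η / 2 := by positivity
  have D : Set.Pairwise (s : Set E) (Function.onFun Disjoint fun c => Metric.ball c (η / 2)) := by
    rintro c hc d hd hcd
    apply Metric.ball_disjoint_ball
    rw [dist_eq_norm, add_halves]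
    exact h c hc d hd hcd
  have hsub : (⋃ c ∈ s, Metric.ball c (η / 2)) ⊆ Metric.ball (0 : E) (r + η / 2) := by
    refine Set.iUnion₂_subset fun c hc => Metric.ball_subset_ball' ?_
    rw [dist_zero_right]
    linarith [hs c hc]
  have I : (s.card : ℝ≥0∞) * ENNReal.ofReal ((η / 2) ^ Module.finrank ℝ E) * μ (Metric.ball 0 1) ≤
      ENNReal.ofReal ((r + η / 2) ^ Module.finrank ℝ E) * μ (Metric.ball 0 1) := by
    calc _ = μ (⋃ c ∈ s, Metric.ball c (η / 2)) := by
          rw [MeasureTheory.measure_biUnion_finset D fun c _ => measurableSet_ball]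
          simp only [μ.addHaar_ball_of_pos _ hη2]
          simp only [Finset.sum_const, nsmul_eq_mul, mul_assoc]
      _ ≤ μ (Metric.ball (0 : E) (r + η / 2)) := MeasureTheory.measure_mono hsub
      _ = _ := by simp only [μ.addHaar_ball_of_pos _ hρ]
  have J := (ENNReal.mul_le_mul_iff_left (Metric.measure_ball_pos _ _ zero_lt_one).ne'
    MeasureTheory.measure_ball_lt_top.ne).1 I
  have K := ENNReal.toReal_le_of_le_ofReal (pow_nonneg hρ.le _) J
  rw [ENNReal.toReal_mul, ENNReal.toReal_natCast, ENNReal.toReal_ofReal (by positivity)] at K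
  have e : 1 + 2 * r / η = (r + η / 2) / (η / 2) := by field_simp; ring
  rw [e, div_pow, le_div_iff₀ (by positivity)]
  exact K

/-- A separated set of maximal cardinality is a net, since an uncovered point could be added to it.
-/
theorem exists_net (E : Type*) [NormedAddCommGroup E] [NormedSpace ℝ E] [FiniteDimensional ℝ E]
    {r η : ℝ} (hr : 0 ≤ r) (hη : 0 < η) :
    ∃ s : Finset E, (s.card : ℝ) ≤ (1 + 2 * r / η) ^ Module.finrank ℝ E ∧ (∀ c ∈ s, ‖c‖ ≤ r) ∧
      ∀ a : E, ‖a‖ ≤ r → ∃ c ∈ s, ‖a - c‖ < η := by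
  classical
  let C : Set ℕ := {m | ∃ s : Finset E, s.card = m ∧ (∀ c ∈ s, ‖c‖ ≤ r) ∧
    ∀ c ∈ s, ∀ d ∈ s, c ≠ d → η ≤ ‖c - d‖}
  have hC0 : C.Nonempty := ⟨0, ∅, by simp⟩
  have hC1 : BddAbove C := by
    refine ⟨⌊(1 + 2 * r / η) ^ Module.finrank ℝ E⌋₊, ?_⟩
    rintro m ⟨s, rfl, h1, h2⟩
    exact Nat.le_floor (card_le_of_separated hr hη h1 h2)
  obtain ⟨s, hs, h1, h2⟩ := Nat.sSup_mem hC0 hC1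
  refine ⟨s, card_le_of_separated hr hη h1 h2, h1, fun a ha => ?_⟩
  by_contra! hcon
  have has : a ∉ s := fun has => by
    have := hcon a has
    rw [sub_self, norm_zero] at this
    linarith
  have : (insert a s).card ≤ sSup C := by
    refine le_csSup hC1 ⟨insert a s, rfl, ?_, ?_⟩
    · intro c hc
      rcases Finset.mem_insert.1 hc with rfl | hc
      · exact ha
      · exact h1 c hc
    · intro c hc d hd hcd
      rcases Finset.mem_insert.1 hc with hc' | hc' <;> rcases Finset.mem_insert.1 hd with hd' | hd'
      · exact absurd (hc'.trans hd'.symm) hcd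
      · rw [hc']; exact hcon d hd'
      · rw [hd', norm_sub_rev]; exact hcon c hc'
      · exact h2 c hc' d hd' hcd
  rw [Finset.card_insert_of_notMem has, hs] at this
  omega

end Net

/-! ### The exponential is Lipschitz on bounded sets -/

section Exp

variable {A : Type*} [NormedRing A] [NormOneClass A]

theorem norm_pow_sub_pow_le {a b : A} {M : ℝ} (ha : ‖a‖ ≤ M) (hb : ‖b‖ ≤ M) (n : ℕ) :
    ‖a ^ (n + 1) - b ^ (n + 1)‖ ≤ (n + 1) * M ^ n * ‖a - b‖ := by
  have hM : 0 ≤ M := (norm_nonneg a).trans ha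
  induction n with
  | zero => simp
  | succ n ih =>
    have e : a ^ (n + 1 + 1) - b ^ (n + 1 + 1) =
        (a ^ (n + 1) - b ^ (n + 1)) * a + b ^ (n + 1) * (a - b) := by
      rw [pow_succ a (n + 1), pow_succ b (n + 1)]; noncomm_ring
    rw [e]
    have h1 : ‖b ^ (n + 1)‖ ≤ M ^ (n + 1) :=
      (norm_pow_le b (n + 1)).trans (pow_le_pow_left₀ (norm_nonneg _) hb _)
    calc _ ≤ ‖a ^ (n + 1) - b ^ (n + 1)‖ * ‖a‖ + ‖b ^ (n + 1)‖ * ‖a - b‖ :=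
          (norm_add_le _ _).trans (add_le_add (norm_mul_le _ _) (norm_mul_le _ _))
      _ ≤ ((n + 1) * M ^ n * ‖a - b‖) * M + M ^ (n + 1) * ‖a - b‖ := by gcongr
      _ = _ := by push_cast; ring

theorem norm_exp_sub_exp_le [NormedAlgebra ℂ A] [CompleteSpace A] {a b : A} {M : ℝ} (ha : ‖a‖ ≤ M) (hb : ‖b‖ ≤ M) :
    ‖NormedSpace.exp a - NormedSpace.exp b‖ ≤ Real.exp M * ‖a - b‖ := by
  have h1 := (NormedSpace.exp_series_hasSum_exp' (𝕂 := ℂ) a).sub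
    (NormedSpace.exp_series_hasSum_exp' (𝕂 := ℂ) b)
  have h2 : HasSum (fun n : ℕ => M ^ n / (n.factorial : ℝ) * ‖a - b‖) (Real.exp M * ‖a - b‖) := by
    have := NormedSpace.expSeries_div_hasSum_exp (𝔸 := ℝ) M
    rw [← Real.exp_eq_exp_ℝ] at this
    exact this.mul_right _
  rw [← hasSum_nat_add_iff' 1] at h1
  simp only [Finset.sum_range_one, pow_zero, sub_self, sub_zero] at h1
  refine h1.norm_le_of_bounded h2 fun n => ?_
  rw [← smul_sub, norm_smul]
  refine (mul_le_mul_of_nonneg_left (norm_pow_sub_pow_le ha hb n) (norm_nonneg _)).trans_eq ?_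
  rw [norm_inv, Complex.norm_natCast, Nat.factorial_succ]
  push_cast
  have : (n.factorial : ℝ) ≠ 0 := by positivity
  have : (n + 1 : ℝ) ≠ 0 := by positivity
  field_simp

end Exp

/-! ### Operator norm nets in the unitary group -/

section Unitary

open scoped Matrix.Norms.L2Operator

theorem exists_exp_eq_of_mem_unitary {k : ℕ+} {U : Mat k} (hU : U ∈ unitary (Mat k)) :
    ∃ K : Mat k, star K = -K ∧ ‖K‖ ≤ Real.pi ∧ NormedSpace.exp K = U := by
  have hn : IsStarNormal U := ⟨by
    rw [Commute, SemiconjBy, (Unitary.mem_iff.1 hU).1, (Unitary.mem_iff.1 hU).2]⟩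
  have hfin : Finite (spectrum ℂ U) := (Matrix.finite_spectrum U).to_subtype
  let g : ℂ → ℂ := fun z => z.arg * Complex.I
  -- The argument jumps at the negative axis, but the spectrum is finite, hence discrete.
  have hg : ContinuousOn g (spectrum ℂ U) := by
    rw [continuousOn_iff_continuous_domRestrict]
    exact continuous_of_discreteTopology
  refine ⟨cfc g U, ?_, ?_, ?_⟩
  · rw [← cfc_star, ← cfc_neg]
    exact cfc_congr fun z _ => by simp [g]
  · refine norm_cfc_le Real.pi_pos.le fun z _ => ?_
    simp only [g, norm_mul, Complex.norm_I, mul_one, Complex.norm_real, Real.norm_eq_abs]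
    exact Complex.abs_arg_le_pi z
  · have h1 : IsStarNormal (cfc g U) := cfc_predicate g U
    rw [← CFC.complex_exp_eq_normedSpace_exp h1, ← cfc_comp Complex.exp g U hn
      Complex.continuous_exp.continuousOn hg]
    conv_rhs => rw [← cfc_id ℂ U hn]
    refine cfc_congr fun z hz => ?_
    have hz1 : ‖z‖ = 1 := by
      simpa using Unitary.spectrum_subset_circle ⟨U, hU⟩ hz
    have := Complex.norm_mul_exp_arg_mul_I z
    rw [hz1, Complex.ofReal_one, one_mul] at this
    simpa [g] using this

/-- For skew-adjoint `K` the real part is antisymmetric and the imaginary part symmetric, so the sum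
of the two, a real matrix, determines `K`. -/
theorem finrank_skewAdjoint_le (k : ℕ+) :
    Module.finrank ℝ (skewAdjoint.submodule ℝ (Mat k)) ≤ (k : ℕ) ^ 2 := by
  let φ : skewAdjoint.submodule ℝ (Mat k) →ₗ[ℝ] Matrix (Fin (k : ℕ)) (Fin (k : ℕ)) ℝ :=
    { toFun := fun K => Matrix.of fun i j => ((K : Mat k) i j).re + ((K : Mat k) i j).im
      map_add' := fun K L => by ext i j; simp; ring
      map_smul' := fun c K => by ext i j; simp; ring }
  have hφ : Function.Injective φ := by
    rw [← LinearMap.ker_eq_bot, LinearMap.ker_eq_bot']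
    intro K hK
    ext i j
    have hs : star (K : Mat k) = -K := K.2
    have h1 := congrFun (congrFun hK i) j
    have h2 := congrFun (congrFun hK j) i
    have h3 := congrFun (congrFun hs i) j
    change ((K : Mat k) i j).re + ((K : Mat k) i j).im = 0 at h1
    change ((K : Mat k) j i).re + ((K : Mat k) j i).im = 0 at h2
    rw [Matrix.star_apply, Matrix.neg_apply] at h3
    have h4 := congrArg Complex.re h3
    have h5 := congrArg Complex.im h3
    simp at h4 h5
    apply Complex.ext
    · simp; linarith
    · simp; linarith
  have := LinearMap.finrank_le_finrank_of_injective hφ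
  simpa [Module.finrank_matrix, sq] using this

/-- The net is the exponential of a net in the skew-adjoint matrices of norm at most `π`. Its
exponent, the real dimension `k²`, is the source of the summand `1` in the final bound. -/
theorem exists_unitary_net (k : ℕ+) {η : ℝ} (hη : 0 < η) :
    ∃ s : Finset (Mat k),
      (s.card : ℝ) ≤ (1 + 2 * (Real.pi * Real.exp Real.pi) / η) ^ (k : ℕ) ^ 2 ∧
        ∀ U ∈ unitary (Mat k), ∃ c ∈ s, ‖U - c‖ < η := by
  classical
  have hη' : 0 < η / Real.exp Real.pi := by positivity
  obtain ⟨s, hs1, hs2, hs3⟩ := exists_net (skewAdjoint.submodule ℝ (Mat k)) Real.pi_pos.le hη'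
  refine ⟨s.image (fun K : skewAdjoint.submodule ℝ (Mat k) => NormedSpace.exp (K : Mat k)), ?_, fun U hU => ?_⟩
  · have h1 : ((s.image (fun K : skewAdjoint.submodule ℝ (Mat k) => NormedSpace.exp (K : Mat k))).card : ℝ) ≤ s.card := by
      exact_mod_cast Finset.card_image_le
    refine (h1.trans hs1).trans ?_
    have e : 2 * Real.pi / (η / Real.exp Real.pi) = 2 * (Real.pi * Real.exp Real.pi) / η := by
      field_simp
    rw [e]
    refine pow_le_pow_right₀ ?_ (finrank_skewAdjoint_le k)
    have : 0 ≤ 2 * (Real.pi * Real.exp Real.pi) / η := by positivity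
    linarith
  · obtain ⟨K, hK1, hK2, rfl⟩ := exists_exp_eq_of_mem_unitary hU
    obtain ⟨c, hc, hd⟩ := hs3 ⟨K, hK1⟩ hK2
    refine ⟨_, Finset.mem_image_of_mem _ hc, ?_⟩
    refine (norm_exp_sub_exp_le hK2 (hs2 c hc)).trans_lt ?_
    rw [lt_div_iff₀ (Real.exp_pos _)] at hd
    rw [mul_comm]
    exact hd

end Unitary

/-! ## Covering numbers -/

section Cover

variable {X : Type*} {ball : X → Set X} {Γ : Set X}

/-- Centres must belong to `Γ`, so net points cannot serve as centres; one element of `Γ` is chosen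
for each index that occurs. -/
theorem minCover_le_of_index {I : Type*} (s : Finset I) (f : X → I) (hf : ∀ a ∈ Γ, f a ∈ s)
    (h : ∀ a ∈ Γ, ∀ b ∈ Γ, f a = f b → a ∈ ball b) : minCover ball Γ ≤ (s.card : ℕ∞) := by
  classical
  rcases Γ.eq_empty_or_nonempty with rfl | ⟨x₀, hx₀⟩
  · refine (iInf₂_le ∅ (by simp)).trans (by simp)
  let g : I → X := fun i => if hi : ∃ a ∈ Γ, f a = i then hi.choose else x₀
  have hg : ∀ i, g i ∈ Γ := fun i => by
    simp only [g]
    split_ifs with hi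
    · exact hi.choose_spec.1
    · exact hx₀
  have hg2 : ∀ a ∈ Γ, f (g (f a)) = f a := fun a ha => by
    have hi : ∃ b ∈ Γ, f b = f a := ⟨a, ha, rfl⟩
    simp only [g, dif_pos hi]
    exact hi.choose_spec.2
  refine (iInf₂_le (s.image g) ⟨?_, fun a ha => ?_⟩).trans (by exact_mod_cast Finset.card_image_le)
  · intro a ha
    obtain ⟨i, -, rfl⟩ := Finset.mem_image.1 (Finset.mem_coe.1 ha)
    exact hg i
  · exact Set.mem_iUnion₂.2 ⟨g (f a), Finset.mem_image_of_mem _ (hf a ha),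
      h a ha _ (hg _) (hg2 a ha).symm⟩

theorem exists_cover_of_minCover_ne_top (h : minCover ball Γ ≠ ⊤) :
    ∃ F : Finset X, (F : Set X) ⊆ Γ ∧ Γ ⊆ ⋃ c ∈ F, ball c ∧ (F.card : ℕ∞) = minCover ball Γ := by
  have e : minCover ball Γ =
      ⨅ F : {F : Finset X // (F : Set X) ⊆ Γ ∧ Γ ⊆ ⋃ c ∈ F, ball c}, (F.1.card : ℕ∞) :=
    iInf_subtype'
  rcases isEmpty_or_nonempty {F : Finset X // (F : Set X) ⊆ Γ ∧ Γ ⊆ ⋃ c ∈ F, ball c} with he | hne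
  · rw [e, iInf_of_empty] at h
    exact absurd rfl h
  · obtain ⟨F, hF⟩ := ENat.exists_eq_iInf
      fun F : {F : Finset X // (F : Set X) ⊆ Γ ∧ Γ ⊆ ⋃ c ∈ F, ball c} => (F.1.card : ℕ∞)
    exact ⟨F.1, F.2.1, F.2.2, by rw [e, hF]⟩

end Cover

/-! ### Counting the tuples that factor through a linear map -/

section Count

open scoped Matrix.Norms.L2Operator

/-- The net lies in the range of `L`, not in its domain. No bound on `Z` and no Lipschitz constant
of `L` enters; both would depend on the polynomials and so on `δ`. -/
theorem exists_range_net {k : ℕ+} {m : ℕ} {V : Type*} [AddCommGroup V] [Module ℂ V]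
    [FiniteDimensional ℂ V] (L : V →ₗ[ℂ] (Fin m → Mat k)) {ρ η : ℝ} (hρ : 0 ≤ ρ) (hη : 0 < η) :
    ∃ s : Finset (EuclideanSpace ℂ (Fin m × Fin (k : ℕ) × Fin (k : ℕ))),
      (s.card : ℝ) ≤ (1 + 2 * ρ / η) ^ (2 * Module.finrank ℂ V) ∧
      ∀ Z, tnorm (L Z) ≤ ρ → ∃ c ∈ s, ‖entries (L Z) - c‖ < √(k : ℕ) * η := by
  classical
  have hk : (0 : ℝ) < √((k : ℕ) : ℝ) := by
    rw [Real.sqrt_pos]; exact_mod_cast k.pos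
  let W := LinearMap.range (entries ∘ₗ L)
  have : FiniteDimensional ℝ W := FiniteDimensional.complexToReal W
  obtain ⟨s, hs1, -, hs3⟩ := exists_net W (r := √(k : ℕ) * ρ) (η := √(k : ℕ) * η)
    (by positivity) (by positivity)
  refine ⟨s.image (fun w : W => (w : EuclideanSpace ℂ (Fin m × Fin (k : ℕ) × Fin (k : ℕ)))), ?_,
    fun Z hZ => ?_⟩
  · refine le_trans (by exact_mod_cast Finset.card_image_le) (hs1.trans ?_)
    have e : 2 * (√(k : ℕ) * ρ) / (√(k : ℕ) * η) = 2 * ρ / η := by field_simp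
    rw [e, finrank_real_of_complex]
    refine pow_le_pow_right₀ ?_ (Nat.mul_le_mul_left 2 (LinearMap.finrank_range_le _))
    have : 0 ≤ 2 * ρ / η := by positivity
    linarith
  · obtain ⟨c, hc, hd⟩ := hs3 ⟨entries (L Z), ⟨Z, rfl⟩⟩ (by
      change ‖entries (L Z)‖ ≤ _
      rw [norm_entries]
      gcongr)
    exact ⟨c, Finset.mem_image_of_mem _ hc, hd⟩

theorem hsNorm_sub_lt_of_entries {k : ℕ+} {m : ℕ} {S T : Fin m → Mat k} {η : ℝ}
    {c : EuclideanSpace ℂ (Fin m × Fin (k : ℕ) × Fin (k : ℕ))}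
    (hS : ‖entries S - c‖ < √(k : ℕ) * η) (hT : ‖entries T - c‖ < √(k : ℕ) * η) (j : Fin m) :
    hsNorm (S j - T j) < 2 * η := by
  have hk : (0 : ℝ) < √((k : ℕ) : ℝ) := by
    rw [Real.sqrt_pos]; exact_mod_cast k.pos
  refine (hsNorm_le_tnorm (S - T) j).trans_lt ?_
  have h1 := norm_sub_le_norm_sub_add_norm_sub (entries S) c (entries T)
  rw [norm_sub_rev c, ← map_sub, norm_entries] at h1
  exact lt_of_mul_lt_mul_left (by linarith) hk.le

/-- The data that determine a tuple `X` up to a small error: `X ≈ U T_{·+1} V*` and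
`1 ≈ U T_0 V*`. -/
structure IsFactored {k : ℕ+} {p : ℕ} (r η : ℝ) (X : Fin p → Mat k) (T : Fin (p + 1) → Mat k)
    (U V : Mat k) (X' : Fin p → Mat k) : Prop where
  left_mem : U ∈ unitary (Mat k)
  right_mem : V ∈ unitary (Mat k)
  norm_le : ∀ j, ‖X' j‖ ≤ r
  near : ∀ j, hsNorm (X j - X' j) ≤ η
  approx : ∀ j : Fin p, hsNorm (X' j - U * T j.succ * star V) ≤ η
  approx_one : hsNorm (1 - U * T 0 * star V) ≤ η

theorem hsNorm_conj_sub_le {k : ℕ+} {η : ℝ} {B T U V : Mat k}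
    (hU : U ∈ unitary (Mat k)) (hV : V ∈ unitary (Mat k)) (h : hsNorm (B - U * T * star V) ≤ η) :
    hsNorm (star U * B * V - T) ≤ η := by
  have e : star U * B * V - T = star U * (B - U * T * star V) * V := by
    rw [mul_sub, sub_mul]
    congr 1
    calc T = 1 * T * 1 := by rw [one_mul, mul_one]
      _ = star U * U * T * (star V * V) := by
        rw [(Unitary.mem_iff.1 hU).1, (Unitary.mem_iff.1 hV).1]
      _ = _ := by noncomm_ring
  rwa [e, hsNorm_mul_unitary hV, hsNorm_unitary_mul (Unitary.star_mem hU)]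

/-- Since `T ≈ U* (1, X') V`, its size is controlled by `r` alone, whatever linear map produced it.
-/
theorem IsFactored.tnorm_le {k : ℕ+} {p : ℕ} {r η : ℝ} (hr : 0 ≤ r)
    {X : Fin p → Mat k} {T : Fin (p + 1) → Mat k} {U V : Mat k} {X' : Fin p → Mat k}
    (h : IsFactored r η X T U V X') : tnorm T ≤ (p + 1) * (r + 1 + η) := by
  have hs := isTraceSeminorm_hsNorm k
  have key : ∀ (B S : Mat k), hsNorm (B - U * S * star V) ≤ η → ‖B‖ ≤ r + 1 →
      hsNorm S ≤ r + 1 + η := by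
    intro B S h1 h2
    have h3 := hs.le_add_sub (U * S * star V) B
    rw [hsNorm_mul_unitary (Unitary.star_mem h.right_mem), hsNorm_unitary_mul h.left_mem,
      hs.sub_comm] at h3
    linarith [hs.le_norm B]
  refine (tnorm_le_sum T).trans ((Finset.sum_le_card_nsmul _ _ (r + 1 + η) fun j _ => ?_).trans_eq
    (by simp; ring))
  refine Fin.cases ?_ (fun j => ?_) j
  · exact key 1 _ h.approx_one (by rw [norm_one]; linarith)
  · exact key _ _ (h.approx j) (by linarith [h.norm_le j])

/-- `V` need not be compared: `T_0` determines `W = U*V`, the other `T_j` determine `A W` with `A =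
U* X' U`, hence `A`, and `U` then determines `X' = U A U*`. -/
theorem IsFactored.hsNorm_sub_le {k : ℕ+} {p : ℕ} {r η : ℝ} (hη : 0 ≤ η)
    {X₁ X₂ : Fin p → Mat k} {T₁ T₂ : Fin (p + 1) → Mat k} {U₁ V₁ U₂ V₂ : Mat k}
    {X₁' X₂' : Fin p → Mat k} (h₁ : IsFactored r η X₁ T₁ U₁ V₁ X₁')
    (h₂ : IsFactored r η X₂ T₂ U₂ V₂ X₂') (hT : ∀ j, hsNorm (T₁ j - T₂ j) ≤ 2 * η)
    (hU : ‖U₁ - U₂‖ ≤ 2 * η) (j : Fin p) : hsNorm (X₁ j - X₂ j) ≤ (6 + 8 * r) * η := by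
  have hs := isTraceSeminorm_hsNorm k
  have hr : 0 ≤ r := (norm_nonneg _).trans (h₁.norm_le j)
  have hU₁ := Unitary.mem_iff.1 h₁.left_mem
  have hU₂ := Unitary.mem_iff.1 h₂.left_mem
  set W₁ := star U₁ * V₁ with hW₁
  set W₂ := star U₂ * V₂ with hW₂
  have hW₁u : W₁ ∈ unitary (Mat k) := mul_mem (Unitary.star_mem h₁.left_mem) h₁.right_mem
  set A₁ := star U₁ * X₁' j * U₁ with hA₁
  set A₂ := star U₂ * X₂' j * U₂ with hA₂
  have hA₂n : ‖A₂‖ ≤ r := by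
    have e1 := norm_mul_le (star U₂ * X₂' j) U₂
    have e2 := norm_mul_le (star U₂) (X₂' j)
    rw [norm_star, norm_unitary h₂.left_mem, one_mul] at e2
    rw [norm_unitary h₂.left_mem, mul_one] at e1
    linarith [h₂.norm_le j]
  have d : ∀ {S₁ S₂ B₁ B₂ : Mat k}, hsNorm (B₁ - S₁) ≤ η → hsNorm (B₂ - S₂) ≤ η →
      hsNorm (S₁ - S₂) ≤ 2 * η → hsNorm (B₁ - B₂) ≤ 4 * η := by
    intro S₁ S₂ B₁ B₂ e1 e2 e3
    have e4 := hs.sub_le B₁ S₁ B₂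
    have e5 := hs.sub_le S₁ S₂ B₂
    rw [hs.sub_comm S₂ B₂] at e5
    linarith
  have hW : hsNorm (W₁ - W₂) ≤ 4 * η := by
    have e1 := hsNorm_conj_sub_le h₁.left_mem h₁.right_mem h₁.approx_one
    have e2 := hsNorm_conj_sub_le h₂.left_mem h₂.right_mem h₂.approx_one
    rw [mul_one] at e1 e2
    exact d e1 e2 (hT 0)
  have hAW : hsNorm (A₁ * W₁ - A₂ * W₂) ≤ 4 * η := by
    have e1 := hsNorm_conj_sub_le h₁.left_mem h₁.right_mem (h₁.approx j)
    have e2 := hsNorm_conj_sub_le h₂.left_mem h₂.right_mem (h₂.approx j)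
    have f1 : A₁ * W₁ = star U₁ * X₁' j * V₁ := by
      rw [hA₁, hW₁, mul_assoc, ← mul_assoc U₁, hU₁.2, one_mul]
    have f2 : A₂ * W₂ = star U₂ * X₂' j * V₂ := by
      rw [hA₂, hW₂, mul_assoc, ← mul_assoc U₂, hU₂.2, one_mul]
    rw [f1, f2]
    exact d e1 e2 (hT _)
  have hA : hsNorm (A₁ - A₂) ≤ 4 * η + r * (4 * η) := by
    -- Multiplication by the unitary `W₁` preserves the 2-norm and replaces `A₁ - A₂` by differences
    -- that are already estimated.
    rw [← hsNorm_mul_unitary hW₁u]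
    have e : (A₁ - A₂) * W₁ = (A₁ * W₁ - A₂ * W₂) + A₂ * (W₂ - W₁) := by noncomm_ring
    rw [e]
    refine (hs.add_le _ _).trans (add_le_add hAW ((hs.mul_left _ _).trans ?_))
    rw [hs.sub_comm] at hW
    exact mul_le_mul hA₂n hW (hs.nonneg _) hr
  have hX : hsNorm (X₁' j - X₂' j) ≤ 4 * η + r * (4 * η) + 2 * η * r + r * (2 * η) := by
    have f1 : X₁' j = U₁ * A₁ * star U₁ := by
      rw [hA₁]
      calc X₁' j = (U₁ * star U₁) * X₁' j * (U₁ * star U₁) := by rw [hU₁.2, one_mul, mul_one]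
        _ = _ := by noncomm_ring
    have f2 : X₂' j = U₂ * A₂ * star U₂ := by
      rw [hA₂]
      calc X₂' j = (U₂ * star U₂) * X₂' j * (U₂ * star U₂) := by rw [hU₂.2, one_mul, mul_one]
        _ = _ := by noncomm_ring
    have e : X₁' j - X₂' j = U₁ * (A₁ - A₂) * star U₁ + (U₁ - U₂) * A₂ * star U₁ +
        U₂ * (A₂ * star (U₁ - U₂)) := by
      rw [f1, f2, star_sub]
      noncomm_ring
    rw [e]
    refine (hs.add_le _ _).trans (add_le_add ((hs.add_le _ _).trans (add_le_add ?_ ?_)) ?_)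
    · rwa [hsNorm_mul_unitary (Unitary.star_mem h₁.left_mem), hsNorm_unitary_mul h₁.left_mem]
    · rw [hsNorm_mul_unitary (Unitary.star_mem h₁.left_mem)]
      exact (hs.le_norm _).trans ((norm_mul_le _ _).trans
        (mul_le_mul hU hA₂n (norm_nonneg _) (by positivity)))
    · rw [hsNorm_unitary_mul h₂.left_mem]
      refine (hs.le_norm _).trans ((norm_mul_le _ _).trans
        (mul_le_mul hA₂n ?_ (norm_nonneg _) hr))
      rwa [norm_star]
  have g1 := hs.sub_le (X₁ j) (X₁' j) (X₂ j)
  have g2 := hs.sub_le (X₁' j) (X₂' j) (X₂ j)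
  have g3 := h₁.near j
  have g4 := h₂.near j
  rw [hs.sub_comm] at g4
  linarith

/-- Each `X` is indexed by its two representatives, a net point near `L(Z)` and a net point near
`U`; equal indices force distance less than `δ`. The real dimension of `M_k(ℂ)^n` gives the exponent
`2nk²`. -/
theorem coveringNumber_le_of_factored {k : ℕ+} {p n : ℕ} {I J : Type*} (F₀ : Finset I)
    (F₁ : Finset J) (L : I → J → (Fin n → Mat k) →ₗ[ℂ] (Fin (p + 1) → Mat k)) {r η δ : ℝ}
    (hr : 0 ≤ r) (hη : 0 < η) (hδ : p * ((6 + 8 * r) * η) < δ) (Γ : Set (Fin p → Mat k))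
    (h : ∀ X ∈ Γ, ∃ a ∈ F₀, ∃ b ∈ F₁, ∃ Z U V X', IsFactored r η X (L a b Z) U V X') :
    ∃ M : ℕ, coveringNumber Γ δ ≤ (M : ℕ∞) ∧ (M : ℝ) ≤ F₀.card * F₁.card *
      (1 + 2 * ((p + 1) * (r + 1 + η)) / η) ^ (2 * (n * (k : ℕ) ^ 2)) *
      (1 + 2 * (Real.pi * Real.exp Real.pi) / η) ^ (k : ℕ) ^ 2 := by
  classical
  have hρ : 0 ≤ ((p : ℝ) + 1) * (r + 1 + η) := by positivity
  choose t ht1 ht2 using fun q : I × J => exists_range_net (L q.1 q.2) hρ hη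
  obtain ⟨u, hu1, hu2⟩ := exists_unitary_net k hη
  have hdim : Module.finrank ℂ (Fin n → Mat k) = n * (k : ℕ) ^ 2 := by
    rw [Module.finrank_pi_fintype]
    simp [Module.finrank_matrix, sq]
  rw [hdim] at ht1
  have key : ∀ X ∈ Γ, ∃ i : I × J × EuclideanSpace ℂ (Fin (p + 1) × Fin (k : ℕ) × Fin (k : ℕ)) ×
      Mat k, ∃ Z U V X', (i.1 ∈ F₀ ∧ i.2.1 ∈ F₁ ∧ i.2.2.1 ∈ t (i.1, i.2.1) ∧ i.2.2.2 ∈ u) ∧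
        IsFactored r η X (L i.1 i.2.1 Z) U V X' ∧
        ‖entries (L i.1 i.2.1 Z) - i.2.2.1‖ < √(k : ℕ) * η ∧ ‖U - i.2.2.2‖ < η := by
    intro X hX
    obtain ⟨a, ha, b, hb, Z, U, V, X', hf⟩ := h X hX
    obtain ⟨c, hc, hc'⟩ := ht2 (a, b) Z (hf.tnorm_le hr)
    obtain ⟨d, hd, hd'⟩ := hu2 U hf.left_mem
    exact ⟨(a, b, c, d), Z, U, V, X', ⟨ha, hb, hc, hd⟩, hf, hc', hd'⟩
  rcases Γ.eq_empty_or_nonempty with rfl | ⟨x₀, hx₀⟩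
  · refine ⟨0, ?_, by push_cast; positivity⟩
    exact (iInf₂_le ∅ (by simp)).trans (by simp)
  have i₀ := (key x₀ hx₀).choose
  let f : (Fin p → Mat k) → I × J × EuclideanSpace ℂ (Fin (p + 1) × Fin (k : ℕ) × Fin (k : ℕ)) ×
      Mat k := fun X => if hX : X ∈ Γ then (key X hX).choose else i₀
  have hf : ∀ X (hX : X ∈ Γ), f X = (key X hX).choose := fun X hX => dif_pos hX
  let s : Finset (I × J × EuclideanSpace ℂ (Fin (p + 1) × Fin (k : ℕ) × Fin (k : ℕ)) × Mat k) :=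
    (F₀ ×ˢ F₁).biUnion fun q => (t q ×ˢ u).image fun z => (q.1, q.2, z)
  refine ⟨s.card, minCover_le_of_index s f (fun X hX => ?_) (fun X hX Y hY hXY => ?_), ?_⟩
  · obtain ⟨Z, U, V, X', ⟨h1, h2, h3, h4⟩, -⟩ := (key X hX).choose_spec
    rw [← hf X hX] at h1 h2 h3 h4
    refine Finset.mem_biUnion.2 ⟨((f X).1, (f X).2.1), Finset.mk_mem_product h1 h2, ?_⟩
    exact Finset.mem_image.2 ⟨(f X).2.2, Finset.mk_mem_product h3 h4, rfl⟩
  · obtain ⟨Z, U, V, X', -, e1, e2, e3⟩ := (key X hX).choose_spec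
    obtain ⟨Z', U', V', Y', -, e1', e2', e3'⟩ := (key Y hY).choose_spec
    rw [← hf X hX] at e1 e2 e3
    rw [← hf Y hY, ← hXY] at e1' e2' e3'
    have hU : ‖U - U'‖ ≤ 2 * η := by
      have := norm_sub_le_norm_sub_add_norm_sub U (f X).2.2.2 U'
      rw [norm_sub_rev (f X).2.2.2 U'] at this
      linarith
    have hd := e1.hsNorm_sub_le hη.le e1'
      (fun j => (hsNorm_sub_lt_of_entries e2 e2' j).le) hU
    change tnorm (fun i => X i - Y i) < δ
    refine lt_of_le_of_lt ((tnorm_le_sum _).trans ?_) hδ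
    refine (Finset.sum_le_card_nsmul _ _ _ fun j _ => hd j).trans_eq ?_
    simp
  · have h1 : s.card ≤ ∑ q ∈ F₀ ×ˢ F₁, (t q).card * u.card := by
      refine Finset.card_biUnion_le.trans (Finset.sum_le_sum fun q _ => ?_)
      exact Finset.card_image_le.trans_eq (Finset.card_product _ _)
    have h2 : (s.card : ℝ) ≤ ∑ q ∈ F₀ ×ˢ F₁, ((t q).card : ℝ) * u.card := by exact_mod_cast h1
    refine h2.trans ((Finset.sum_le_card_nsmul _ _ _ fun q _ =>
      mul_le_mul (ht1 q) hu1 (Nat.cast_nonneg _) (by positivity)).trans_eq ?_)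
    rw [Finset.card_product, nsmul_eq_mul]
    push_cast
    ring

end Count

/-! ## Logarithms of covering numbers and limits along an ultrafilter -/

section Limits

theorem logCount_le {c : ℝ} {N : ℕ∞} {M : ℕ} (hN : N ≤ (M : ℕ∞)) (hM : (M : ℝ) ≤ Real.exp c) :
    logCount N ≤ (c : EReal) := by
  rw [← EReal.log_exp (c : EReal), EReal.exp_coe, logCount, ENNReal.log_le_log_iff]
  have h1 : (N : ℝ≥0∞) ≤ ((M : ℕ∞) : ℝ≥0∞) := ENat.toENNReal_le.2 hN
  refine h1.trans ?_
  rw [ENat.toENNReal_coe, ← ENNReal.ofReal_natCast]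
  exact ENNReal.ofReal_le_ofReal hM

theorem ne_top_of_logCount_lt {c : ℝ} {N : ℕ∞} (h : logCount N < (c : EReal)) : N ≠ ⊤ := by
  rintro rfl
  simp [logCount] at h

theorem le_exp_of_logCount_lt {c : ℝ} {M : ℕ} (h : logCount (M : ℕ∞) < (c : EReal)) :
    (M : ℝ) ≤ Real.exp c := by
  rw [← EReal.log_exp (c : EReal), EReal.exp_coe, logCount, ENNReal.log_lt_log_iff,
    ENat.toENNReal_coe, ← ENNReal.ofReal_natCast] at h
  exact (ENNReal.ofReal_lt_ofReal_iff (Real.exp_pos c)).1 h |>.le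

/-- By compactness of the extended reals every limit along `ω` exists, so `limUnder` never takes its
default value here. -/
theorem tendsto_limUnder_ultrafilter {α : Type*} (ω : Ultrafilter α) (f : α → EReal) :
    Tendsto f ω (𝓝 (limUnder (ω : Filter α) f)) :=
  tendsto_nhds_limUnder ⟨_, (ω.map f).le_nhds_lim⟩

theorem eventually_ge_of_le_cofinite {ω : Ultrafilter ℕ+} (hω : (ω : Filter ℕ+) ≤ cofinite)
    (K : ℕ+) : ∀ᶠ k in (ω : Filter ℕ+), K ≤ k := by
  refine hω ?_
  rw [mem_cofinite]
  refine (Set.finite_Iio K).subset fun k hk => ?_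
  simpa using hk

theorem eventually_logCount_lt {ω : Ultrafilter ℕ+} {A : Type*} [Ring A] [StarRing A]
    [Algebra ℂ A] {τ : A →ₗ[ℂ] ℂ} {n : ℕ} {x : Fin n → A} {R : ℝ} {ξ : ℕ+ → ℕ+} {δ C : ℝ}
    (h : embDimAt 1 ω τ x R ξ δ < (C : EReal)) :
    ∀ᶠ k : ℕ+ in (ω : Filter ℕ+),
      logCount (orbitCoveringNumber (projAt k (nbhdOf ω τ x R ξ)) δ) <
        ((C * ((k : ℕ) : ℝ) ^ 2 : ℝ) : EReal) := by
  filter_upwards [(tendsto_limUnder_ultrafilter ω _).eventually (gt_mem_nhds h)] with k hk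
  have hk0 : (0 : ℝ) < ((k : ℕ) : ℝ) ^ 2 := by
    have : (0 : ℝ) < ((k : ℕ) : ℝ) := by exact_mod_cast k.pos
    positivity
  have e : ((k : ℕ) : ℝ) ^ (2 * (1 : ℝ)) = ((k : ℕ) : ℝ) ^ 2 := by norm_num
  rw [e, EReal.div_lt_iff (by exact_mod_cast hk0) (EReal.coe_ne_top _), ← EReal.coe_mul] at hk
  exact hk

theorem delta0At_le {ω : Ultrafilter ℕ+} {A : Type*} [Ring A] [StarRing A] [Algebra ℂ A]
    {τ : A →ₗ[ℂ] ℂ} {n : ℕ} {x : Fin n → A} {R : ℝ} {ξ : ℕ+ → ℕ+} {δ C : ℝ} (hδ : 0 < δ)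
    (hδ1 : δ < 1)
    (h : ∀ᶠ k : ℕ+ in (ω : Filter ℕ+),
      logCount (coveringNumber (projAt k (nbhdOf ω τ x R ξ)) δ) ≤
        ((((k : ℕ) : ℝ) ^ 2 * C : ℝ) : EReal)) :
    delta0At ω τ x R ξ δ ≤ ((C / (-Real.log δ) : ℝ) : EReal) := by
  refine le_of_tendsto (tendsto_limUnder_ultrafilter ω _) ?_
  filter_upwards [h] with k hk
  have hlog : Real.log δ < 0 := Real.log_neg hδ hδ1
  have hk0 : (0 : ℝ) < ((k : ℕ) : ℝ) ^ 2 := by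
    have : (0 : ℝ) < ((k : ℕ) : ℝ) := by exact_mod_cast k.pos
    positivity
  have hpos : 0 < -(((k : ℕ) : ℝ) ^ 2 * Real.log δ) := by nlinarith
  refine (EReal.div_le_div_right_of_nonneg (by exact_mod_cast hpos.le) hk).trans_eq ?_
  rw [← EReal.coe_div]
  congr 1
  rw [← mul_neg, mul_div_mul_left _ _ hk0.ne']

end Limits

/-! ### Neighbourhoods expressed by moments -/

section Neighbourhoods

theorem wordVal_algHom {ι A B : Type*} [Ring A] [StarRing A] [Algebra ℂ A] [Ring B] [StarRing B]
    [Algebra ℂ B] (φ : A →⋆ₐ[ℂ] B) (y : ι → A) (w : List (ι × Bool)) :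
    wordVal (fun i => φ (y i)) w = φ (wordVal y w) := by
  rw [← StarPoly.ev_word, ← StarPoly.ev_word, StarPoly.ev_comp]

open scoped Matrix.Norms.L2Operator

/-- Embeddings preserve the trace, so all of them prescribe the same moments; they matter only
through the existence of one. -/
theorem mem_nbhdOf_iff {ω : Ultrafilter ℕ+} {A : Type*} [Ring A] [StarRing A] [Algebra ℂ A]
    {τ : A →ₗ[ℂ] ℂ} (hτ : (Embeddings ω τ).Nonempty) {n : ℕ} {x : Fin n → A} {R : ℝ}
    {ξ : ℕ+ → ℕ+} {Y : Fin n → ∀ k : ℕ+, Mat k} :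
    Y ∈ nbhdOf ω τ x R ξ ↔ (∀ i k, ‖Y i k‖ < R) ∧
      ∀ m k : ℕ+, ξ m ≤ k → IsMicrostate τ x m fun i => Y i k := by
  have key : ∀ θ ∈ Embeddings ω τ, ∀ w, ultraTrace ω (wordEval (fun i => θ (x i)) w) =
      τ (wordVal x w) := fun θ hθ w => by
    rw [wordEval_eq_wordVal, wordVal_algHom, hθ.2]
  rw [nbhdOf, Set.mem_iUnion₂]
  constructor
  · rintro ⟨θ, hθ, h1, h2⟩
    refine ⟨h1, fun m k hk w hw1 hw2 => ?_⟩
    rw [← key θ hθ w]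
    exact h2 m k hk w hw1 hw2
  · rintro ⟨h1, h2⟩
    obtain ⟨θ, hθ⟩ := hτ
    refine ⟨θ, hθ, h1, fun m k hk w hw1 hw2 => ?_⟩
    rw [key θ hθ w]
    exact h2 m k hk w hw1 hw2

theorem nonempty_embeddings_restrict {H : Type*} [NormedAddCommGroup H] [InnerProductSpace ℂ H]
    [CompleteSpace H] {N N₀ : VonNeumannAlgebra H} {τ : FaithfulNormalTrace N} {ω : Ultrafilter ℕ+}
    (h : (Embeddings ω τ.toLin).Nonempty) (h₀ : N₀ ≤ N) :
    (Embeddings ω (τ.restrict h₀).toLin).Nonempty := by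
  obtain ⟨θ, h1, h2⟩ := h
  refine ⟨θ.comp (incl h₀), h1.comp fun a b hab => ?_, fun a => h2 (incl h₀ a)⟩
  exact Subtype.ext (congrArg (fun z : N.toStarSubalgebra => (z : H →L[ℂ] H)) hab)

end Neighbourhoods

/-! ### The linear maps that come from bimodule sums -/

section Bimodule

variable {A : Type*} [Ring A] [StarRing A] [Algebra ℂ A] {κ κ' : Type*} {n : ℕ}

theorem bimodEval_add (a : κ → A) (b : κ' → A) (z z' : Fin n → A)
    (l : List (StarPoly κ × Fin n × StarPoly κ')) :
    bimodEval a b (z + z') l = bimodEval a b z l + bimodEval a b z' l := by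
  induction l with
  | nil => simp [bimodEval]
  | cons t l ih =>
    simp only [bimodEval, List.map_cons, List.sum_cons, Pi.add_apply] at ih ⊢
    rw [ih]
    noncomm_ring

theorem bimodEval_smul (a : κ → A) (b : κ' → A) (c : ℂ) (z : Fin n → A)
    (l : List (StarPoly κ × Fin n × StarPoly κ')) :
    bimodEval a b (c • z) l = c • bimodEval a b z l := by
  induction l with
  | nil => simp [bimodEval]
  | cons t l ih =>
    simp only [bimodEval, List.map_cons, List.sum_cons, Pi.smul_apply] at ih ⊢
    rw [ih, smul_add, mul_smul_comm, smul_mul_assoc]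

/-- The linear map `z ↦ ∑ p(a) z_i q(b)` given by a family of lists of triples `(p, i, q)`. -/
def bimodMap {m : ℕ} (l : Fin m → List (StarPoly κ × Fin n × StarPoly κ')) (a : κ → A)
    (b : κ' → A) : (Fin n → A) →ₗ[ℂ] (Fin m → A) where
  toFun z j := bimodEval a b z (l j)
  map_add' z z' := funext fun j => bimodEval_add a b z z' (l j)
  map_smul' c z := funext fun j => bimodEval_smul a b c z (l j)

/-- Conjugating the coefficients is absorbed into the middle factors, so the linear map itself
depends only on the representatives `a` and `b`. -/
theorem bimodEval_conj {u v : A} (hu : u ∈ unitary A) (hv : v ∈ unitary A) (a : κ → A)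
    (b : κ' → A) (z : Fin n → A) (l : List (StarPoly κ × Fin n × StarPoly κ')) :
    bimodEval (fun i => u * a i * star u) (fun i => v * b i * star v) z l =
      u * bimodEval a b (fun i => star u * z i * v) l * star v := by
  induction l with
  | nil => simp [bimodEval]
  | cons t l ih =>
    simp only [bimodEval, List.map_cons, List.sum_cons] at ih ⊢
    rw [ih, StarPoly.ev_conj u hu, StarPoly.ev_conj v hv]
    noncomm_ring

namespace StarPoly

/-- Renaming of the variables. -/
def rename {ι : Type*} (f : κ → ι) : StarPoly κ →ₐ[ℂ] StarPoly ι :=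
  subst fun i => var (f i, false)

theorem ev_rename [StarModule ℂ A] {ι : Type*} (f : κ → ι) (y : ι → A) (P : StarPoly κ) :
    ev y (rename f P) = ev (fun i => y (f i)) P := by
  rw [rename, ev_subst]
  simp [letter]

end StarPoly

/-- The *-polynomial `∑ p(a) Q_i(x) q(b)` in all variables. -/
def bimodPoly {ι ν : Type*} (f : κ → ι) (g : κ' → ι) (h : ν → ι) (Q : Fin n → StarPoly ν)
    (l : List (StarPoly κ × Fin n × StarPoly κ')) : StarPoly ι :=
  (l.map fun t => StarPoly.rename f t.1 * StarPoly.rename h (Q t.2.1) *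
    StarPoly.rename g t.2.2).sum

theorem ev_bimodPoly [StarModule ℂ A] {ι ν : Type*} (f : κ → ι) (g : κ' → ι) (h : ν → ι)
    (Q : Fin n → StarPoly ν) (l : List (StarPoly κ × Fin n × StarPoly κ')) (y : ι → A) :
    StarPoly.ev y (bimodPoly f g h Q l) =
      bimodEval (fun i => y (f i)) (fun i => y (g i))
        (fun i => StarPoly.ev (fun j => y (h j)) (Q i)) l := by
  induction l with
  | nil => simp [bimodPoly, bimodEval]
  | cons t l ih =>
    simp only [bimodPoly, bimodEval, List.map_cons, List.sum_cons] at ih ⊢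
    simp only [map_add, map_mul, ih, StarPoly.ev_rename]

end Bimodule

section

/-! ## The estimate of the free entropy dimension -/

open scoped Matrix.Norms.L2Operator

variable {H : Type*} [NormedAddCommGroup H] [InnerProductSpace ℂ H] [CompleteSpace H]
  {N : VonNeumannAlgebra H}

/-- Microstates of `x` extend to joint microstates of `(x, x', y₀, y₁)`, `x' = x`, from which a
factorization of `x` up to `η` can be read off. -/
theorem exists_factored (τ : FaithfulNormalTrace N) {N₀ N₁ : VonNeumannAlgebra H} (h₀ : N₀ ≤ N)
    (h₁ : N₁ ≤ N) {p q₀ q₁ n : ℕ} {x : Fin p → N.toStarSubalgebra} (hx : PolyDense τ x)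
    {y₀ : Fin q₀ → N₀.toStarSubalgebra} {y₁ : Fin q₁ → N₁.toStarSubalgebra}
    (hy₀ : Generates N₀ y₀) (hy₁ : Generates N₁ y₁) {ζ : Fin n → L2 τ}
    (hζ : closedBimodSpan τ h₀ h₁ ζ = ⊤) {r R η : ℝ} (hη : 0 < η) :
    ∃ (l : Fin (p + 1) → List (StarPoly (Fin q₀) × Fin n × StarPoly (Fin q₁))) (m : ℕ+) (ε : ℝ),
      0 < ε ∧ ∀ (k : ℕ+) (X X' : Fin p → Mat k) (Y₀ : Fin q₀ → Mat k) (Y₁ : Fin q₁ → Mat k)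
        (B₀ : Fin q₀ → Mat k) (B₁ : Fin q₁ → Mat k) (U V : Mat k),
        IsMicrostate τ.toLin (Sum.elim x (Sum.elim x (Sum.elim (fun i => incl h₀ (y₀ i))
          fun i => incl h₁ (y₁ i)))) m (Sum.elim X (Sum.elim X' (Sum.elim Y₀ Y₁))) →
        (∀ i, ‖X i‖ ≤ R) → (∀ i, ‖X' i‖ ≤ r) → (∀ i, ‖Y₀ i‖ ≤ r) → (∀ i, ‖Y₁ i‖ ≤ r) →
        (∀ i, ‖B₀ i‖ ≤ r) → (∀ i, ‖B₁ i‖ ≤ r) → U ∈ unitary (Mat k) → V ∈ unitary (Mat k) →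
        (∀ i, hsNorm (Y₀ i - U * B₀ i * star U) ≤ ε) →
        (∀ i, hsNorm (Y₁ i - V * B₁ i * star V) ≤ ε) →
        ∃ Z, IsFactored r η X (bimodMap l B₀ B₁ Z) U V X' := by
  have := τ.normOneClass
  have hτs := τ.isTraceSeminorm
  -- The unit is approximated along with the `x_j`: its equation is the one that later eliminates
  -- `V`.
  obtain ⟨Q, l, hl⟩ := exists_bimodule_approx τ hx h₀ h₁ hy₀ hy₁ hζ
    (Fin.cons 1 x : Fin (p + 1) → N.toStarSubalgebra) (half_pos hη)
  let iX : Fin p → Fin p ⊕ (Fin p ⊕ (Fin q₀ ⊕ Fin q₁)) := Sum.inl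
  let iX' : Fin p → Fin p ⊕ (Fin p ⊕ (Fin q₀ ⊕ Fin q₁)) := fun i => Sum.inr (Sum.inl i)
  let iY₀ : Fin q₀ → Fin p ⊕ (Fin p ⊕ (Fin q₀ ⊕ Fin q₁)) := fun i => Sum.inr (Sum.inr (Sum.inl i))
  let iY₁ : Fin q₁ → Fin p ⊕ (Fin p ⊕ (Fin q₀ ⊕ Fin q₁)) := fun i => Sum.inr (Sum.inr (Sum.inr i))
  let T : Fin (p + 1) → StarPoly (Fin p ⊕ (Fin p ⊕ (Fin q₀ ⊕ Fin q₁))) :=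
    Fin.cons 1 fun j => StarPoly.var (iX' j, false)
  let G : Fin (p + 1) → StarPoly (Fin p ⊕ (Fin p ⊕ (Fin q₀ ⊕ Fin q₁))) :=
    fun j => T j - bimodPoly iY₀ iY₁ iX Q (l j)
  let D : Fin p → StarPoly (Fin p ⊕ (Fin p ⊕ (Fin q₀ ⊕ Fin q₁))) :=
    fun j => StarPoly.var (iX j, false) - StarPoly.var (iX' j, false)
  set w : Fin p ⊕ (Fin p ⊕ (Fin q₀ ⊕ Fin q₁)) → N.toStarSubalgebra :=
    Sum.elim x (Sum.elim x (Sum.elim (fun i => incl h₀ (y₀ i)) fun i => incl h₁ (y₁ i))) with hw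
  have hD : ∀ j, ∃ m : ℕ+, ∀ (k : ℕ+) (W : Fin p ⊕ (Fin p ⊕ (Fin q₀ ⊕ Fin q₁)) → Mat k),
      IsMicrostate τ.toLin w m W → hsNorm (StarPoly.ev W (D j)) < η := fun j => by
    refine exists_order_hsNorm_ev τ.map_one w (D j) hη ?_
    rw [← τ.norm2_sq]
    have e : StarPoly.ev w (D j) = 0 := by simp [D, letter, iX, iX', hw]
    rw [e, hτs.map_zero]
    exact pow_lt_pow_left₀ hη le_rfl two_ne_zero
  have hG : ∀ j, ∃ m : ℕ+, ∀ (k : ℕ+) (W : Fin p ⊕ (Fin p ⊕ (Fin q₀ ⊕ Fin q₁)) → Mat k),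
      IsMicrostate τ.toLin w m W → hsNorm (StarPoly.ev W (G j)) < η / 2 := fun j => by
    refine exists_order_hsNorm_ev τ.map_one w (G j) (half_pos hη) ?_
    rw [← τ.norm2_sq]
    refine pow_lt_pow_left₀ ?_ (hτs.nonneg _) two_ne_zero
    have e1 : StarPoly.ev w (T j) = (Fin.cons 1 x : Fin (p + 1) → N.toStarSubalgebra) j := by
      refine Fin.cases ?_ (fun j => ?_) j
      · simp [T]
      · simp [T, letter, iX', hw]
    rw [map_sub, e1, ev_bimodPoly]
    exact hl j
  choose mD hmD using hD
  choose mG hmG using hG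
  obtain ⟨m₁, hm₁⟩ := exists_forall_le_of_finite mD
  obtain ⟨m₂, hm₂⟩ := exists_forall_le_of_finite mG
  -- This constant depends on `R`, which is allowed, because it only affects `ε`, the mesh of the
  -- orbit nets.
  choose Lip hLip0 hLip using fun j => StarPoly.ev_lipschitz (G j) (max R r)
  obtain ⟨K, hK⟩ := exists_forall_le_of_finite Lip
  refine ⟨l, max m₁ m₂, η / 2 / (|K| + 1), by positivity, ?_⟩
  intro k X X' Y₀ Y₁ B₀ B₁ U V hW hX hX' hY₀ hY₁ hB₀ hB₁ hU hV hY₀B hY₁B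
  have hs := isTraceSeminorm_hsNorm k
  set ε := η / 2 / (|K| + 1) with hε
  have hε0 : 0 < ε := by positivity
  let W := Sum.elim X (Sum.elim X' (Sum.elim Y₀ Y₁))
  let W' := Sum.elim X (Sum.elim X' (Sum.elim (fun i => U * B₀ i * star U)
    fun i => V * B₁ i * star V))
  have hconj : ∀ {S u : Mat k}, u ∈ unitary (Mat k) → ‖S‖ ≤ r → ‖u * S * star u‖ ≤ r := by
    intro S u hu hS
    have e1 := norm_mul_le (u * S) (star u)
    have e2 := norm_mul_le u S
    rw [norm_unitary hu, one_mul] at e2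
    rw [norm_star, norm_unitary hu, mul_one] at e1
    linarith
  have hGW' : ∀ j, hsNorm (StarPoly.ev W' (G j)) ≤ η := by
    intro j
    have e1 := hmG j k W (hW.mono ((hm₂ j).trans (le_max_right _ _)))
    have e2 : hsNorm (StarPoly.ev W (G j) - StarPoly.ev W' (G j)) ≤ Lip j * ε := by
      refine hLip j (Mat k) hsNorm hs W W' ?_ ?_ ε ?_
      · rintro (i | i | i | i)
        · exact (hX i).trans (le_max_left _ _)
        · exact (hX' i).trans (le_max_right _ _)
        · exact (hY₀ i).trans (le_max_right _ _)
        · exact (hY₁ i).trans (le_max_right _ _)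
      · rintro (i | i | i | i)
        · exact (hX i).trans (le_max_left _ _)
        · exact (hX' i).trans (le_max_right _ _)
        · exact (hconj hU (hB₀ i)).trans (le_max_right _ _)
        · exact (hconj hV (hB₁ i)).trans (le_max_right _ _)
      · rintro (i | i | i | i)
        · simp [W, W', hs.map_zero, hε0.le]
        · simp [W, W', hs.map_zero, hε0.le]
        · exact hY₀B i
        · exact hY₁B i
    have e3 : Lip j * ε ≤ η / 2 := by
      have : Lip j ≤ |K| + 1 := ((hK j).trans (le_abs_self _)).trans (by linarith)
      calc Lip j * ε ≤ (|K| + 1) * ε := by gcongr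
        _ = η / 2 := by rw [hε]; field_simp
    have e4 := hs.le_add_sub (StarPoly.ev W' (G j)) (StarPoly.ev W (G j))
    rw [hs.sub_comm] at e4
    linarith
  have hval : ∀ j, StarPoly.ev W' (G j) = StarPoly.ev W' (T j) -
      U * bimodMap l B₀ B₁ (fun i => star U * StarPoly.ev X (Q i) * V) j * star V := by
    intro j
    simp only [G, map_sub, ev_bimodPoly]
    congr 1
    exact bimodEval_conj hU hV B₀ B₁ (fun i => StarPoly.ev X (Q i)) (l j)
  refine ⟨fun i => star U * StarPoly.ev X (Q i) * V, hU, hV, hX', fun j => ?_, fun j => ?_, ?_⟩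
  · have e1 := hmD j k W (hW.mono ((hm₁ j).trans (le_max_left _ _)))
    have e2 : StarPoly.ev W (D j) = X j - X' j := by simp [D, letter, iX, iX', W]
    rw [e2] at e1
    exact e1.le
  · have e1 := hGW' j.succ
    have e2 : StarPoly.ev W' (T j.succ) = X' j := by simp [T, letter, iX', W']
    rwa [hval, e2] at e1
  · have e1 := hGW' 0
    have e2 : StarPoly.ev W' (T 0) = 1 := by simp [T]
    rwa [hval, e2] at e1

/-- A bound on the orbit covering numbers that is uniform in the radius and the neighbourhood. -/
def OrbitBound (ω : Ultrafilter ℕ+) {A : Type*} [Ring A] [StarRing A] [Algebra ℂ A]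
    (τ : A →ₗ[ℂ] ℂ) {n : ℕ} (x : Fin n → A) (C : ℝ) : Prop :=
  ∃ u : ℝ, 0 < u ∧ ∀ δ ∈ Set.Ioo 0 u, ∀ R : ℝ, 0 < R → ∀ ξ ∈ Radii,
    embDimAt 1 ω τ x R ξ δ < (C : EReal)

/-- Any real number above the finite limsup works; the supremum over radii and neighbourhoods stands
inside the limsup, whence the uniformity. -/
theorem exists_orbitBound {ω : Ultrafilter ℕ+} {A : Type*} [Ring A] [StarRing A] [Algebra ℂ A]
    {τ : A →ₗ[ℂ] ℂ} {n : ℕ} {x : Fin n → A} (h : embDim 1 ω τ x < ⊤) :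
    ∃ C : ℝ, OrbitBound ω τ x C := by
  obtain ⟨C, hC, -⟩ := EReal.lt_iff_exists_real_btwn.1 h
  have h1 := eventually_lt_of_limsup_lt hC
  obtain ⟨u, hu, hsub⟩ := mem_nhdsGT_iff_exists_Ioo_subset.1 h1
  refine ⟨C, u, hu, fun δ hδ R hR ξ hξ => lt_of_le_of_lt ?_ (hsub hδ)⟩
  exact le_iSup₂_of_le R hR (le_iSup₂_of_le ξ hξ le_rfl)

/-- The order of the choices carries the argument: `r`, and with it `c`, come before `δ`, `R` and
`ξ`, whereas the polynomials and the mesh `δ'` of the orbit nets come after them. -/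
theorem exists_delta0At_le {ω : Ultrafilter ℕ+} (hω : (ω : Filter ℕ+) ≤ cofinite)
    (τ : FaithfulNormalTrace N) (hemb : (Embeddings ω τ.toLin).Nonempty)
    {N₀ N₁ : VonNeumannAlgebra H} (h₀ : N₀ ≤ N)
    (h₁ : N₁ ≤ N) {p q₀ q₁ n : ℕ} {x : Fin p → N.toStarSubalgebra} (hx : PolyDense τ x)
    {y₀ : Fin q₀ → N₀.toStarSubalgebra} {y₁ : Fin q₁ → N₁.toStarSubalgebra}
    (hy₀ : Generates N₀ y₀) (hy₁ : Generates N₁ y₁) {ζ : Fin n → L2 τ}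
    (hζ : closedBimodSpan τ h₀ h₁ ζ = ⊤) {C₀ C₁ : ℝ}
    (hC₀ : OrbitBound ω (τ.restrict h₀).toLin y₀ C₀)
    (hC₁ : OrbitBound ω (τ.restrict h₁).toLin y₁ C₁) :
    ∃ c : ℝ, ∀ δ ∈ Set.Ioo (0 : ℝ) 1, ∀ R ξ, delta0At ω τ.toLin x R ξ δ ≤
      (((C₀ + C₁ + (2 * n + 1) * (c - Real.log δ)) / (-Real.log δ) : ℝ) : EReal) := by
  obtain ⟨u₀, hu₀, hC₀⟩ := hC₀
  obtain ⟨u₁, hu₁, hC₁⟩ := hC₁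
  obtain ⟨r, hr, hΦ⟩ := exists_joint_microstates τ hx
    (Sum.elim x (Sum.elim (fun i => incl h₀ (y₀ i)) fun i => incl h₁ (y₁ i)))
  -- Summing the `p` coordinate errors `(6 + 8r)η` with `η = δ/c₀` stays below `δ`; the `1` makes
  -- the inequality strict.
  let c₀ : ℝ := p * (6 + 8 * r) + 1
  have hc₀ : 1 ≤ c₀ := by
    have : 0 ≤ p * (6 + 8 * r) := by positivity
    linarith
  -- Chosen so that, for `η ≤ 1`, the bases of both net cardinalities are at most `c₁/δ`.
  let c₁ : ℝ := (1 + 2 * ((p + 1) * (r + 2)) + 2 * (Real.pi * Real.exp Real.pi)) * c₀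
  have hc₁ : 0 < c₁ := by positivity
  refine ⟨Real.log c₁, fun δ hδ R ξ => ?_⟩
  obtain ⟨hδ0, hδ1⟩ := hδ
  let η : ℝ := δ / c₀
  have hη : 0 < η := by positivity
  have hη1 : η ≤ 1 := (div_le_self hδ0.le hc₀).trans hδ1.le
  obtain ⟨l, m, ε, hε, hfac⟩ := exists_factored τ h₀ h₁ hx hy₀ hy₁ hζ (r := r) (R := R) hη
  obtain ⟨ξ', hξ', Φ, hΦ1, hΦ2⟩ := hΦ R ξ
  let δ' : ℝ := min ε (min (u₀ / 2) (u₁ / 2))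
  have hδ'0 : 0 < δ' := by positivity
  have hδ'ε : δ' ≤ ε := min_le_left _ _
  have hδ'u₀ : δ' < u₀ := by
    have : δ' ≤ u₀ / 2 := (min_le_right _ _).trans (min_le_left _ _)
    linarith
  have hδ'u₁ : δ' < u₁ := by
    have : δ' ≤ u₁ / 2 := (min_le_right _ _).trans (min_le_right _ _)
    linarith
  refine delta0At_le hδ0 hδ1 ?_
  filter_upwards [eventually_ge_of_le_cofinite hω (ξ' m),
    eventually_logCount_lt (hC₀ δ' ⟨hδ'0, hδ'u₀⟩ r hr ξ' hξ'),
    eventually_logCount_lt (hC₁ δ' ⟨hδ'0, hδ'u₁⟩ r hr ξ' hξ')] with k hk hk₀ hk₁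
  obtain ⟨F₀, hF₀, hF₀c, hF₀n⟩ := exists_cover_of_minCover_ne_top (ne_top_of_logCount_lt hk₀)
  obtain ⟨F₁, hF₁, hF₁c, hF₁n⟩ := exists_cover_of_minCover_ne_top (ne_top_of_logCount_lt hk₁)
  have hcard₀ : (F₀.card : ℝ) ≤ Real.exp (C₀ * ((k : ℕ) : ℝ) ^ 2) :=
    le_exp_of_logCount_lt (by rw [hF₀n]; exact hk₀)
  have hcard₁ : (F₁.card : ℝ) ≤ Real.exp (C₁ * ((k : ℕ) : ℝ) ^ 2) :=
    le_exp_of_logCount_lt (by rw [hF₁n]; exact hk₁)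
  have hmem₀ : ∀ B ∈ F₀, ∀ i, ‖B i‖ ≤ r := by
    intro B hB i
    obtain ⟨Y, hY, rfl⟩ := hF₀ hB
    exact (((mem_nbhdOf_iff (nonempty_embeddings_restrict hemb h₀)).1 hY).1 i k).le
  have hmem₁ : ∀ B ∈ F₁, ∀ i, ‖B i‖ ≤ r := by
    intro B hB i
    obtain ⟨Y, hY, rfl⟩ := hF₁ hB
    exact (((mem_nbhdOf_iff (nonempty_embeddings_restrict hemb h₁)).1 hY).1 i k).le
  have hδη : p * ((6 + 8 * r) * η) < δ := by
    have e : p * ((6 + 8 * r) * η) = (p * (6 + 8 * r)) * δ / c₀ := by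
      simp only [η]; ring
    rw [e, div_lt_iff₀ (by positivity)]
    simp only [c₀]
    nlinarith
  have hcov : ∀ X ∈ projAt k (nbhdOf ω τ.toLin x R ξ), ∃ a ∈ F₀, ∃ b ∈ F₁, ∃ Z U V X',
      IsFactored r η X (bimodMap l a b Z) U V X' := by
    rintro _ ⟨X, hX, rfl⟩
    obtain ⟨hX1, hX2⟩ := (mem_nbhdOf_iff hemb).1 hX
    have hnorm : ∀ j i, ‖Φ j (fun i => X i j) i‖ < r := fun j =>
      hΦ1 j (fun i => X i j) fun i => hX1 i j
    have hmicro : ∀ m j, ξ' m ≤ j → IsMicrostate τ.toLin _ m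
        (Sum.elim (fun i => X i j) (Φ j fun i => X i j)) := fun m j hj =>
      hΦ2 j (fun i => X i j) (fun m' hm' => hX2 m' j hm') m hj
    -- Membership in the projected neighbourhood requires a full sequence, so the extension is made
    -- at every size and not only at `k`.
    have hY₀ : (fun i j => Φ j (fun i => X i j) (Sum.inr (Sum.inl i))) ∈
        nbhdOf ω (τ.restrict h₀).toLin y₀ r ξ' := by
      refine (mem_nbhdOf_iff (nonempty_embeddings_restrict hemb h₀)).2
        ⟨fun i j => hnorm j _, fun m j hj => ?_⟩
      intro v hv1 hv2
      have h := (hmicro m j hj).comp (fun i : Fin q₀ => Sum.inr (Sum.inr (Sum.inl i))) v hv1 hv2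
      have e : wordVal (fun i => incl h₀ (y₀ i)) v = incl h₀ (wordVal y₀ v) :=
        wordVal_algHom (incl h₀) y₀ v
      change ‖_ - τ.toLin (wordVal (fun i => incl h₀ (y₀ i)) v)‖ < _ at h
      rw [e] at h
      exact h
    have hY₁ : (fun i j => Φ j (fun i => X i j) (Sum.inr (Sum.inr i))) ∈
        nbhdOf ω (τ.restrict h₁).toLin y₁ r ξ' := by
      refine (mem_nbhdOf_iff (nonempty_embeddings_restrict hemb h₁)).2
        ⟨fun i j => hnorm j _, fun m j hj => ?_⟩
      intro v hv1 hv2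
      have h := (hmicro m j hj).comp (fun i : Fin q₁ => Sum.inr (Sum.inr (Sum.inr i))) v hv1 hv2
      have e : wordVal (fun i => incl h₁ (y₁ i)) v = incl h₁ (wordVal y₁ v) :=
        wordVal_algHom (incl h₁) y₁ v
      change ‖_ - τ.toLin (wordVal (fun i => incl h₁ (y₁ i)) v)‖ < _ at h
      rw [e] at h
      exact h
    obtain ⟨a, ha, U, hU, hUa⟩ := Set.mem_iUnion₂.1 (hF₀c ⟨_, hY₀, rfl⟩)
    obtain ⟨b, hb, V, hV, hVb⟩ := Set.mem_iUnion₂.1 (hF₁c ⟨_, hY₁, rfl⟩)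
    have hsplit : Φ k (fun i => X i k) = Sum.elim (fun i => Φ k (fun i => X i k) (Sum.inl i))
        (Sum.elim (fun i => Φ k (fun i => X i k) (Sum.inr (Sum.inl i)))
          fun i => Φ k (fun i => X i k) (Sum.inr (Sum.inr i))) := by
      funext i
      rcases i with i | i | i <;> rfl
    have hm := hmicro m k hk
    rw [hsplit] at hm
    obtain ⟨Z, hZ⟩ := hfac k _ _ _ _ a b U V hm (fun i => (hX1 i k).le) (fun i => (hnorm k _).le)
      (fun i => (hnorm k _).le) (fun i => (hnorm k _).le) (hmem₀ a ha) (hmem₁ b hb) hU hV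
      (fun i => ((hsNorm_le_tnorm _ i).trans hUa.le).trans hδ'ε)
      (fun i => ((hsNorm_le_tnorm _ i).trans hVb.le).trans hδ'ε)
    exact ⟨a, ha, b, hb, Z, U, V, _, hZ⟩
  obtain ⟨M, hM1, hM2⟩ := coveringNumber_le_of_factored F₀ F₁ (bimodMap l) hr.le hη hδη _ hcov
  refine logCount_le hM1 (hM2.trans ?_)
  have hcδ : 0 < c₁ / δ := by positivity
  have hpi : 0 ≤ Real.pi * Real.exp Real.pi := by positivity
  have g1 : 1 + 2 * ((p + 1) * (r + 1 + η)) / η ≤ c₁ / δ := by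
    have e : c₁ / δ = (1 + 2 * ((p + 1) * (r + 2)) + 2 * (Real.pi * Real.exp Real.pi)) / η := by
      simp only [c₁, η]; field_simp
    rw [e, ← sub_nonneg]
    have e2 : (1 + 2 * ((p + 1) * (r + 2)) + 2 * (Real.pi * Real.exp Real.pi)) / η -
        (1 + 2 * ((p + 1) * (r + 1 + η)) / η) =
        ((1 - η) + 2 * ((p + 1) * (1 - η)) + 2 * (Real.pi * Real.exp Real.pi)) / η := by
      field_simp; ring
    rw [e2]
    have : 0 ≤ 1 - η := by linarith
    positivity
  have g2 : 1 + 2 * (Real.pi * Real.exp Real.pi) / η ≤ c₁ / δ := by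
    have e : c₁ / δ = (1 + 2 * ((p + 1) * (r + 2)) + 2 * (Real.pi * Real.exp Real.pi)) / η := by
      simp only [c₁, η]; field_simp
    rw [e, ← sub_nonneg]
    have e2 : (1 + 2 * ((p + 1) * (r + 2)) + 2 * (Real.pi * Real.exp Real.pi)) / η -
        (1 + 2 * (Real.pi * Real.exp Real.pi) / η) =
        ((1 - η) + 2 * ((p + 1) * (r + 2))) / η := by
      field_simp; ring
    rw [e2]
    have : 0 ≤ 1 - η := by linarith
    positivity
  have hexp : Real.exp (((k : ℕ) : ℝ) ^ 2 * (C₀ + C₁ + (2 * n + 1) * (Real.log c₁ - Real.log δ))) =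
      Real.exp (C₀ * ((k : ℕ) : ℝ) ^ 2) * Real.exp (C₁ * ((k : ℕ) : ℝ) ^ 2) *
        (c₁ / δ) ^ (2 * (n * (k : ℕ) ^ 2)) * (c₁ / δ) ^ (k : ℕ) ^ 2 := by
    rw [mul_assoc _ ((c₁ / δ) ^ _), ← pow_add, ← Real.log_div hc₁.ne' hδ0.ne', ← Real.exp_add]
    conv_rhs => rw [← Real.exp_log hcδ]
    rw [← Real.exp_nat_mul, ← Real.exp_add]
    congr 1
    push_cast
    ring
  rw [hexp]
  gcongr

theorem tendsto_dimension_bound (a b c : ℝ) :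
    Tendsto (fun δ : ℝ => (a + b * (c - Real.log δ)) / (-Real.log δ)) (𝓝[>] 0) (𝓝 b) := by
  have h1 : Tendsto (fun δ : ℝ => -Real.log δ) (𝓝[>] 0) atTop :=
    tendsto_neg_atBot_atTop.comp Real.tendsto_log_nhdsGT_zero
  have h2 : Tendsto (fun δ : ℝ => (a + b * c) / (-Real.log δ) + b) (𝓝[>] 0) (𝓝 (0 + b)) :=
    (h1.const_div_atTop _).add_const b
  rw [zero_add] at h2
  refine h2.congr' ?_
  filter_upwards [h1.eventually (eventually_gt_atTop 0)] with δ hδ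
  rw [div_add' _ _ _ hδ.ne']
  congr 1
  ring

end

end

end EmbDim

theorem theorem11 {H : Type*} [NormedAddCommGroup H] [InnerProductSpace ℂ H] [CompleteSpace H]
    (ω : Ultrafilter ℕ+) (hω : (ω : Filter ℕ+) ≤ Filter.cofinite)
    (N : VonNeumannAlgebra H) (hN : EmbDim.IsIIOneFactor N) (hfg : EmbDim.FinitelyGenerated N)
    (τ : EmbDim.FaithfulNormalTrace N) (hemb : (EmbDim.Embeddings ω τ.toLin).Nonempty)
    (N₀ N₁ : VonNeumannAlgebra H) (h₀ : N₀ ≤ N) (h₁ : N₁ ≤ N)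
    (hfin₀ : EmbDim.algEmbDim 1 ω N₀ (τ.restrict h₀) < ⊤)
    (hfin₁ : EmbDim.algEmbDim 1 ω N₁ (τ.restrict h₁) < ⊤)
    (n : ℕ) (ξ : Fin n → EmbDim.L2 τ) (hspan : EmbDim.closedBimodSpan τ h₀ h₁ ξ = ⊤) :
    ∀ (p : ℕ) (x : Fin p → N.toStarSubalgebra), EmbDim.Generates N x →
      EmbDim.delta0 ω τ.toLin x ≤ 1 + 2 * (n : EReal) := by
  intro p x hx
  -- A finite infimum provides generating families with finite `ℋ₁`; independence of the family is
  -- not needed.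
  simp only [EmbDim.algEmbDim, iInf_lt_iff] at hfin₀ hfin₁
  obtain ⟨q₀, y₀, hy₀, hfin₀⟩ := hfin₀
  obtain ⟨q₁, y₁, hy₁, hfin₁⟩ := hfin₁
  obtain ⟨C₀, hC₀⟩ := EmbDim.exists_orbitBound hfin₀
  obtain ⟨C₁, hC₁⟩ := EmbDim.exists_orbitBound hfin₁
  obtain ⟨c, hc⟩ := EmbDim.exists_delta0At_le hω τ hemb h₀ h₁ (hx.polyDense τ) hy₀ hy₁ hspan hC₀ hC₁
  have hlim := continuous_coe_real_ereal.tendsto _ |>.comp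
    (EmbDim.tendsto_dimension_bound (C₀ + C₁) (2 * n + 1) c)
  have e : 1 + 2 * (n : EReal) = ((2 * n + 1 : ℝ) : EReal) := by
    rw [add_comm]
    norm_cast
  rw [e, ← hlim.limsup_eq]
  refine limsup_le_limsup ?_
  filter_upwards [Ioo_mem_nhdsGT zero_lt_one] with δ hδ
  exact iSup₂_le fun R _ => iSup₂_le fun ξ _ => hc δ hδ R ξ
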